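/- Let $N\ge 1$ and let $G=G(x,t)$ be a real function on $\mathbf R^N\times(0,\infty)$ such that, for some $\gamma\in\{1,2,\dots\}$, $d>0$ and $L>0$: (i) $G\in C^\gamma(\mathbf R^N\times(0,\infty))$; (ii) $G(x,t)=t^{-N/d}\,G(t^{-1/d}x,1)$ for $x\in\mathbf R^N$, $t>0$, and $\sup_{x}(1+|x|)^{N+L+j}|\nabla_x^jG(x,1)|<\infty$ for $j=0,\dots,\gamma$; (iii) $G(x,t)=\int_{\mathbf R^N}G(x-y,t-s)\,G(y,s)\,dy$ for $x\in\mathbf R^N$, $t>s>0$. Put $e^{t\mathcal L}\psi(x)=\int_{\mathbf R^N}G(x-y,t)\psi(y)\,dy$, $g(x,t)=G(x,t+1)$, $\|\cdot\|_q=\|\cdot\|_{L^q(\mathbf R^N)}$, and for $k\ge0$ let $L^1_k=L^1(\mathbf R^N,(1+|x|^k)dx)$ with norm $|||f|||_k=\int_{\mathbf R^N}|f(x)|(1+|x|^k)\,dx$. Let $0\le K<1$, $K<L$, $\lfloor K\rfloor+1\le\gamma$ and $\varphi\in L^\infty(\mathbf R^N)\cap L^1_K$. Let $F:\mathbf R^N\times(0,\infty)\times\mathbf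 R\to\mathbf R$, with $(x,t)\mapsto F(x,t,v)$ measurable for each $v$, satisfy $F(x,t,0)=0$ and $$|F(x,t,v_1)-F(x,t,v_2)|\le C_*(1+t)^A\max\{|v_1|^{p-1},|v_2|^{p-1}\}\,|v_1-v_2|$$ for all $x\in\mathbf R^N$, $t>0$, $v_1,v_2\in\mathbf R$, where $C_*>0$, $A\in\mathbf R$, $p\ge1$, and assume $$A_p:=-A+\frac{N(p-1)}d-1>0.$$ Let $u$ be a measurable function on $\mathbf R^N\times(0,\infty)$ such that, for every $t>0$, $$u(t)=e^{t\mathcal L}\varphi+\int_0^te^{(t-s)\mathcal L}F(\cdot,s,u(\cdot,s))\,ds\quad\text{a.e. in }\mathbf R^N,$$ and such that for all $q\in[1,\infty]$ and $\ell\in[0,K]$ $$\sup_{t>0}(1+t)^{\frac Nd(1-\frac1q)}\|u(t)\|_q+\sup_{t>0}(1+t)^{-\frac\ell d}|||u(t)|||_\ell<\infty .$$ Put $$M=\int_{\mathbf R^N}\varphi\,dx+\int_0^\infty\!\!\int_{\mathbf R^N}F(x,t,u(x,t))\,dx\,dt,\qquad f_M(x,t)=F(x,t,M\,g(x,t)),$$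 $$M'=\int_{\mathbf R^N}\varphi\,dx+\int_0^\infty\!\!\int_{\mathbf R^N}\bigl[F(x,t,u(x,t))-f_M(x,t)\bigr]dx\,dt,\qquad \tilde u(x,t)=M'g(x,t)+\int_0^te^{(t-s)\mathcal L}f_M(s)(x)\,ds .$$ Then all these integrals converge absolutely; if $G\not\equiv0$, then $M=\lim_{t\to\infty}\int_{\mathbf R^N}u(x,t)\,dx$; and for all $q\in[1,\infty]$ and $\ell\in[0,K]$ one has $u(t)-\tilde u(t)\in L^q\cap L^1_\ell$ for every $t>0$, and $$t^{\frac Nd(1-\frac1q)}\|u(t)-\tilde u(t)\|_q+t^{-\frac\ell d}|||u(t)-\tilde u(t)|||_\ell=\begin{cases}o(t^{-K/d})+O(t^{-2A_p})&\text{if }2A_p\ne K/d,\\ O(t^{-K/d}\log t)&\text{if }2A_p=K/d,\end{cases}$$ as $t\to\infty$. -/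

import Mathlib

open MeasureTheory Filter Asymptotics Set
open scoped ENNReal Topology

/-- The space `ℝ^N` with its Euclidean norm. -/
abbrev RN (N : ℕ) : Type := EuclideanSpace ℝ (Fin N)

/-- Lebesgue measure on `ℝ^N × (0, ∞)`. -/
noncomputable def spaceTime (N : ℕ) : Measure (RN N × ℝ) :=
  (volume : Measure (RN N)).prod ((volume : Measure ℝ).restrict (Ioi 0))

/-- Condition (G): `G = G(x,t)` is a generalized heat kernel on `ℝ^N × (0, ∞)`, of class `C^γ`,
self-similar of order `d`, with algebraic spatial decay governed by `L`, and with the semigroup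
property.  The values of `G x t` for `t ≤ 0` are irrelevant. -/
structure IsGeneralizedHeatKernel (N γ : ℕ) (d L : ℝ) (G : RN N → ℝ → ℝ) : Prop where
  one_le_gamma : 1 ≤ γ
  d_pos : 0 < d
  L_pos : 0 < L
  smooth : ContDiffOn ℝ (γ : WithTop ℕ∞) (fun z : RN N × ℝ => G z.1 z.2) (univ ×ˢ Ioi 0)
  selfSimilar : ∀ (x : RN N) (t : ℝ), 0 < t →
    G x t = t ^ (-((N : ℝ) / d)) * G ((t ^ (1 / d))⁻¹ • x) 1
  decay : ∀ j : ℕ, j ≤ γ → ∃ C : ℝ, ∀ x : RN N,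
    (1 + ‖x‖) ^ ((N : ℝ) + L + j) * ‖iteratedFDeriv ℝ j (fun y => G y 1) x‖ ≤ C
  semigroup : ∀ (x : RN N) (s t : ℝ), 0 < s → s < t →
    G x t = ∫ y, G (x - y) (t - s) * G y s

/-- `(e^{tℒ} φ)(x) = ∫ G(x - y, t) φ(y) dy`. -/
noncomputable def kernelSemigroup {N : ℕ} (G : RN N → ℝ → ℝ) (t : ℝ) (φ : RN N → ℝ)
    (x : RN N) : ℝ :=
  ∫ y, G (x - y) t * φ y

/-- `∫_0^t (e^{(t-s)ℒ} f(s))(x) ds`. -/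
noncomputable def duhamel {N : ℕ} (G f : RN N → ℝ → ℝ) (x : RN N) (t : ℝ) : ℝ :=
  ∫ s in (0 : ℝ)..t, kernelSemigroup G (t - s) (fun y => f y s) x

/-- Membership in the weighted space `L^1_k = L^1(ℝ^N, (1 + |x|^k) dx)`. -/
def MemWeightedL1 {N : ℕ} (k : ℝ) (f : RN N → ℝ) : Prop :=
  AEStronglyMeasurable f volume ∧ Integrable (fun x => |f x| * (1 + ‖x‖ ^ k)) volume

/-- The norm `|||f|||_k` of `L^1_k`. -/
noncomputable def weightedL1Norm {N : ℕ} (k : ℝ) (f : RN N → ℝ) : ℝ :=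
  ∫ x, |f x| * (1 + ‖x‖ ^ k)

/-- The norm `‖f‖_q` of `L^q(ℝ^N)`, as a real number (used for `f ∈ L^q` only). -/
noncomputable def lqNorm {N : ℕ} (q : ℝ≥0∞) (f : RN N → ℝ) : ℝ :=
  (eLpNorm f q volume).toReal

/-- The exponent `(N/d)(1 - 1/q)`, with `1/∞ = 0`. -/
noncomputable def lqExponent (N : ℕ) (d : ℝ) (q : ℝ≥0∞) : ℝ :=
  (N : ℝ) / d * (1 - (q⁻¹).toReal)

/-- The conditions on the nonlinearity `F = F(x,t,v)`: it is measurable in `(x,t)` and vanishes at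
`v = 0`, and it is locally Lipschitz in `v` with power growth. -/
structure IsPowerNonlinearity (N : ℕ) (Cstar A p : ℝ) (F : RN N → ℝ → ℝ → ℝ) : Prop where
  measurable : ∀ v : ℝ, AEStronglyMeasurable (fun z : RN N × ℝ => F z.1 z.2 v) (spaceTime N)
  zero : ∀ (x : RN N) (t : ℝ), 0 < t → F x t 0 = 0
  lipschitz : ∀ (x : RN N) (t : ℝ), 0 < t → ∀ v₁ v₂ : ℝ,
    |F x t v₁ - F x t v₂| ≤
      Cstar * (1 + t) ^ A * max (|v₁| ^ (p - 1)) (|v₂| ^ (p - 1)) * |v₁ - v₂|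

/-- `u` is a global-in-time solution of
`u(t) = e^{tℒ} φ + ∫_0^t e^{(t-s)ℒ} F(·, s, u(s)) ds`, `t > 0`. -/
structure IsGlobalSolution {N : ℕ} (G : RN N → ℝ → ℝ) (F : RN N → ℝ → ℝ → ℝ) (φ : RN N → ℝ)
    (u : RN N → ℝ → ℝ) : Prop where
  measurable : AEStronglyMeasurable (fun z : RN N × ℝ => u z.1 z.2) (spaceTime N)
  equation : ∀ t : ℝ, 0 < t → ∀ᵐ x : RN N,
    u x t = kernelSemigroup G t φ x + duhamel G (fun y s => F y s (u y s)) x t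

/-- The bound: for all `q ∈ [1,∞]` and `ℓ ∈ [0,K]`,
`sup_{t>0} (1+t)^{(N/d)(1-1/q)} ‖u(t)‖_q + sup_{t>0} (1+t)^{-ℓ/d} |||u(t)|||_ℓ < ∞`. -/
def HasHeatBounds {N : ℕ} (d K : ℝ) (u : RN N → ℝ → ℝ) : Prop :=
  ∀ (q : ℝ≥0∞) (l : ℝ), 1 ≤ q → 0 ≤ l → l ≤ K →
    (∃ C : ℝ, ∀ t : ℝ, 0 < t → MemLp (fun x => u x t) q volume ∧
      (1 + t) ^ lqExponent N d q * lqNorm q (fun x => u x t) ≤ C) ∧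
    (∃ C : ℝ, ∀ t : ℝ, 0 < t → MemWeightedL1 l (fun x => u x t) ∧
      (1 + t) ^ (-(l / d)) * weightedL1Norm l (fun x => u x t) ≤ C)

/-- `A_p = -A + N(p-1)/d - 1`. -/
noncomputable def decayRate (N : ℕ) (d A p : ℝ) : ℝ := -A + (N : ℝ) * (p - 1) / d - 1

/-- `g(x,t) = G(x, t+1)`. -/
def shiftedKernel {N : ℕ} (G : RN N → ℝ → ℝ) (x : RN N) (t : ℝ) : ℝ := G x (t + 1)

/-- `M = ∫ φ dx + ∫_0^∞ ∫ F(x,t,u(x,t)) dx dt`. -/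
noncomputable def limitMass {N : ℕ} (F : RN N → ℝ → ℝ → ℝ) (φ : RN N → ℝ)
    (u : RN N → ℝ → ℝ) : ℝ :=
  (∫ x, φ x) + ∫ t in Ioi (0 : ℝ), ∫ x, F x t (u x t)

/-- `f_M(x,t) = F(x, t, M g(x,t))`. -/
noncomputable def frozenSource {N : ℕ} (G : RN N → ℝ → ℝ) (F : RN N → ℝ → ℝ → ℝ) (φ : RN N → ℝ)
    (u : RN N → ℝ → ℝ) (x : RN N) (t : ℝ) : ℝ :=
  F x t (limitMass F φ u * shiftedKernel G x t)

/-- `M' = ∫ φ dx + ∫_0^∞ ∫ [F(x,t,u(x,t)) - f_M(x,t)] dx dt`. -/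
noncomputable def correctedMass {N : ℕ} (G : RN N → ℝ → ℝ) (F : RN N → ℝ → ℝ → ℝ)
    (φ : RN N → ℝ) (u : RN N → ℝ → ℝ) : ℝ :=
  (∫ x, φ x) + ∫ t in Ioi (0 : ℝ), ∫ x, (F x t (u x t) - frozenSource G F φ u x t)

/-- `ũ(x,t) = M' g(x,t) + ∫_0^t (e^{(t-s)ℒ} f_M(s))(x) ds`. -/
noncomputable def correctedProfile {N : ℕ} (G : RN N → ℝ → ℝ) (F : RN N → ℝ → ℝ → ℝ)
    (φ : RN N → ℝ) (u : RN N → ℝ → ℝ) (x : RN N) (t : ℝ) : ℝ :=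
  correctedMass G F φ u * shiftedKernel G x t + duhamel G (frozenSource G F φ u) x t

/-- `t^{(N/d)(1-1/q)} ‖w(t)‖_q + t^{-ℓ/d} |||w(t)|||_ℓ`. -/
noncomputable def scaledNorm {N : ℕ} (d : ℝ) (q : ℝ≥0∞) (l : ℝ) (w : RN N → ℝ → ℝ) (t : ℝ) : ℝ :=
  t ^ lqExponent N d q * lqNorm q (fun x => w x t)
    + t ^ (-(l / d)) * weightedL1Norm l (fun x => w x t)

/-! The argument compares a solution with a multiple of `g` at the level of the kernel. For data `φ`
and a source `h`, subtracting from `e^{tℒ}φ + ∫_0^t e^{(t-s)ℒ}h(s) ds` the total mass of `(φ, h)`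
times `g(t)` leaves exactly the integral of the defect `G(x-y,t-s) - G(x,t+1)` against `φ` (at `s =
0`) and `h`. All sizes are measured in one scaled norm, `ScaledBound`, which combines `L^1` with
weight `1 + t^{-K/d}|x|^K` and `t^{N/d}` times the sup norm. It controls every `‖·‖_q` and
`|||·|||_ℓ` in the statement.

For `s ≤ t/2` the defect has size `min(|y|t^{-1/d}, |y|^K t^{-K/d}) + (1+s)/t` by the mean value
theorem (`scaledBound_kernelDefect`). For `s > t/2` its two terms are estimated separately. If
`h(s)` has scaled size `(1+s)^{-b-1}`, early times contribute `t^{-K/d} ∫_0^{t/2} (1+s)^{K/d-b-1}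
ds` and late times `t^{-b}`. Hence the remainder is `O(t^{-b})` when `b < K/d`, acquires a logarithm
when `b = K/d`, and is `o(t^{-K/d})` when `b > K/d`, the last by dominated convergence
(`remainder_of_lt`, `remainder_of_eq`, `remainder_of_gt`).

This is used twice. With `h = F(u)` the rate is `b = A_p` and the remainder is `u - Mg`. By the
Lipschitz condition, a bound `t^{-r}` for `u - Mg` makes `F(u) - f_M` a source of rate `A_p + r`,
and `u - ũ` is exactly the remainder of that source. If `A_p < K/d`, then `r = A_p` and the second
application has `b = 2A_p`; if `A_p ≥ K/d`, a rate above `K/d` is available directly or after a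
small loss.

The term `(1+s)/t` is harmless only if `K < d`, which is not assumed but forced (`lt_order`). The
semigroup law and the moments of `G` give a nontrivial kernel unit mass (`mass_eq_one`) and time
increments `O(h^{κ/d})` for `κ < min(1, L)`. If `d ≤ K`, some such `κ` exceeds `d`, so `G` would be
constant in time, contradicting self-similarity. For `G = 0` on positive times the remainder
vanishes. -/

/-- The self-similar algebraic profile `t^{-N/d} (1 + t^{-1/d}|x|)^{-(N+L)}` dominating `G`. -/
noncomputable def algebraicProfile (N : ℕ) (d L : ℝ) (x : RN N) (t : ℝ) : ℝ :=
  t ^ (-((N : ℝ) / d)) * (1 + ‖(t ^ (1 / d))⁻¹ • x‖) ^ (-((N : ℝ) + L))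

/-- The scaled spatial weight `1 + t^{-K/d}|x|^K`. -/
noncomputable def spatialWeight {N : ℕ} (K d t : ℝ) (x : RN N) : ℝ :=
  1 + t ^ (-(K / d)) * ‖x‖ ^ K

/-! ### Algebraic profile and scaled spatial weight. -/

section Profile

variable {N : ℕ} {d L K : ℝ}

lemma algebraicProfile_nonneg (x : RN N) {t : ℝ} (ht : 0 < t) :
    0 ≤ algebraicProfile N d L x t := by
  unfold algebraicProfile; positivity

lemma algebraicProfile_le (hL : 0 < L) (x : RN N) {t : ℝ} (ht : 0 < t) :
    algebraicProfile N d L x t ≤ t ^ (-((N : ℝ) / d)) := by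
  unfold algebraicProfile
  have h1 : (1 + ‖(t ^ (1 / d))⁻¹ • x‖) ^ (-((N : ℝ) + L)) ≤ 1 :=
    Real.rpow_le_one_of_one_le_of_nonpos (by linarith [norm_nonneg ((t ^ (1 / d))⁻¹ • x)])
      (by have : (0 : ℝ) ≤ N := Nat.cast_nonneg N
          linarith)
  have h2 : 0 < t ^ (-((N : ℝ) / d)) := by positivity
  nlinarith

lemma spatialWeight_one_le (x : RN N) {t : ℝ} (ht : 0 < t) : 1 ≤ spatialWeight K d t x := by
  unfold spatialWeight
  have : 0 ≤ t ^ (-(K / d)) * ‖x‖ ^ K := by positivity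
  linarith

lemma spatialWeight_nonneg (x : RN N) {t : ℝ} (ht : 0 < t) : 0 ≤ spatialWeight K d t x :=
  zero_le_one.trans (spatialWeight_one_le x ht)

/-- Subadditivity of `r ↦ r^K` for `K ≤ 1` makes the weight submultiplicative, which is what lets it
pass through a convolution. -/
lemma spatialWeight_le_mul (hK0 : 0 ≤ K) (hK1 : K ≤ 1) (x y : RN N) {t : ℝ} (ht : 0 < t) :
    spatialWeight K d t x ≤ spatialWeight K d t (x - y) * spatialWeight K d t y := by
  unfold spatialWeight
  have h0 : ‖x‖ ≤ ‖x - y‖ + ‖y‖ := by simpa using norm_add_le (x - y) y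
  have h1 : ‖x‖ ^ K ≤ ‖x - y‖ ^ K + ‖y‖ ^ K :=
    (Real.rpow_le_rpow (norm_nonneg _) h0 hK0).trans
      (Real.rpow_add_le_add_rpow (norm_nonneg _) (norm_nonneg _) hK0 hK1)
  have h2 : 0 < t ^ (-(K / d)) := by positivity
  have h3 : 0 ≤ ‖x - y‖ ^ K := by positivity
  have h4 : 0 ≤ ‖y‖ ^ K := by positivity
  have h5 : 0 ≤ (t ^ (-(K / d)) * ‖x - y‖ ^ K) * (t ^ (-(K / d)) * ‖y‖ ^ K) := by positivity
  nlinarith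

lemma spatialWeight_antitone (hK0 : 0 ≤ K) (hd : 0 < d) (x : RN N) {s t : ℝ} (hs : 0 < s)
    (hst : s ≤ t) : spatialWeight K d t x ≤ spatialWeight K d s x := by
  unfold spatialWeight
  have h1 : t ^ (-(K / d)) ≤ s ^ (-(K / d)) :=
    Real.rpow_le_rpow_of_nonpos hs hst (by have := div_nonneg hK0 hd.le; linarith)
  have h2 : 0 ≤ ‖x‖ ^ K := by positivity
  nlinarith

/-- Enlarging the time by a factor `c` costs a factor `c^{K/d}` in the weight. -/
lemma spatialWeight_le_of_le_mul (hK0 : 0 ≤ K) (hd : 0 < d) (x : RN N) {s t c : ℝ} (hs : 0 < s)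
    (ht : 0 < t) (hc : 1 ≤ c) (hst : s ≤ c * t) :
    spatialWeight K d t x ≤ c ^ (K / d) * spatialWeight K d s x := by
  unfold spatialWeight
  have hKd : 0 ≤ K / d := div_nonneg hK0 hd.le
  have h1 : t ^ (-(K / d)) ≤ c ^ (K / d) * s ^ (-(K / d)) := by
    have : (c * t) ^ (-(K / d)) ≤ s ^ (-(K / d)) :=
      Real.rpow_le_rpow_of_nonpos hs hst (by linarith)
    rw [Real.mul_rpow (by linarith) ht.le, Real.rpow_neg (by linarith) (K / d)] at this
    have hcp : 0 < c ^ (K / d) := by positivity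
    rwa [inv_mul_le_iff₀ hcp] at this
  have h2 : 0 ≤ ‖x‖ ^ K := by positivity
  have h3 : 1 ≤ c ^ (K / d) := Real.one_le_rpow hc hKd
  nlinarith

lemma measurable_spatialWeight (t : ℝ) : Measurable (spatialWeight (N := N) K d t) := by
  unfold spatialWeight; fun_prop

/-- Profiles at comparable times are comparable. -/
lemma algebraicProfile_le_of_comparable (hd : 0 < d) (hL : 0 < L) (x : RN N) {s t c : ℝ}
    (hs : 0 < s) (ht : 0 < t) (hst : s ≤ c * t) (hts : t ≤ c * s) :
    algebraicProfile N d L x s ≤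
      c ^ ((N : ℝ) / d) * (c ^ (1 / d)) ^ ((N : ℝ) + L) * algebraicProfile N d L x t := by
  unfold algebraicProfile
  have hN : (0 : ℝ) ≤ N := Nat.cast_nonneg N
  have hc : 0 < c := by
    by_contra h
    push Not at h
    nlinarith
  -- The two comparisons chain to `s ≤ c t ≤ c² s`.
  have hc1 : 1 ≤ c := by
    by_contra h
    push Not at h
    nlinarith
  have h1 : s ^ (-((N : ℝ) / d)) ≤ c ^ ((N : ℝ) / d) * t ^ (-((N : ℝ) / d)) := by
    have hNd : 0 ≤ (N : ℝ) / d := div_nonneg hN hd.le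
    have : (c * s) ^ (-((N : ℝ) / d)) ≤ t ^ (-((N : ℝ) / d)) :=
      Real.rpow_le_rpow_of_nonpos ht hts (by linarith)
    rw [Real.mul_rpow hc.le hs.le, Real.rpow_neg hc.le] at this
    have hcp : 0 < c ^ ((N : ℝ) / d) := by positivity
    rwa [inv_mul_le_iff₀ hcp] at this
  have h2 : (1 + ‖(s ^ (1 / d))⁻¹ • x‖) ^ (-((N : ℝ) + L)) ≤
      (c ^ (1 / d)) ^ ((N : ℝ) + L) * (1 + ‖(t ^ (1 / d))⁻¹ • x‖) ^ (-((N : ℝ) + L)) := by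
    have hcd : 1 ≤ c ^ (1 / d) := Real.one_le_rpow hc1 (by positivity)
    have hsd : 0 < s ^ (1 / d) := by positivity
    have htd : 0 < t ^ (1 / d) := by positivity
    have key : 1 + ‖(t ^ (1 / d))⁻¹ • x‖ ≤ c ^ (1 / d) * (1 + ‖(s ^ (1 / d))⁻¹ • x‖) := by
      rw [norm_smul, norm_smul, Real.norm_of_nonneg (by positivity),
        Real.norm_of_nonneg (by positivity)]
      have h3 : s ^ (1 / d) ≤ c ^ (1 / d) * t ^ (1 / d) := by
        rw [← Real.mul_rpow hc.le ht.le]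
        exact Real.rpow_le_rpow hs.le hst (by positivity)
      have h4 : (t ^ (1 / d))⁻¹ ≤ c ^ (1 / d) * (s ^ (1 / d))⁻¹ := by
        rw [← div_eq_mul_inv, le_div_iff₀ hsd, inv_mul_le_iff₀ htd]
        linarith
      nlinarith [norm_nonneg x]
    have h5 : (c ^ (1 / d) * (1 + ‖(s ^ (1 / d))⁻¹ • x‖)) ^ (-((N : ℝ) + L)) ≤
        (1 + ‖(t ^ (1 / d))⁻¹ • x‖) ^ (-((N : ℝ) + L)) :=
      Real.rpow_le_rpow_of_nonpos (by positivity) key (by linarith)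
    rw [Real.mul_rpow (by positivity) (by positivity), Real.rpow_neg (by positivity),
      inv_mul_le_iff₀ (by positivity)] at h5
    exact h5
  calc _ ≤ (c ^ ((N : ℝ) / d) * t ^ (-((N : ℝ) / d))) *
        ((c ^ (1 / d)) ^ ((N : ℝ) + L) * (1 + ‖(t ^ (1 / d))⁻¹ • x‖) ^ (-((N : ℝ) + L))) := by
        gcongr
    _ = _ := by ring

/-- Change of variables for the dilation `x ↦ R⁻¹ x`. -/
lemma lintegral_comp_inv_smul {R : ℝ} (hR : 0 < R) {f : RN N → ℝ≥0∞} (hf : Measurable f) :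
    ∫⁻ x, f (R⁻¹ • x) = ENNReal.ofReal (R ^ N) * ∫⁻ x, f x := by
  have h := Measure.map_addHaar_smul (volume : Measure (RN N)) (r := R⁻¹) (by positivity)
  rw [← lintegral_map hf (by fun_prop), h, lintegral_smul_measure]
  simp [abs_of_pos hR]

/-- The weighted integral of the profile does not depend on the time, and it is finite. -/
lemma lintegral_algebraicProfile_mul_spatialWeight (hK0 : 0 ≤ K)
    (hKL : K < L) : ∃ C : ℝ≥0∞, C ≠ ∞ ∧ ∀ t : ℝ, 0 < t →
      ∫⁻ x : RN N, ENNReal.ofReal (algebraicProfile N d L x t) *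
        ENNReal.ofReal (spatialWeight K d t x) ≤ C := by
  -- The witness is the integral at `t = 1`; scaling reduces every other time to it.
  refine ⟨∫⁻ x : RN N, ENNReal.ofReal ((1 + ‖x‖) ^ (-((N : ℝ) + L)) * (1 + ‖x‖ ^ K)), ?_, ?_⟩
  -- The weight costs `K` powers, and the remaining exponent `N + (L - K)` still exceeds the
  -- dimension.
  · have h1 : ∫⁻ x : RN N, ENNReal.ofReal ((1 + ‖x‖) ^ (-((N : ℝ) + (L - K)))) < ∞ :=
      finite_integral_one_add_norm (by simp; linarith)
    have h2 : ∫⁻ x : RN N, ENNReal.ofReal 2 *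
        ENNReal.ofReal ((1 + ‖x‖) ^ (-((N : ℝ) + (L - K)))) < ∞ := by
      rw [lintegral_const_mul' _ _ ENNReal.ofReal_ne_top]
      exact ENNReal.mul_lt_top ENNReal.ofReal_lt_top h1
    refine (lt_of_le_of_lt (lintegral_mono fun x => ?_) h2).ne
    rw [← ENNReal.ofReal_mul (by norm_num)]
    refine ENNReal.ofReal_le_ofReal ?_
    have hx : 0 ≤ ‖x‖ := norm_nonneg x
    have h3 : (1 + ‖x‖) ^ (-((N : ℝ) + (L - K))) = (1 + ‖x‖) ^ (-((N : ℝ) + L)) * (1 + ‖x‖) ^ K := by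
      rw [← Real.rpow_add (by positivity)]; ring_nf
    have h4 : ‖x‖ ^ K ≤ (1 + ‖x‖) ^ K := Real.rpow_le_rpow hx (by linarith) hK0
    have h5 : 1 ≤ (1 + ‖x‖) ^ K := Real.one_le_rpow (by linarith) hK0
    have h6 : 0 < (1 + ‖x‖) ^ (-((N : ℝ) + L)) := by positivity
    rw [h3]
    nlinarith
  · intro t ht
    have hR : 0 < t ^ (1 / d) := by positivity
    have e1 : ∀ x : RN N, ENNReal.ofReal (algebraicProfile N d L x t) *
        ENNReal.ofReal (spatialWeight K d t x) = ENNReal.ofReal (t ^ (-((N : ℝ) / d))) *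
        (fun z : RN N => ENNReal.ofReal ((1 + ‖z‖) ^ (-((N : ℝ) + L)) * (1 + ‖z‖ ^ K)))
          ((t ^ (1 / d))⁻¹ • x) := by
      intro x
      rw [← ENNReal.ofReal_mul (algebraicProfile_nonneg x ht), ← ENNReal.ofReal_mul (by positivity)]
      congr 1
      unfold algebraicProfile spatialWeight
      have : t ^ (-(K / d)) * ‖x‖ ^ K = ‖(t ^ (1 / d))⁻¹ • x‖ ^ K := by
        rw [norm_smul, Real.norm_of_nonneg (by positivity), Real.mul_rpow (by positivity)
          (norm_nonneg _), Real.inv_rpow (by positivity), ← Real.rpow_mul ht.le, Real.rpow_neg ht.le]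
        congr 3; ring
      rw [this]; ring
    rw [lintegral_congr e1, lintegral_const_mul' _ _ ENNReal.ofReal_ne_top,
      lintegral_comp_inv_smul (f := fun z : RN N => ENNReal.ofReal
        ((1 + ‖z‖) ^ (-((N : ℝ) + L)) * (1 + ‖z‖ ^ K))) hR (by fun_prop), ← mul_assoc, ← ENNReal.ofReal_mul (by positivity)]
    -- The amplitude of the profile cancels the Jacobian of the dilation.
    have : t ^ (-((N : ℝ) / d)) * (t ^ (1 / d)) ^ N = 1 := by
      rw [← Real.rpow_natCast, ← Real.rpow_mul ht.le, ← Real.rpow_add ht]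
      convert Real.rpow_zero t using 2
      ring
    rw [this]; simp

end Profile

/-! ### Pointwise bounds and increments of the kernel. -/

namespace IsGeneralizedHeatKernel

variable {N γ : ℕ} {d L : ℝ} {G : RN N → ℝ → ℝ} (hG : IsGeneralizedHeatKernel N γ d L G)
include hG

lemma differentiable_one : Differentiable ℝ (fun y : RN N => G y 1) := by
  have h := hG.smooth
  have h1 : DifferentiableOn ℝ (fun z : RN N × ℝ => G z.1 z.2) (univ ×ˢ Ioi 0) :=
    h.differentiableOn (by have := hG.one_le_gamma; simp; omega)
  intro x
  have h2 : DifferentiableAt ℝ (fun z : RN N × ℝ => G z.1 z.2) (x, 1) :=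
    (h1 (x, 1) (by simp)).differentiableAt ((isOpen_univ.prod isOpen_Ioi).mem_nhds (by simp))
  exact DifferentiableAt.comp x (f := fun y : RN N => (y, (1 : ℝ))) h2 (by fun_prop)

/-- The gradient keeps its extra power of decay because the time derivative of a self-similar kernel
contains the product of `x` with the gradient. -/
lemma decay_one : ∃ C : ℝ, 0 < C ∧ (∀ x, |G x 1| ≤ C * (1 + ‖x‖) ^ (-((N : ℝ) + L))) ∧
    ∀ x, (1 + ‖x‖) * ‖fderiv ℝ (fun y => G y 1) x‖ ≤ C * (1 + ‖x‖) ^ (-((N : ℝ) + L)) := by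
  obtain ⟨C0, h0⟩ := hG.decay 0 (Nat.zero_le _)
  obtain ⟨C1, h1⟩ := hG.decay 1 hG.one_le_gamma
  refine ⟨max (max C0 C1) 1, by positivity, fun x => ?_, fun x => ?_⟩
  · have hx : 0 < 1 + ‖x‖ := by positivity
    have := h0 x
    rw [norm_iteratedFDeriv_zero] at this
    rw [Real.rpow_neg hx.le, ← div_eq_mul_inv, le_div_iff₀ (by positivity), mul_comm]
    simp only [CharP.cast_eq_zero, add_zero, Real.norm_eq_abs] at this
    exact this.trans (by simp)
  · have hx : 0 < 1 + ‖x‖ := by positivity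
    have := h1 x
    rw [norm_iteratedFDeriv_one, Nat.cast_one, Real.rpow_add hx, Real.rpow_one] at this
    rw [Real.rpow_neg hx.le, ← div_eq_mul_inv, le_div_iff₀ (by positivity)]
    calc _ = (1 + ‖x‖) ^ ((N : ℝ) + L) * (1 + ‖x‖) * ‖fderiv ℝ (fun y => G y 1) x‖ := by ring
      _ ≤ C1 := this
      _ ≤ _ := by simp

lemma abs_le_profile : ∃ C : ℝ, 0 < C ∧ ∀ (x : RN N) (t : ℝ), 0 < t →
    |G x t| ≤ C * algebraicProfile N d L x t := by
  obtain ⟨C, hC, h, -⟩ := hG.decay_one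
  refine ⟨C, hC, fun x t ht => ?_⟩
  rw [hG.selfSimilar x t ht, abs_mul, abs_of_pos (by positivity)]
  unfold algebraicProfile
  have := h ((t ^ (1 / d))⁻¹ • x)
  have ht' : 0 < t ^ (-((N : ℝ) / d)) := by positivity
  nlinarith

/-- Spatial increments of the kernel. -/
lemma abs_sub_le_space : ∃ C : ℝ, 0 < C ∧ ∀ (x y : RN N) (t : ℝ), 0 < t → ‖y‖ ≤ t ^ (1 / d) →
    |G (x - y) t - G x t| ≤ C * (‖y‖ * t ^ (-(1 / d))) * algebraicProfile N d L x t := by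
  obtain ⟨C, hC, -, h⟩ := hG.decay_one
  have hN : (0 : ℝ) ≤ N := Nat.cast_nonneg N
  have hL := hG.L_pos
  -- By self-similarity it is enough to work at time one. There the mean value inequality is applied
  -- on the unit ball around `x`, where `1 + ‖x‖ ≤ 2 (1 + ‖z‖)`.
  have one : ∀ x y : RN N, ‖y‖ ≤ 1 → |G (x - y) 1 - G x 1| ≤
      C * 2 ^ ((N : ℝ) + L) * ‖y‖ * (1 + ‖x‖) ^ (-((N : ℝ) + L)) := by
    intro x y hy
    have hb : ∀ z ∈ Metric.closedBall x 1, ‖fderiv ℝ (fun y => G y 1) z‖ ≤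
        C * 2 ^ ((N : ℝ) + L) * (1 + ‖x‖) ^ (-((N : ℝ) + L)) := by
      intro z hz
      have hz1 : ‖x‖ ≤ ‖z‖ + 1 := by
        have h3 := norm_sub_norm_le x z
        rw [Metric.mem_closedBall, dist_comm, dist_eq_norm] at hz
        linarith
      have h2 := h z
      have hz0 := norm_nonneg z
      have h3 : ‖fderiv ℝ (fun y => G y 1) z‖ ≤ (1 + ‖z‖) * ‖fderiv ℝ (fun y => G y 1) z‖ := by
        nlinarith [norm_nonneg (fderiv ℝ (fun y => G y 1) z)]
      have h4 : (1 + ‖z‖) ^ (-((N : ℝ) + L)) ≤ 2 ^ ((N : ℝ) + L) * (1 + ‖x‖) ^ (-((N : ℝ) + L)) := by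
        have h5 : (2 * (1 + ‖z‖)) ^ (-((N : ℝ) + L)) ≤ (1 + ‖x‖) ^ (-((N : ℝ) + L)) :=
          Real.rpow_le_rpow_of_nonpos (by positivity) (by linarith) (by linarith)
        rwa [Real.mul_rpow (by positivity) (by positivity), Real.rpow_neg (by positivity),
          inv_mul_le_iff₀ (by positivity)] at h5
      calc _ ≤ _ := h3.trans h2
        _ ≤ C * (2 ^ ((N : ℝ) + L) * (1 + ‖x‖) ^ (-((N : ℝ) + L))) := by gcongr
        _ = _ := by ring
    have := (convex_closedBall x 1).norm_image_sub_le_of_norm_fderiv_le (𝕜 := ℝ)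
      (f := fun y => G y 1) (fun z _ => hG.differentiable_one z) hb
      (Metric.mem_closedBall_self zero_le_one)
      (show x - y ∈ Metric.closedBall x 1 by simpa using hy)
    rw [Real.norm_eq_abs] at this
    refine this.trans (le_of_eq ?_)
    simp only [sub_sub_cancel_left, norm_neg]
    ring
  refine ⟨C * 2 ^ ((N : ℝ) + L), by positivity, fun x y t ht hy => ?_⟩
  have hR : 0 < t ^ (1 / d) := by positivity
  rw [hG.selfSimilar x t ht, hG.selfSimilar (x - y) t ht, ← mul_sub, abs_mul,
    abs_of_pos (by positivity), smul_sub]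
  have hny : ‖(t ^ (1 / d))⁻¹ • y‖ = ‖y‖ * t ^ (-(1 / d)) := by
    rw [norm_smul, Real.norm_of_nonneg (by positivity), Real.rpow_neg ht.le, mul_comm]
  have h1 := one ((t ^ (1 / d))⁻¹ • x) ((t ^ (1 / d))⁻¹ • y) (by
    rw [norm_smul, Real.norm_of_nonneg (by positivity), inv_mul_le_iff₀ hR]; linarith)
  rw [hny] at h1
  unfold algebraicProfile
  calc _ ≤ t ^ (-((N : ℝ) / d)) * (C * 2 ^ ((N : ℝ) + L) * (‖y‖ * t ^ (-(1 / d))) *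
        (1 + ‖(t ^ (1 / d))⁻¹ • x‖) ^ (-((N : ℝ) + L))) := by gcongr
    _ = _ := by ring

/-- Differentiating the self-similar formula expresses the time derivative through `G(·,1)` and its
gradient, the only functions whose decay is assumed. -/
lemma hasDerivAt_time (x : RN N) {r : ℝ} (hr : 0 < r) :
    HasDerivAt (fun r => G x r)
      (-((N : ℝ) / d) * r ^ (-((N : ℝ) / d) - 1) * G ((r ^ (1 / d))⁻¹ • x) 1 +
        r ^ (-((N : ℝ) / d)) * (fderiv ℝ (fun y => G y 1) ((r ^ (1 / d))⁻¹ • x)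
          ((-(1 / d) * r ^ (-(1 / d) - 1)) • x))) r := by
  have h1 : HasDerivAt (fun r : ℝ => r ^ (-((N : ℝ) / d))) (-((N : ℝ) / d) *
      r ^ (-((N : ℝ) / d) - 1)) r := Real.hasDerivAt_rpow_const (Or.inl hr.ne')
  have h2 : HasDerivAt (fun r : ℝ => r ^ (-(1 / d))) (-(1 / d) * r ^ (-(1 / d) - 1)) r :=
    Real.hasDerivAt_rpow_const (Or.inl hr.ne')
  have h3 : HasDerivAt (fun r : ℝ => r ^ (-(1 / d)) • x) ((-(1 / d) * r ^ (-(1 / d) - 1)) • x) r :=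
    h2.smul_const x
  have h4 := (hG.differentiable_one (r ^ (-(1 / d)) • x)).hasFDerivAt.comp_hasDerivAt r h3
  have h5 := h1.mul h4
  simp only [Function.comp, Real.rpow_neg hr.le (1 / d)] at h5
  refine h5.congr_of_eventuallyEq ?_
  filter_upwards [lt_mem_nhds hr] with s hs
  simp only [Pi.mul_apply, Function.comp, Real.rpow_neg hs.le (1 / d)]
  exact hG.selfSimilar x s hs

/-- Temporal increments of the kernel. -/
lemma abs_sub_le_time : ∃ C : ℝ, 0 < C ∧ ∀ (x : RN N) (t t' : ℝ), 0 < t → t / 2 ≤ t' → t' ≤ 2 * t →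
    |G x t' - G x t| ≤ C * (|t' - t| / t) * algebraicProfile N d L x t := by
  obtain ⟨C, hC, h0, h⟩ := hG.decay_one
  have hN : (0 : ℝ) ≤ N := Nat.cast_nonneg N
  have hL := hG.L_pos
  have hd := hG.d_pos
  set c : ℝ := 2 ^ ((N : ℝ) / d) * (2 ^ (1 / d)) ^ ((N : ℝ) + L) with hc
  have hc0 : 0 < c := by positivity
  -- The leading `2` comes from `r⁻¹ ≤ 2 t⁻¹`, and `c` from comparing the profiles at times within a
  -- factor two.
  refine ⟨2 * (((N : ℝ) / d + 1 / d) * C) * c, by positivity, fun x t t' ht h1 h2 => ?_⟩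
  have hb : ∀ r ∈ Icc (t / 2) (2 * t),
      ‖(-((N : ℝ) / d) * r ^ (-((N : ℝ) / d) - 1) * G ((r ^ (1 / d))⁻¹ • x) 1 +
        r ^ (-((N : ℝ) / d)) * (fderiv ℝ (fun y => G y 1) ((r ^ (1 / d))⁻¹ • x)
          ((-(1 / d) * r ^ (-(1 / d) - 1)) • x)))‖ ≤
      2 * (((N : ℝ) / d + 1 / d) * C) * c * t⁻¹ * algebraicProfile N d L x t := by
    intro r hr
    have hr0 : 0 < r := by linarith [hr.1]
    have e0 : (0 : ℝ) < r ^ (-((N : ℝ) / d)) := by positivity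
    have e1 : r ^ (-((N : ℝ) / d) - 1) = r ^ (-((N : ℝ) / d)) * r⁻¹ := by
      rw [Real.rpow_sub_one hr0.ne', div_eq_mul_inv]
    -- The velocity of `r^{-1/d} x` is a multiple of that vector itself, so the gradient is only
    -- paired with its own base point, where its additional decay absorbs the factor `‖ξ‖`.
    have e2 : (-(1 / d) * r ^ (-(1 / d) - 1)) • x = (-(1 / d) * r⁻¹) • ((r ^ (1 / d))⁻¹ • x) := by
      rw [smul_smul, Real.rpow_sub_one hr0.ne', div_eq_mul_inv, Real.rpow_neg hr0.le]
      congr 1; ring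
    set ξ := (r ^ (1 / d))⁻¹ • x with hξ
    have g0 := h0 ξ
    have g1 := h ξ
    have hξ0 := norm_nonneg ξ
    rw [e1, e2, map_smul]
    have k1 : |(fderiv ℝ (fun y => G y 1) ξ) ξ| ≤ C * (1 + ‖ξ‖) ^ (-((N : ℝ) + L)) := by
      have := (fderiv ℝ (fun y => G y 1) ξ).le_opNorm ξ
      rw [Real.norm_eq_abs] at this
      nlinarith [norm_nonneg (fderiv ℝ (fun y => G y 1) ξ)]
    have k2 : algebraicProfile N d L x r = r ^ (-((N : ℝ) / d)) * (1 + ‖ξ‖) ^ (-((N : ℝ) + L)) := rfl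
    have k3 := algebraicProfile_le_of_comparable (N := N) (c := 2) hd hL x hr0 ht hr.2
      (by linarith [hr.1])
    have k4 : r⁻¹ ≤ 2 * t⁻¹ := by
      rw [← div_eq_mul_inv, le_div_iff₀ ht, inv_mul_le_iff₀ hr0]; linarith [hr.1]
    calc _ ≤ ‖-((N : ℝ) / d) * (r ^ (-((N : ℝ) / d)) * r⁻¹) * G ξ 1‖ +
          ‖r ^ (-((N : ℝ) / d)) * ((-(1 / d) * r⁻¹) • (fderiv ℝ (fun y => G y 1) ξ) ξ)‖ :=
          norm_add_le _ _
      _ = (N : ℝ) / d * (r ^ (-((N : ℝ) / d)) * r⁻¹) * |G ξ 1| +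
          r ^ (-((N : ℝ) / d)) * (1 / d * r⁻¹ * |(fderiv ℝ (fun y => G y 1) ξ) ξ|) := by
          simp only [norm_mul, norm_neg, norm_smul, Real.norm_eq_abs, abs_inv, abs_div,
            abs_of_pos hr0, abs_of_pos hd, abs_of_pos e0, Nat.abs_cast, abs_one]
      _ ≤ (N : ℝ) / d * (r ^ (-((N : ℝ) / d)) * r⁻¹) * (C * (1 + ‖ξ‖) ^ (-((N : ℝ) + L))) +
          r ^ (-((N : ℝ) / d)) * (1 / d * r⁻¹ * (C * (1 + ‖ξ‖) ^ (-((N : ℝ) + L)))) := by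
          gcongr
      _ = r⁻¹ * (((N : ℝ) / d + 1 / d) * C) * algebraicProfile N d L x r := by rw [k2]; ring
      _ ≤ (2 * t⁻¹) * (((N : ℝ) / d + 1 / d) * C) * (c * algebraicProfile N d L x t) := by
          gcongr
          exact algebraicProfile_nonneg x hr0
      _ = _ := by ring
  have := (convex_Icc (t / 2) (2 * t)).norm_image_sub_le_of_norm_hasDerivWithin_le
    (fun r hr => (hG.hasDerivAt_time x (by linarith [hr.1])).hasDerivWithinAt) hb
    (show t ∈ Icc (t / 2) (2 * t) by constructor <;> linarith) (show t' ∈ _ from ⟨h1, h2⟩)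
  rw [Real.norm_eq_abs, Real.norm_eq_abs] at this
  refine this.trans (le_of_eq ?_)
  rw [div_eq_mul_inv]; ring

end IsGeneralizedHeatKernel

/-! ### Integral properties of the kernel: moments, mass and order. -/

/-- The kernel extended by zero to nonpositive times. -/
noncomputable def positiveKernel {N : ℕ} (G : RN N → ℝ → ℝ) (z : RN N × ℝ) : ℝ :=
  (univ ×ˢ Ioi (0 : ℝ)).indicator (fun z : RN N × ℝ => G z.1 z.2) z

lemma positiveKernel_of_pos {N : ℕ} (G : RN N → ℝ → ℝ) (x : RN N) {t : ℝ} (ht : 0 < t) :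
    positiveKernel G (x, t) = G x t := by
  simp [positiveKernel, ht]

lemma positiveKernel_of_nonpos {N : ℕ} (G : RN N → ℝ → ℝ) (x : RN N) {t : ℝ} (ht : t ≤ 0) :
    positiveKernel G (x, t) = 0 := by
  simp [positiveKernel, ht]

namespace IsGeneralizedHeatKernel

variable {N γ : ℕ} {d L K : ℝ} {G : RN N → ℝ → ℝ} (hG : IsGeneralizedHeatKernel N γ d L G)
include hG

/-- Continuity for positive times gives joint measurability of the extension. Tonelli can then be
used over all of space-time, without carrying the restriction `s < t`. -/
lemma measurable_positiveKernel : Measurable (positiveKernel G) := by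
  have h := hG.smooth.continuousOn
  have hs : MeasurableSet (univ ×ˢ Ioi (0 : ℝ) : Set (RN N × ℝ)) :=
    MeasurableSet.univ.prod measurableSet_Ioi
  classical
  have := h.measurable_piecewise (g := fun _ => 0) continuousOn_const hs
  convert this using 1
  ext z
  simp [positiveKernel, Set.indicator, Set.piecewise]

lemma continuous_slice {t : ℝ} (ht : 0 < t) : Continuous (fun x : RN N => G x t) := by
  have h := hG.smooth.continuousOn
  exact h.comp_continuous (f := fun x : RN N => (x, t)) (by fun_prop) (by simp [ht])

/-- The weight at `x` splits into weights at `x - y` and at `y`. Since the weight decreases in time,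
`s ≤ t` allows the factor at `x - y` to be taken at time `s`, the scale of the kernel; this makes
the constant uniform. -/
lemma lintegral_kernel_mul_spatialWeight (hK0 : 0 ≤ K) (hK1 : K ≤ 1) (hKL : K < L) :
    ∃ C : ℝ≥0∞, C ≠ ∞ ∧ ∀ (s t : ℝ) (y : RN N), 0 < s → s ≤ t →
      ∫⁻ x, ‖G (x - y) s‖ₑ * ENNReal.ofReal (spatialWeight K d t x) ≤
        C * ENNReal.ofReal (spatialWeight K d t y) := by
  obtain ⟨C₁, hC₁, h1⟩ := hG.abs_le_profile
  obtain ⟨C₂, hC₂, h2⟩ := lintegral_algebraicProfile_mul_spatialWeight (N := N) (d := d)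
    hK0 hKL
  refine ⟨ENNReal.ofReal C₁ * C₂, ENNReal.mul_ne_top ENNReal.ofReal_ne_top hC₂, ?_⟩
  intro s t y hs hst
  have ht := hs.trans_le hst
  have key : ∀ x, ‖G (x - y) s‖ₑ * ENNReal.ofReal (spatialWeight K d t x) ≤
      ENNReal.ofReal C₁ * ENNReal.ofReal (spatialWeight K d t y) *
        (fun x => ENNReal.ofReal (algebraicProfile N d L x s) *
          ENNReal.ofReal (spatialWeight K d s x)) (x - y) := by
    intro x
    have e1 : ‖G (x - y) s‖ₑ ≤ ENNReal.ofReal C₁ *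
        ENNReal.ofReal (algebraicProfile N d L (x - y) s) := by
      rw [← ENNReal.ofReal_mul hC₁.le, Real.enorm_eq_ofReal_abs]
      exact ENNReal.ofReal_le_ofReal (h1 _ _ hs)
    have e2 : ENNReal.ofReal (spatialWeight K d t x) ≤
        ENNReal.ofReal (spatialWeight K d s (x - y)) * ENNReal.ofReal (spatialWeight K d t y) := by
      rw [← ENNReal.ofReal_mul (spatialWeight_nonneg _ hs)]
      refine ENNReal.ofReal_le_ofReal ((spatialWeight_le_mul hK0 hK1 x y ht).trans ?_)
      exact mul_le_mul_of_nonneg_right (spatialWeight_antitone hK0 hG.d_pos _ hs hst)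
        (spatialWeight_nonneg _ ht)
    calc _ ≤ _ := mul_le_mul' e1 e2
      _ = _ := by ring
  calc _ ≤ _ := lintegral_mono key
    _ = ENNReal.ofReal C₁ * ENNReal.ofReal (spatialWeight K d t y) *
        ∫⁻ x : RN N, ENNReal.ofReal (algebraicProfile N d L x s) *
          ENNReal.ofReal (spatialWeight K d s x) := by
        rw [lintegral_const_mul' _ _ (by finiteness)]
        congr 1
        exact lintegral_sub_right_eq_self (fun x => ENNReal.ofReal (algebraicProfile N d L x s) *
          ENNReal.ofReal (spatialWeight K d s x)) y
    _ ≤ ENNReal.ofReal C₁ * ENNReal.ofReal (spatialWeight K d t y) * C₂ := by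
        gcongr; exact h2 s hs
    _ = _ := by ring

/-- The sup bound for the kernel. -/
lemma abs_le_rpow : ∃ C : ℝ, 0 < C ∧ ∀ (x : RN N) (t : ℝ), 0 < t →
    |G x t| ≤ C * t ^ (-((N : ℝ) / d)) := by
  obtain ⟨C, hC, h⟩ := hG.abs_le_profile
  exact ⟨C, hC, fun x t ht => (h x t ht).trans
    (mul_le_mul_of_nonneg_left (algebraicProfile_le hG.L_pos x ht) hC.le)⟩

/-- Moments of order `κ < L` of the kernel. -/
lemma moment_le {κ : ℝ} (hκ0 : 0 ≤ κ) (hκ1 : κ ≤ 1) (hκL : κ < L) : ∃ C : ℝ, 0 ≤ C ∧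
    ∀ s : ℝ, 0 < s → Integrable (fun y : RN N => ‖y‖ ^ κ * |G y s|) ∧
      ∫ y : RN N, ‖y‖ ^ κ * |G y s| ≤ C * s ^ (κ / d) := by
  obtain ⟨C, hC, h⟩ := hG.lintegral_kernel_mul_spatialWeight hκ0 hκ1 hκL
  refine ⟨(C * 2).toReal, by positivity, fun s hs => ?_⟩
  have h1 := h s s 0 hs le_rfl
  simp only [sub_zero] at h1
  have hc := (hG.continuous_slice hs)
  have hm : AEStronglyMeasurable (fun y : RN N => ‖y‖ ^ κ * |G y s|) volume :=
    (((by fun_prop : Measurable (fun y : RN N => ‖y‖ ^ κ)).mul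
      (hc.measurable.abs))).aestronglyMeasurable
  -- Because `0 ^ 0 = 1` for real powers, the weight at the origin equals `2` when `κ = 0` and `1`
  -- otherwise.
  have hW : ENNReal.ofReal (spatialWeight κ d s (0 : RN N)) ≤ 2 := by
    unfold spatialWeight
    rcases eq_or_ne κ 0 with rfl | hk
    · simp; norm_num
    · simp [Real.zero_rpow hk]
  have key : ∫⁻ y : RN N, ‖‖y‖ ^ κ * |G y s|‖ₑ ≤ ENNReal.ofReal (s ^ (κ / d)) * (C * 2) := by
    calc _ ≤ ∫⁻ y : RN N, ENNReal.ofReal (s ^ (κ / d)) *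
          (‖G y s‖ₑ * ENNReal.ofReal (spatialWeight κ d s y)) := by
          refine lintegral_mono fun y => ?_
          rw [enorm_mul, Real.enorm_abs, Real.enorm_eq_ofReal (by positivity)]
          have : ENNReal.ofReal (‖y‖ ^ κ) ≤ ENNReal.ofReal (s ^ (κ / d)) *
              ENNReal.ofReal (spatialWeight κ d s y) := by
            rw [← ENNReal.ofReal_mul (by positivity)]
            refine ENNReal.ofReal_le_ofReal ?_
            unfold spatialWeight
            rw [mul_add, mul_one, ← mul_assoc, Real.rpow_neg hs.le,
              mul_inv_cancel₀ (by positivity), one_mul]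
            have : 0 < s ^ (κ / d) := by positivity
            linarith
          calc _ ≤ _ := mul_le_mul_left this _
            _ = _ := by ring
      _ = ENNReal.ofReal (s ^ (κ / d)) *
          ∫⁻ y : RN N, ‖G y s‖ₑ * ENNReal.ofReal (spatialWeight κ d s y) :=
          lintegral_const_mul' _ _ ENNReal.ofReal_ne_top
      _ ≤ _ := by gcongr; exact h1.trans (by gcongr)
  have hfin : ENNReal.ofReal (s ^ (κ / d)) * (C * 2) ≠ ∞ := by finiteness
  refine ⟨⟨hm, lt_of_le_of_lt key hfin.lt_top⟩, ?_⟩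
  rw [integral_eq_lintegral_of_nonneg_ae (Eventually.of_forall fun y => by positivity) hm]
  have e : ∀ y : RN N, ENNReal.ofReal (‖y‖ ^ κ * |G y s|) = ‖‖y‖ ^ κ * |G y s|‖ₑ := fun y =>
    (Real.enorm_eq_ofReal (by positivity)).symm
  simp_rw [e]
  have h5 := ENNReal.toReal_mono hfin key
  rw [ENNReal.toReal_mul, ENNReal.toReal_ofReal (by positivity)] at h5
  linarith

lemma integrable_slice {t : ℝ} (ht : 0 < t) : Integrable (fun x : RN N => G x t) := by
  obtain ⟨C, -, h⟩ := hG.moment_le (κ := 0) le_rfl zero_le_one hG.L_pos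
  have := (h t ht).1
  simp only [Real.rpow_zero, one_mul] at this
  exact (integrable_norm_iff (hG.continuous_slice ht).aestronglyMeasurable).1 this

/-- The mass of the kernel does not depend on the time. -/
lemma mass_eq {t : ℝ} (ht : 0 < t) : ∫ x, G x t = ∫ x, G x 1 := by
  have hR : 0 < t ^ (1 / d) := by positivity
  calc ∫ x, G x t = ∫ x, t ^ (-((N : ℝ) / d)) * G ((t ^ (1 / d))⁻¹ • x) 1 := by
        congr 1; ext x; exact hG.selfSimilar x t ht
    _ = t ^ (-((N : ℝ) / d)) * ((t ^ (1 / d)) ^ N * ∫ x, G x 1) := by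
        rw [integral_const_mul, Measure.integral_comp_smul volume (fun x => G x 1)]
        rw [finrank_euclideanSpace_fin, inv_pow, inv_inv, abs_of_pos (by positivity), smul_eq_mul]
    _ = _ := by
        rw [← mul_assoc, ← Real.rpow_natCast, ← Real.rpow_mul ht.le, ← Real.rpow_add ht]
        have : -((N : ℝ) / d) + 1 / d * N = 0 := by ring
        rw [this, Real.rpow_zero, one_mul]

/-- Hölder bound for spatial increments at times `t ≥ 1`. -/
lemma abs_sub_le_holder {κ : ℝ} (hκ0 : 0 ≤ κ) (hκ1 : κ ≤ 1) : ∃ C : ℝ, 0 ≤ C ∧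
    ∀ (x y : RN N) (t : ℝ), 1 ≤ t → |G (x - y) t - G x t| ≤ C * ‖y‖ ^ κ := by
  obtain ⟨C₁, hC₁, h1⟩ := hG.abs_sub_le_space
  obtain ⟨C₂, hC₂, h2⟩ := hG.abs_le_rpow
  have hd := hG.d_pos
  refine ⟨C₁ + 2 * C₂, by positivity, fun x y t ht => ?_⟩
  have ht0 : 0 < t := by linarith
  have htN : t ^ (-((N : ℝ) / d)) ≤ 1 := Real.rpow_le_one_of_one_le_of_nonpos ht
    (by have : 0 ≤ (N : ℝ) / d := by positivity
        linarith)
  -- Short increments use the first-order bound and `‖y‖ ≤ ‖y‖^κ`; long ones use the sup bound twice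
  -- and `1 ≤ ‖y‖^κ`.
  rcases le_or_gt ‖y‖ 1 with hy | hy
  · have h3 := h1 x y t ht0 (hy.trans (Real.one_le_rpow ht (by positivity)))
    have h4 := (algebraicProfile_le (N := N) (d := d) hG.L_pos x ht0).trans htN
    have h5 := algebraicProfile_nonneg (N := N) (d := d) (L := L) x ht0
    have h6 : t ^ (-(1 / d)) ≤ 1 := Real.rpow_le_one_of_one_le_of_nonpos ht
      (by have : 0 ≤ 1 / d := by positivity
          linarith)
    have h7 : ‖y‖ ≤ ‖y‖ ^ κ := by
      conv_lhs => rw [← Real.rpow_one ‖y‖]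
      rcases eq_or_lt_of_le (norm_nonneg y) with h0 | h0
      · rw [← h0, Real.zero_rpow one_ne_zero]; positivity
      · exact Real.rpow_le_rpow_of_exponent_ge h0 hy hκ1
    calc _ ≤ _ := h3
      _ ≤ C₁ * (‖y‖ ^ κ * 1) * 1 := by gcongr
      _ ≤ _ := by
        have : 0 ≤ ‖y‖ ^ κ := by positivity
        nlinarith
  · have h3 := h2 (x - y) t ht0
    have h4 := h2 x t ht0
    have h5 : 1 ≤ ‖y‖ ^ κ := Real.one_le_rpow hy.le hκ0
    calc _ ≤ |G (x - y) t| + |G x t| := abs_sub _ _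
      _ ≤ C₂ * 1 + C₂ * 1 := by
        refine add_le_add (h3.trans ?_) (h4.trans ?_) <;> gcongr
      _ ≤ _ := by nlinarith

/-- The semigroup property makes the kernel an approximate identity, with a rate. -/
lemma abs_sub_mass_mul_le {κ : ℝ} (hκ0 : 0 ≤ κ) (hκ1 : κ ≤ 1) (hκL : κ < L) : ∃ C : ℝ,
    ∀ (x : RN N) (t h : ℝ), 1 ≤ t → 0 < h →
      |G x (t + h) - (∫ y, G y 1) * G x t| ≤ C * h ^ (κ / d) := by
  obtain ⟨C₁, hC₁, h1⟩ := hG.abs_sub_le_holder hκ0 hκ1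
  obtain ⟨C₂, hC₂, h2⟩ := hG.moment_le hκ0 hκ1 hκL
  obtain ⟨C₃, hC₃, h3⟩ := hG.abs_le_rpow
  refine ⟨C₁ * C₂, fun x t h ht hh => ?_⟩
  have ht0 : 0 < t := by linarith
  have e1 : G x (t + h) = ∫ y, G (x - y) t * G y h := by
    have := hG.semigroup x h (t + h) hh (by linarith)
    simpa using this
  have hi := hG.integrable_slice hh
  have i1 : Integrable (fun y => G (x - y) t * G y h) :=
    hi.bdd_mul ((hG.continuous_slice ht0).comp (by fun_prop : Continuous fun y => x - y)).aestronglyMeasurable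
      (Eventually.of_forall fun y => h3 (x - y) t ht0)
  -- Since the mass may be computed at time `h`, the difference is the integral of `(G(x-y,t) -
  -- G(x,t)) G(y,h)`, and the Hölder bound turns it into a moment of order `κ`.
  rw [e1, ← hG.mass_eq hh, mul_comm, ← integral_const_mul, ← integral_sub i1 (hi.const_mul _),
    ← Real.norm_eq_abs]
  calc _ ≤ ∫ y, C₁ * (‖y‖ ^ κ * |G y h|) := by
        refine norm_integral_le_of_norm_le ((h2 h hh).1.const_mul _)
          (Eventually.of_forall fun y => ?_)
        rw [← sub_mul, norm_mul, Real.norm_eq_abs, Real.norm_eq_abs, ← mul_assoc]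
        exact mul_le_mul_of_nonneg_right (h1 x y t ht) (abs_nonneg _)
    _ = C₁ * ∫ y, ‖y‖ ^ κ * |G y h| := integral_const_mul _ _
    _ ≤ C₁ * (C₂ * h ^ (κ / d)) := mul_le_mul_of_nonneg_left (h2 h hh).2 hC₁
    _ = _ := by ring

lemma exists_ne_zero_one (h : ∃ (x : RN N) (t : ℝ), 0 < t ∧ G x t ≠ 0) : ∃ x, G x 1 ≠ 0 := by
  obtain ⟨x, t, ht, hx⟩ := h
  rw [hG.selfSimilar x t ht] at hx
  exact ⟨_, right_ne_zero_of_mul hx⟩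

/-- A nontrivial kernel has unit mass. -/
lemma mass_eq_one (h : ∃ (x : RN N) (t : ℝ), 0 < t ∧ G x t ≠ 0) : ∫ y, G y 1 = 1 := by
  obtain ⟨x, hx⟩ := hG.exists_ne_zero_one h
  have hL := hG.L_pos
  have hd := hG.d_pos
  have hκ : 0 < min (1 / 2) (L / 2) := by positivity
  obtain ⟨C, hC⟩ := hG.abs_sub_mass_mul_le hκ.le
    ((min_le_left _ _).trans (by norm_num)) ((min_le_right _ _).trans_lt (by linarith))
  set κ := min (1 / 2) (L / 2)
  -- As `h → 0` the same quantity tends to `(1 - m) G(x,1)` by continuity in time, `m` being the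
  -- mass, and to `0` by the rate just obtained. Choosing `x` with `G(x,1) ≠ 0` gives `m = 1`.
  have l1 : Tendsto (fun h => G x (1 + h) - (∫ y, G y 1) * G x 1) (𝓝[>] 0)
      (𝓝 (G x 1 - (∫ y, G y 1) * G x 1)) := by
    have hcont : ContinuousAt (fun r => G x r) (1 + 0) := by
      rw [add_zero]; exact (hG.hasDerivAt_time x one_pos).continuousAt
    have h2 : Tendsto (fun h : ℝ => 1 + h) (𝓝[>] 0) (𝓝 (1 + 0)) :=
      (Continuous.tendsto (by fun_prop) 0).mono_left nhdsWithin_le_nhds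
    have := (hcont.tendsto.comp h2).sub_const ((∫ y, G y 1) * G x 1)
    simpa using this
  have l2 : Tendsto (fun h => G x (1 + h) - (∫ y, G y 1) * G x 1) (𝓝[>] 0) (𝓝 0) := by
    have h3 : Tendsto (fun h : ℝ => C * h ^ (κ / d)) (𝓝[>] 0) (𝓝 0) := by
      have : Tendsto (fun h : ℝ => C * h ^ (κ / d)) (𝓝 0) (𝓝 (C * 0 ^ (κ / d))) :=
        ((Real.continuous_rpow_const (by positivity)).tendsto 0).const_mul C
      rw [Real.zero_rpow (by positivity), mul_zero] at this
      exact this.mono_left nhdsWithin_le_nhds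
    refine squeeze_zero_norm' ?_ h3
    filter_upwards [self_mem_nhdsWithin] with h hh
    exact hC x 1 h le_rfl hh
  have := tendsto_nhds_unique l1 l2
  have h4 : (1 - ∫ y, G y 1) * G x 1 = 0 := by linarith
  rcases mul_eq_zero.1 h4 with h5 | h5
  · linarith
  · exact absurd h5 hx

/-- The decay exponent of a nontrivial kernel does not exceed its order, up to `1`. -/
lemma lt_order (h : ∃ (x : RN N) (t : ℝ), 0 < t ∧ G x t ≠ 0) (hN : 1 ≤ N)
    (hK1 : K < 1) (hKL : K < L) : K < d := by
  by_contra hKd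
  push Not at hKd
  have hd := hG.d_pos
  -- If `d ≤ K`, any `κ` strictly between `K` and `min 1 L` has `κ / d > 1` and is still an
  -- admissible moment.
  obtain ⟨κ, hκ1, hκ2⟩ := exists_between (lt_min hK1 hKL)
  obtain ⟨C, hC⟩ := hG.abs_sub_mass_mul_le (κ := κ) (by linarith)
    (hκ2.le.trans (min_le_left _ _)) (hκ2.trans_le (min_le_right _ _))
  simp only [hG.mass_eq_one h, one_mul] at hC
  have hr : 1 < κ / d := by rw [lt_div_iff₀ hd]; linarith
  -- Increments of order `κ / d > 1` force the time derivative to vanish on `[1, 2)`.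
  have const : ∀ x, G x 2 = G x 1 := by
    intro x
    refine constant_of_has_deriv_right_zero (f := fun r => G x r) (a := 1) (b := 2) ?_ ?_ 2 (by simp)
    · intro r hr
      exact (hG.hasDerivAt_time x (by linarith [hr.1])).continuousAt.continuousWithinAt
    · intro r hr'
      have hd1 := (hG.hasDerivAt_time x (show 0 < r by linarith [hr'.1]))
      have hslope := hd1.tendsto_slope_zero_right
      have hz : Tendsto (fun t => t⁻¹ • (G x (r + t) - G x r)) (𝓝[>] 0) (𝓝 0) := by
        have h3 : Tendsto (fun t : ℝ => C * t ^ (κ / d - 1)) (𝓝[>] 0) (𝓝 0) := by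
          have : Tendsto (fun t : ℝ => C * t ^ (κ / d - 1)) (𝓝 0) (𝓝 (C * 0 ^ (κ / d - 1))) :=
            ((Real.continuous_rpow_const (by linarith)).tendsto 0).const_mul C
          rw [Real.zero_rpow (by linarith), mul_zero] at this
          exact this.mono_left nhdsWithin_le_nhds
        refine squeeze_zero_norm' ?_ h3
        filter_upwards [self_mem_nhdsWithin] with t ht
        have ht : 0 < t := ht
        have := hC x r t hr'.1 ht
        rw [norm_smul, Real.norm_of_nonneg (by positivity), Real.norm_eq_abs,
          Real.rpow_sub_one ht.ne']
        calc t⁻¹ * |G x (r + t) - G x r| ≤ t⁻¹ * (C * t ^ (κ / d)) := by gcongr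
          _ = _ := by rw [div_eq_mul_inv]; ring
      have := tendsto_nhds_unique hslope hz
      rw [← this]
      exact hd1.hasDerivWithinAt
  obtain ⟨C₃, hC₃, h3⟩ := hG.abs_le_rpow
  have hq : (2 : ℝ) ^ (-((N : ℝ) / d)) < 1 := Real.rpow_lt_one_of_one_lt_of_neg (by norm_num)
    (by have : 0 < (N : ℝ) / d := by
          have : (0 : ℝ) < N := by exact_mod_cast hN
          positivity
        linarith)
  -- Constancy in time and self-similarity give `G(x,1) = 2^{-N/d} G(2^{-1/d}x, 1)`. Iteration
  -- contracts the sup bound to zero, and this is where `N ≥ 1` enters.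
  have hstep : ∀ (n : ℕ) (x : RN N), |G x 1| ≤ ((2 : ℝ) ^ (-((N : ℝ) / d))) ^ n * C₃ := by
    intro n
    induction n with
    | zero => intro x; simpa using h3 x 1 one_pos
    | succ n ih =>
      intro x
      rw [← const x, hG.selfSimilar x 2 two_pos, abs_mul, abs_of_pos (by positivity), pow_succ]
      have := ih (((2 : ℝ) ^ (1 / d))⁻¹ • x)
      have hp : (0 : ℝ) < 2 ^ (-((N : ℝ) / d)) := by positivity
      nlinarith
  obtain ⟨x, hx⟩ := hG.exists_ne_zero_one h
  have hlim : Tendsto (fun n : ℕ => ((2 : ℝ) ^ (-((N : ℝ) / d))) ^ n * C₃) atTop (𝓝 (0 * C₃)) :=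
    (tendsto_pow_atTop_nhds_zero_of_lt_one (by positivity) hq).mul_const C₃
  rw [zero_mul] at hlim
  have := ge_of_tendsto' hlim (fun n => hstep n x)
  exact hx (abs_nonpos_iff.1 this)

end IsGeneralizedHeatKernel

/-! ### The scaled norm. -/

/-- `w` is bounded by `ε` in the norm of `L^1` with weight `1 + t^{-K/d}|x|^K`, and by
`ε t^{-N/d}` in the sup norm. -/
def ScaledBound {N : ℕ} (K d t : ℝ) (w : RN N → ℝ≥0∞) (ε : ℝ≥0∞) : Prop :=
  ∫⁻ x, w x * ENNReal.ofReal (spatialWeight K d t x) ≤ ε ∧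
    ∀ᵐ x, w x ≤ ε * ENNReal.ofReal (t ^ (-((N : ℝ) / d)))

namespace ScaledBound

variable {N : ℕ} {K d s t : ℝ} {w w₁ w₂ : RN N → ℝ≥0∞} {ε ε₁ ε₂ : ℝ≥0∞}

lemma mono (h : ScaledBound K d t w₁ ε₁) (hw : ∀ᵐ x, w₂ x ≤ w₁ x) (hε : ε₁ ≤ ε₂) :
    ScaledBound K d t w₂ ε₂ := by
  refine ⟨(lintegral_mono_ae ?_).trans (h.1.trans hε), ?_⟩
  · filter_upwards [hw] with x hx
    gcongr
  · filter_upwards [hw, h.2] with x hx hx2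
    exact hx.trans (hx2.trans (by gcongr))

lemma add (h₁ : ScaledBound K d t w₁ ε₁) (h₂ : ScaledBound K d t w₂ ε₂) (hw : AEMeasurable w₁) :
    ScaledBound K d t (fun x => w₁ x + w₂ x) (ε₁ + ε₂) := by
  refine ⟨?_, ?_⟩
  · simp_rw [add_mul]
    rw [lintegral_add_left' (f := fun x => w₁ x * ENNReal.ofReal (spatialWeight K d t x))
      (hw.mul (measurable_spatialWeight t).ennreal_ofReal.aemeasurable)]
    exact add_le_add h₁.1 h₂.1
  · filter_upwards [h₁.2, h₂.2] with x hx1 hx2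
    rw [add_mul]
    exact add_le_add hx1 hx2

lemma const_mul (h : ScaledBound K d t w ε) {c : ℝ≥0∞} (hc : c ≠ ∞) :
    ScaledBound K d t (fun x => c * w x) (c * ε) := by
  refine ⟨?_, ?_⟩
  · simp_rw [mul_assoc]
    rw [lintegral_const_mul' _ _ hc]
    gcongr
    exact h.1
  · filter_upwards [h.2] with x hx
    rw [mul_assoc]
    gcongr

lemma lintegral_le (h : ScaledBound K d t w ε) (ht : 0 < t) : ∫⁻ x, w x ≤ ε := by
  refine (lintegral_mono fun x => ?_).trans h.1
  calc w x = w x * ENNReal.ofReal 1 := by simp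
    _ ≤ _ := by gcongr; exact spatialWeight_one_le x ht

/-- Bounds at a time `s` give bounds at a comparable later or earlier time. -/
lemma comparable (h : ScaledBound K d s w ε) (hK0 : 0 ≤ K) (hd : 0 < d) (hs : 0 < s) (ht : 0 < t)
    {c : ℝ} (hc : 1 ≤ c) (hst : s ≤ c * t) (hts : t ≤ c * s) :
    ScaledBound K d t w (ENNReal.ofReal (c ^ (K / d) * c ^ ((N : ℝ) / d)) * ε) := by
  have hNd : 0 ≤ (N : ℝ) / d := by positivity
  have h1 : 1 ≤ c ^ ((N : ℝ) / d) := Real.one_le_rpow hc hNd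
  have h2 : 1 ≤ c ^ (K / d) := Real.one_le_rpow hc (by positivity)
  refine ⟨?_, ?_⟩
  · calc _ ≤ ∫⁻ x, ENNReal.ofReal (c ^ (K / d)) *
          (w x * ENNReal.ofReal (spatialWeight K d s x)) := by
          refine lintegral_mono fun x => ?_
          have := spatialWeight_le_of_le_mul (K := K) hK0 hd x hs ht hc hst
          calc _ ≤ w x * ENNReal.ofReal (c ^ (K / d) * spatialWeight K d s x) := by gcongr
            _ = _ := by rw [ENNReal.ofReal_mul (by positivity)]; ring
      _ = ENNReal.ofReal (c ^ (K / d)) * ∫⁻ x, w x * ENNReal.ofReal (spatialWeight K d s x) :=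
          lintegral_const_mul' _ _ ENNReal.ofReal_ne_top
      _ ≤ _ := by
          gcongr
          · nlinarith
          · exact h.1
  · filter_upwards [h.2] with x hx
    refine hx.trans ?_
    have h3 : s ^ (-((N : ℝ) / d)) ≤ c ^ ((N : ℝ) / d) * t ^ (-((N : ℝ) / d)) := by
      have : (c * s) ^ (-((N : ℝ) / d)) ≤ t ^ (-((N : ℝ) / d)) :=
        Real.rpow_le_rpow_of_nonpos ht hts (by linarith)
      rw [Real.mul_rpow (by linarith) hs.le, Real.rpow_neg (by linarith)] at this
      have hcp : 0 < c ^ ((N : ℝ) / d) := by positivity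
      rwa [inv_mul_le_iff₀ hcp] at this
    have h4 : 0 < t ^ (-((N : ℝ) / d)) := by positivity
    have h5 : s ^ (-((N : ℝ) / d)) ≤ c ^ (K / d) * c ^ ((N : ℝ) / d) * t ^ (-((N : ℝ) / d)) := by
      refine h3.trans ?_
      have : 0 < c ^ ((N : ℝ) / d) * t ^ (-((N : ℝ) / d)) := by positivity
      nlinarith
    calc ε * ENNReal.ofReal (s ^ (-((N : ℝ) / d)))
        ≤ ε * ENNReal.ofReal (c ^ (K / d) * c ^ ((N : ℝ) / d) * t ^ (-((N : ℝ) / d))) := by gcongr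
      _ = _ := by rw [ENNReal.ofReal_mul (by positivity)]; ring

/-- Superpositions of functions with scaled bounds. -/
lemma lintegral_kernel {α : Type*} [MeasurableSpace α] {μ : Measure α} [SFinite μ]
    {k : RN N → α → ℝ≥0∞} {c v : α → ℝ≥0∞} (hk : Measurable (Function.uncurry k))
    (hv : Measurable v)
    (h : ∀ᵐ z ∂μ, ∫⁻ x, k x z * ENNReal.ofReal (spatialWeight K d t x) ≤ c z ∧
      ∀ x, k x z ≤ c z * ENNReal.ofReal (t ^ (-((N : ℝ) / d)))) :
    ScaledBound K d t (fun x => ∫⁻ z, k x z * v z ∂μ) (∫⁻ z, c z * v z ∂μ) := by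
  refine ⟨?_, Eventually.of_forall fun x => ?_⟩
  · have hm : Measurable (fun q : RN N × α =>
        k q.1 q.2 * v q.2 * ENNReal.ofReal (spatialWeight K d t q.1)) :=
      (hk.mul (hv.comp measurable_snd)).mul
        ((measurable_spatialWeight t).ennreal_ofReal.comp measurable_fst)
    calc _ = ∫⁻ x, ∫⁻ z, k x z * v z * ENNReal.ofReal (spatialWeight K d t x) ∂μ := by
          refine lintegral_congr fun x => ?_
          rw [lintegral_mul_const' _ _ ENNReal.ofReal_ne_top]
      _ = ∫⁻ z, (∫⁻ x, k x z * v z * ENNReal.ofReal (spatialWeight K d t x)) ∂μ :=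
          -- Minkowski's inequality for a superposition reduces to Tonelli, since everything is
          -- nonnegative.
          lintegral_lintegral_swap hm.aemeasurable
      _ ≤ ∫⁻ z, c z * v z ∂μ := by
          refine lintegral_mono_ae ?_
          filter_upwards [h] with z hz
          have hkz : Measurable fun x => k x z := hk.comp measurable_prodMk_right
          calc _ = ∫⁻ x, v z * (k x z * ENNReal.ofReal (spatialWeight K d t x)) := by
                congr 1; ext x; ring
            _ = v z * ∫⁻ x, k x z * ENNReal.ofReal (spatialWeight K d t x) :=
                lintegral_const_mul _ (hkz.mul (measurable_spatialWeight t).ennreal_ofReal)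
            _ ≤ v z * c z := by gcongr; exact hz.1
            _ = _ := mul_comm _ _
  · calc _ ≤ ∫⁻ z, ENNReal.ofReal (t ^ (-((N : ℝ) / d))) * (c z * v z) ∂μ := by
          refine lintegral_mono_ae ?_
          filter_upwards [h] with z hz
          calc _ ≤ _ := mul_le_mul_left (hz.2 x) (v z)
            _ = _ := by ring
      _ = _ := by rw [lintegral_const_mul' _ _ ENNReal.ofReal_ne_top, mul_comm]

end ScaledBound

/-! ### The kernel defect and its size for early sources. -/

/-- The defect `G(x-y,t-s) - G(x,t+1)`, the first term being present for `s < t` only. -/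
noncomputable def kernelDefect {N : ℕ} (G : RN N → ℝ → ℝ) (t : ℝ) (x : RN N) (z : RN N × ℝ) : ℝ :=
  positiveKernel G (x - z.1, t - z.2) - positiveKernel G (x, t + 1)

/-- The size `min(|y|t^{-1/d}, |y|^K t^{-K/d}) + (1+s)/t` of the defect for `s ≤ t/2`. -/
noncomputable def defectWeight {N : ℕ} (K d t : ℝ) (z : RN N × ℝ) : ℝ :=
  min (‖z.1‖ * t ^ (-(1 / d))) (‖z.1‖ ^ K * t ^ (-(K / d))) + (1 + z.2) / t

lemma defectWeight_nonneg {N : ℕ} {K d t : ℝ} (ht : 0 < t) {z : RN N × ℝ} (hz : 0 ≤ z.2) :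
    0 ≤ defectWeight K d t z := by
  unfold defectWeight
  positivity

lemma measurable_defectWeight {N : ℕ} (K d t : ℝ) : Measurable (defectWeight (N := N) K d t) := by
  unfold defectWeight; fun_prop

lemma spaceTime_restrict_snd {N : ℕ} {a : ℝ} (ha : 0 ≤ a) :
    (spaceTime N).restrict {z | a < z.2} =
      (volume : Measure (RN N)).prod ((volume : Measure ℝ).restrict (Ioi a)) := by
  have : {z : RN N × ℝ | a < z.2} = univ ×ˢ Ioi a := by ext z; simp
  rw [this, spaceTime, ← Measure.prod_restrict, Measure.restrict_univ,
    Measure.restrict_restrict measurableSet_Ioi, Ioi_inter_Ioi, sup_eq_left.2 ha]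

lemma ae_spaceTime_pos (N : ℕ) : ∀ᵐ z ∂spaceTime N, 0 < z.2 := by
  have : {z : RN N × ℝ | 0 < z.2} = univ ×ˢ Ioi 0 := by ext z; simp
  have h : (spaceTime N).restrict {z | 0 < z.2} = spaceTime N := spaceTime_restrict_snd le_rfl
  rw [← h]
  exact ae_restrict_mem (measurableSet_lt measurable_const measurable_snd)

instance (N : ℕ) : SFinite (spaceTime N) := by unfold spaceTime; infer_instance

namespace IsGeneralizedHeatKernel

variable {N γ : ℕ} {d L K : ℝ} {G : RN N → ℝ → ℝ} (hG : IsGeneralizedHeatKernel N γ d L G)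
include hG

lemma measurable_kernelDefect (t : ℝ) :
    Measurable (fun q : RN N × (RN N × ℝ) => kernelDefect G t q.1 q.2) := by
  unfold kernelDefect
  have := hG.measurable_positiveKernel
  exact (this.comp (by fun_prop)).sub (this.comp (by fun_prop))

/-- This is the second term of the defect, measured at time `t` although it lives at time `t + 1`;
for `t ≥ 1` the two times differ by at most a factor two. -/
lemma scaledBound_shifted (hK0 : 0 ≤ K) (hK1 : K ≤ 1) (hKL : K < L) :
    ∃ C : ℝ≥0∞, C ≠ ∞ ∧ ∀ t : ℝ, 1 ≤ t →
      ∫⁻ x, ‖G x (t + 1)‖ₑ * ENNReal.ofReal (spatialWeight K d t x) ≤ C ∧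
      ∀ x, ‖G x (t + 1)‖ₑ ≤ C * ENNReal.ofReal (t ^ (-((N : ℝ) / d))) := by
  obtain ⟨C₁, hC₁, h1⟩ := hG.lintegral_kernel_mul_spatialWeight hK0 hK1 hKL
  obtain ⟨C₂, hC₂, h2⟩ := hG.abs_le_rpow
  have hd := hG.d_pos
  refine ⟨ENNReal.ofReal (2 ^ (K / d)) * (C₁ * 2) + ENNReal.ofReal C₂, by finiteness,
    fun t ht => ⟨?_, fun x => ?_⟩⟩
  · have h0 := h1 (t + 1) (t + 1) 0 (by linarith) le_rfl
    simp only [sub_zero] at h0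
    have hW : ENNReal.ofReal (spatialWeight K d (t + 1) (0 : RN N)) ≤ 2 := by
      have h3 : (t + 1) ^ (-(K / d)) * ‖(0 : RN N)‖ ^ K ≤ 1 * 1 := by
        gcongr
        · exact Real.rpow_le_one_of_one_le_of_nonpos (by linarith)
            (by have : 0 ≤ K / d := by positivity
                linarith)
        · rw [norm_zero]; exact Real.zero_rpow_le_one K
      calc _ ≤ ENNReal.ofReal 2 := ENNReal.ofReal_le_ofReal (by unfold spatialWeight; linarith)
        _ = 2 := by simp
    calc _ ≤ ∫⁻ x, ENNReal.ofReal (2 ^ (K / d)) *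
          (‖G x (t + 1)‖ₑ * ENNReal.ofReal (spatialWeight K d (t + 1) x)) := by
          refine lintegral_mono fun x => ?_
          have := spatialWeight_le_of_le_mul (K := K) (d := d) (s := t + 1) (t := t) (c := 2) hK0 hd x
            (by linarith) (by linarith) (by norm_num) (by linarith)
          calc _ ≤ ‖G x (t + 1)‖ₑ * ENNReal.ofReal (2 ^ (K / d) * spatialWeight K d (t + 1) x) := by
                gcongr
            _ = _ := by rw [ENNReal.ofReal_mul (by positivity)]; ring
      _ = ENNReal.ofReal (2 ^ (K / d)) *
          ∫⁻ x, ‖G x (t + 1)‖ₑ * ENNReal.ofReal (spatialWeight K d (t + 1) x) :=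
          lintegral_const_mul' _ _ ENNReal.ofReal_ne_top
      _ ≤ ENNReal.ofReal (2 ^ (K / d)) * (C₁ * 2) := by gcongr; exact h0.trans (by gcongr)
      _ ≤ _ := le_self_add
  · have h3 := h2 x (t + 1) (by linarith)
    have h4 : (t + 1) ^ (-((N : ℝ) / d)) ≤ t ^ (-((N : ℝ) / d)) :=
      Real.rpow_le_rpow_of_nonpos (by linarith) (by linarith)
        (by have : 0 ≤ (N : ℝ) / d := by positivity
            linarith)
    calc ‖G x (t + 1)‖ₑ ≤ ENNReal.ofReal (C₂ * t ^ (-((N : ℝ) / d))) := by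
          rw [Real.enorm_eq_ofReal_abs]
          exact ENNReal.ofReal_le_ofReal (h3.trans (by gcongr))
      _ = ENNReal.ofReal C₂ * ENNReal.ofReal (t ^ (-((N : ℝ) / d))) := ENNReal.ofReal_mul hC₂.le
      _ ≤ _ := by gcongr; exact le_add_self

/-- The defect bound for sources that are close to the origin. -/
lemma abs_kernelDefect_le : ∃ C : ℝ, 0 < C ∧ ∀ (t s : ℝ) (x y : RN N), 1 ≤ t → 0 ≤ s → s ≤ t / 2 →
    ‖y‖ ≤ (t - s) ^ (1 / d) →
      |kernelDefect G t x (y, s)| ≤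
        C * (‖y‖ * t ^ (-(1 / d)) + (1 + s) / t) * algebraicProfile N d L x t := by
  obtain ⟨C₁, hC₁, h1⟩ := hG.abs_sub_le_space
  obtain ⟨C₂, hC₂, h2⟩ := hG.abs_sub_le_time
  have hd := hG.d_pos
  have hL := hG.L_pos
  set c : ℝ := 2 ^ ((N : ℝ) / d) * (2 ^ (1 / d)) ^ ((N : ℝ) + L)
  have hc0 : 0 < c := by positivity
  refine ⟨C₁ * 2 ^ (1 / d) * c + C₂, by positivity, fun t s x y ht hs hst hy => ?_⟩
  have ht0 : 0 < t := by linarith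
  have hτ : 0 < t - s := by linarith
  have hQ := algebraicProfile_nonneg (N := N) (d := d) (L := L) x ht0
  have a1 := h1 x y (t - s) hτ hy
  have a2 := h2 x t (t - s) ht0 (by linarith) (by linarith)
  have a3 := h2 x t (t + 1) ht0 (by linarith) (by linarith)
  have e2 : |t - s - t| = s := by rw [sub_sub_cancel_left, abs_neg, abs_of_nonneg hs]
  have e3 : |t + 1 - t| = 1 := by simp
  rw [e2] at a2
  rw [e3] at a3
  have b1 : (t - s) ^ (-(1 / d)) ≤ 2 ^ (1 / d) * t ^ (-(1 / d)) := by
    have : (2 * (t - s)) ^ (-(1 / d)) ≤ t ^ (-(1 / d)) :=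
      Real.rpow_le_rpow_of_nonpos ht0 (by linarith)
        (by have : 0 ≤ 1 / d := by positivity
            linarith)
    rwa [Real.mul_rpow (by norm_num) hτ.le, Real.rpow_neg (by norm_num),
      inv_mul_le_iff₀ (by positivity)] at this
  have b2 := algebraicProfile_le_of_comparable (N := N) (c := 2) hd hL x hτ ht0 (by linarith)
    (by linarith)
  have hx : 0 ≤ ‖y‖ * t ^ (-(1 / d)) := by positivity
  have hQ' := algebraicProfile_nonneg (N := N) (d := d) (L := L) x hτ
  unfold kernelDefect
  rw [positiveKernel_of_pos _ _ hτ, positiveKernel_of_pos _ _ (by linarith)]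
  -- Telescoping: remove the shift `y` at time `t - s`, then go from `t - s` to `t` and from `t` to
  -- `t + 1`. The assumptions `s ≤ t/2` and `t ≥ 1` keep all these times within a factor two of `t`.
  calc |G (x - y) (t - s) - G x (t + 1)|
      = |(G (x - y) (t - s) - G x (t - s)) + (G x (t - s) - G x t) - (G x (t + 1) - G x t)| := by
        ring_nf
    _ ≤ |G (x - y) (t - s) - G x (t - s)| + |G x (t - s) - G x t| + |G x (t + 1) - G x t| :=
        (abs_sub _ _).trans (add_le_add_left (abs_add_le _ _) _)
    _ ≤ C₁ * (‖y‖ * (2 ^ (1 / d) * t ^ (-(1 / d)))) * (c * algebraicProfile N d L x t) +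
        C₂ * (s / t) * algebraicProfile N d L x t + C₂ * (1 / t) * algebraicProfile N d L x t := by
        gcongr
        refine a1.trans ?_
        gcongr
    _ = ((C₁ * 2 ^ (1 / d) * c) * (‖y‖ * t ^ (-(1 / d))) + C₂ * ((1 + s) / t)) *
        algebraicProfile N d L x t := by ring
    _ ≤ _ := by
        refine mul_le_mul_of_nonneg_right ?_ hQ
        have h5 : 0 ≤ (1 + s) / t := by positivity
        have h6 : 0 < C₁ * 2 ^ (1 / d) * c := by positivity
        nlinarith [mul_nonneg h6.le h5, mul_nonneg hC₂.le hx]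

/-- The defect, measured in the scaled norm, for `s ≤ t/2`. -/
lemma scaledBound_kernelDefect (hK0 : 0 ≤ K) (hK1 : K ≤ 1) (hKL : K < L) :
    ∃ C : ℝ≥0∞, C ≠ ∞ ∧ ∀ (t : ℝ) (z : RN N × ℝ), 1 ≤ t → 0 ≤ z.2 → z.2 ≤ t / 2 →
      ∫⁻ x, ‖kernelDefect G t x z‖ₑ * ENNReal.ofReal (spatialWeight K d t x) ≤
        C * ENNReal.ofReal (defectWeight K d t z) ∧
      ∀ x, ‖kernelDefect G t x z‖ₑ ≤ C * ENNReal.ofReal (defectWeight K d t z) *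
        ENNReal.ofReal (t ^ (-((N : ℝ) / d))) := by
  obtain ⟨C₁, hC₁, h1⟩ := hG.abs_kernelDefect_le
  obtain ⟨C₂, hC₂, h2⟩ := lintegral_algebraicProfile_mul_spatialWeight (N := N) (d := d) hK0 hKL
  obtain ⟨C₃, hC₃, h3⟩ := hG.lintegral_kernel_mul_spatialWeight hK0 hK1 hKL
  obtain ⟨C₄, hC₄, h4⟩ := hG.scaledBound_shifted hK0 hK1 hKL
  obtain ⟨C₅, hC₅, h5⟩ := hG.abs_le_rpow
  have hd := hG.d_pos
  set c₀ : ℝ := 2 ^ (1 / d) with hc₀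
  have hc1 : 1 ≤ c₀ := Real.one_le_rpow (by norm_num) (by positivity)
  refine ⟨ENNReal.ofReal C₁ * (C₂ + 1) +
    (C₃ + C₄ + ENNReal.ofReal (C₅ * 2 ^ ((N : ℝ) / d))) * ENNReal.ofReal (2 * c₀),
    by finiteness, ?_⟩
  rintro t ⟨y, s⟩ ht hs hst
  simp only at hs hst
  have ht0 : 0 < t := by linarith
  have hτ : 0 < t - s := by linarith
  have hΘ := defectWeight_nonneg (K := K) (d := d) ht0 (z := (y, s)) hs
  have hzK : ‖y‖ ^ K * t ^ (-(K / d)) = (‖y‖ * t ^ (-(1 / d))) ^ K := by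
    rw [Real.mul_rpow (norm_nonneg _) (by positivity), ← Real.rpow_mul ht0.le]
    congr 2; ring
  have ht1d : t ^ (-(1 / d)) = (t ^ (1 / d))⁻¹ := Real.rpow_neg ht0.le _
  have hRt : 0 < t ^ (1 / d) := by positivity
  -- Sources within the diffusion length benefit from cancellation. There `‖y‖ t^{-1/d} ≤ 1`, so the
  -- linear term attains the minimum.
  rcases le_or_gt ‖y‖ ((t - s) ^ (1 / d)) with hy | hy
  · have hz1 : ‖y‖ * t ^ (-(1 / d)) ≤ 1 := by
      rw [ht1d, ← div_eq_mul_inv, div_le_one hRt]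
      exact hy.trans (Real.rpow_le_rpow hτ.le (by linarith) (by positivity))
    have hmin : defectWeight K d t (y, s) = ‖y‖ * t ^ (-(1 / d)) + (1 + s) / t := by
      unfold defectWeight
      rw [min_eq_left]
      simp only
      rw [hzK]
      have h0 : 0 ≤ ‖y‖ * t ^ (-(1 / d)) := by positivity
      rcases eq_or_lt_of_le h0 with h0 | h0
      · rw [← h0]; positivity
      · conv_lhs => rw [← Real.rpow_one (‖y‖ * t ^ (-(1 / d)))]
        exact Real.rpow_le_rpow_of_exponent_ge h0 hz1 hK1
    have hD : ∀ x, ‖kernelDefect G t x (y, s)‖ₑ ≤ ENNReal.ofReal C₁ *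
        ENNReal.ofReal (defectWeight K d t (y, s)) *
          ENNReal.ofReal (algebraicProfile N d L x t) := by
      intro x
      rw [← ENNReal.ofReal_mul hC₁.le, ← ENNReal.ofReal_mul (by positivity),
        Real.enorm_eq_ofReal_abs, hmin]
      exact ENNReal.ofReal_le_ofReal (h1 t s x y ht hs hst hy)
    refine ⟨?_, fun x => ?_⟩
    · calc _ ≤ ∫⁻ x, ENNReal.ofReal C₁ * ENNReal.ofReal (defectWeight K d t (y, s)) *
            (ENNReal.ofReal (algebraicProfile N d L x t) *
              ENNReal.ofReal (spatialWeight K d t x)) := by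
            refine lintegral_mono fun x => ?_
            calc _ ≤ _ := mul_le_mul_left (hD x) _
              _ = _ := by ring
        _ = ENNReal.ofReal C₁ * ENNReal.ofReal (defectWeight K d t (y, s)) *
            ∫⁻ x : RN N, ENNReal.ofReal (algebraicProfile N d L x t) *
              ENNReal.ofReal (spatialWeight K d t x) :=
            lintegral_const_mul' _ _ (by finiteness)
        _ ≤ ENNReal.ofReal C₁ * ENNReal.ofReal (defectWeight K d t (y, s)) * C₂ := by
            gcongr; exact h2 t ht0
        _ = ENNReal.ofReal C₁ * C₂ * ENNReal.ofReal (defectWeight K d t (y, s)) := by ring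
        _ ≤ _ := by
            gcongr
            exact (mul_le_mul_right le_self_add _).trans le_self_add
    · calc _ ≤ _ := hD x
        _ ≤ ENNReal.ofReal C₁ * ENNReal.ofReal (defectWeight K d t (y, s)) *
            ENNReal.ofReal (t ^ (-((N : ℝ) / d))) := by
            gcongr; exact algebraicProfile_le hG.L_pos x ht0
        _ ≤ _ := by
            gcongr
            calc ENNReal.ofReal C₁ = ENNReal.ofReal C₁ * 1 := (mul_one _).symm
              _ ≤ ENNReal.ofReal C₁ * (C₂ + 1) := by gcongr; exact le_add_self
              _ ≤ _ := le_self_add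
  -- Far sources need no cancellation: `z = ‖y‖ t^{-1/d}` is bounded below, so the full weight `1 +
  -- z^K` is already at most `2 c₀ min(z, z^K)`, and the two terms of the defect can be bounded
  -- separately.
  · have hz : c₀⁻¹ ≤ ‖y‖ * t ^ (-(1 / d)) := by
      rw [ht1d, ← div_eq_mul_inv, le_div_iff₀ hRt, inv_mul_le_iff₀ (by positivity), hc₀]
      calc t ^ (1 / d) ≤ (2 * (t - s)) ^ (1 / d) :=
            Real.rpow_le_rpow ht0.le (by linarith) (by positivity)
        _ = 2 ^ (1 / d) * (t - s) ^ (1 / d) := Real.mul_rpow (by norm_num) hτ.le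
        _ ≤ _ := by gcongr
    have hW : spatialWeight K d t y ≤ 2 * c₀ * defectWeight K d t (y, s) := by
      have h7 : 1 ≤ c₀ * (‖y‖ * t ^ (-(1 / d))) := by rwa [inv_le_iff_one_le_mul₀' (by positivity)] at hz
      have h8 : 0 ≤ (1 + s) / t := by positivity
      unfold spatialWeight defectWeight
      simp only
      rw [mul_comm (t ^ (-(K / d))), hzK]
      set z := ‖y‖ * t ^ (-(1 / d))
      have hz0 : 0 ≤ z := by positivity
      have h9 : 1 + z ^ K ≤ 2 * c₀ * min z (z ^ K) := by
        rcases le_total z 1 with h | h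
        · have : z ^ K ≤ 1 := Real.rpow_le_one hz0 h hK0
          have hzz : z ≤ z ^ K := by
            have h0 : 0 < z := by
              by_contra h0
              have : z = 0 := le_antisymm (not_lt.1 h0) hz0
              rw [this] at h7; linarith
            conv_lhs => rw [← Real.rpow_one z]
            exact Real.rpow_le_rpow_of_exponent_ge h0 h hK1
          rw [min_eq_left hzz]
          nlinarith
        · have h1K : 1 ≤ z ^ K := Real.one_le_rpow h hK0
          have hzz : z ^ K ≤ z := by
            conv_rhs => rw [← Real.rpow_one z]
            exact Real.rpow_le_rpow_of_exponent_le h hK1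
          rw [min_eq_right hzz]
          nlinarith
      nlinarith
    have hW' : ENNReal.ofReal (spatialWeight K d t y) ≤
        ENNReal.ofReal (2 * c₀) * ENNReal.ofReal (defectWeight K d t (y, s)) := by
      rw [← ENNReal.ofReal_mul (by positivity)]
      exact ENNReal.ofReal_le_ofReal hW
    have hW1 : 1 ≤ ENNReal.ofReal (spatialWeight K d t y) := by
      rw [ENNReal.one_le_ofReal]; exact spatialWeight_one_le y ht0
    have hD : ∀ x, ‖kernelDefect G t x (y, s)‖ₑ ≤ ‖G (x - y) (t - s)‖ₑ + ‖G x (t + 1)‖ₑ := by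
      intro x
      unfold kernelDefect
      rw [positiveKernel_of_pos _ _ hτ, positiveKernel_of_pos _ _ (by linarith)]
      exact enorm_sub_le
    have h4t := h4 t ht
    refine ⟨?_, fun x => ?_⟩
    · calc _ ≤ ∫⁻ x, (‖G (x - y) (t - s)‖ₑ * ENNReal.ofReal (spatialWeight K d t x) +
            ‖G x (t + 1)‖ₑ * ENNReal.ofReal (spatialWeight K d t x)) := by
            refine lintegral_mono fun x => ?_
            rw [← add_mul]
            exact mul_le_mul_left (hD x) _
        _ = (∫⁻ x, ‖G (x - y) (t - s)‖ₑ * ENNReal.ofReal (spatialWeight K d t x)) +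
            ∫⁻ x, ‖G x (t + 1)‖ₑ * ENNReal.ofReal (spatialWeight K d t x) := by
            refine lintegral_add_right _ ?_
            exact (hG.continuous_slice (by linarith)).measurable.enorm.mul
              (measurable_spatialWeight t).ennreal_ofReal
        _ ≤ C₃ * ENNReal.ofReal (spatialWeight K d t y) +
            C₄ * ENNReal.ofReal (spatialWeight K d t y) :=
            add_le_add (h3 _ _ _ hτ (by linarith))
              (h4t.1.trans (by simpa using mul_le_mul_right hW1 C₄))
        _ = (C₃ + C₄) * ENNReal.ofReal (spatialWeight K d t y) := by ring
        _ ≤ (C₃ + C₄) * (ENNReal.ofReal (2 * c₀) * ENNReal.ofReal (defectWeight K d t (y, s))) := by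
            gcongr
        _ = (C₃ + C₄) * ENNReal.ofReal (2 * c₀) * ENNReal.ofReal (defectWeight K d t (y, s)) := by
            ring
        _ ≤ _ := by
            gcongr
            exact (mul_le_mul_left le_self_add _).trans le_add_self
    · have h6 : ‖G (x - y) (t - s)‖ₑ ≤ ENNReal.ofReal (C₅ * 2 ^ ((N : ℝ) / d)) *
          ENNReal.ofReal (t ^ (-((N : ℝ) / d))) := by
        rw [← ENNReal.ofReal_mul (by positivity), Real.enorm_eq_ofReal_abs]
        refine ENNReal.ofReal_le_ofReal ((h5 _ _ hτ).trans ?_)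
        have : (2 * (t - s)) ^ (-((N : ℝ) / d)) ≤ t ^ (-((N : ℝ) / d)) :=
          Real.rpow_le_rpow_of_nonpos ht0 (by linarith)
            (by have : 0 ≤ (N : ℝ) / d := by positivity
                linarith)
        rw [Real.mul_rpow (by norm_num) hτ.le, Real.rpow_neg (by norm_num),
          inv_mul_le_iff₀ (by positivity)] at this
        rw [mul_assoc]
        gcongr
      calc _ ≤ _ := hD x
        _ ≤ ENNReal.ofReal (C₅ * 2 ^ ((N : ℝ) / d)) * ENNReal.ofReal (t ^ (-((N : ℝ) / d))) +
            C₄ * ENNReal.ofReal (t ^ (-((N : ℝ) / d))) := add_le_add h6 (h4t.2 x)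
        _ = (C₄ + ENNReal.ofReal (C₅ * 2 ^ ((N : ℝ) / d))) * 1 *
            ENNReal.ofReal (t ^ (-((N : ℝ) / d))) := by ring
        _ ≤ (C₄ + ENNReal.ofReal (C₅ * 2 ^ ((N : ℝ) / d))) *
            (ENNReal.ofReal (2 * c₀) * ENNReal.ofReal (defectWeight K d t (y, s))) *
            ENNReal.ofReal (t ^ (-((N : ℝ) / d))) := by
            gcongr; exact hW1.trans hW'
        _ = (C₄ + ENNReal.ofReal (C₅ * 2 ^ ((N : ℝ) / d))) * ENNReal.ofReal (2 * c₀) *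
            ENNReal.ofReal (defectWeight K d t (y, s)) *
            ENNReal.ofReal (t ^ (-((N : ℝ) / d))) := by ring
        _ ≤ _ := by
            gcongr
            refine le_trans (mul_le_mul_left ?_ _) le_add_self
            rw [add_assoc]; exact le_add_self

end IsGeneralizedHeatKernel

/-! ### Convolution of the kernel and of the defect with sources. -/

namespace IsGeneralizedHeatKernel

variable {N γ : ℕ} {d L K : ℝ} {G : RN N → ℝ → ℝ} (hG : IsGeneralizedHeatKernel N γ d L G)
include hG

/-- This supplies the sup part of the convolution estimates: a bounded source is convolved with a
kernel whose `L^1` norm is uniform in time, so the singularity of `G` at time zero is never felt. -/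
lemma lintegral_positiveKernel_le : ∃ C : ℝ≥0∞, C ≠ ∞ ∧ ∀ (x : RN N) (τ : ℝ),
    ∫⁻ y, ‖positiveKernel G (x - y, τ)‖ₑ ≤ C := by
  obtain ⟨C, hC, h⟩ := hG.lintegral_kernel_mul_spatialWeight le_rfl zero_le_one hG.L_pos
  refine ⟨C * ENNReal.ofReal (1 + 1), by finiteness, fun x τ => ?_⟩
  rcases le_or_gt τ 0 with hτ | hτ
  · simp [positiveKernel_of_nonpos G _ hτ]
  · simp_rw [positiveKernel_of_pos G _ hτ]
    rw [lintegral_sub_left_eq_self (fun y => ‖G y τ‖ₑ) x]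
    have h1 := h τ τ 0 hτ le_rfl
    simp only [spatialWeight, sub_zero, zero_div, neg_zero, Real.rpow_zero, mul_one] at h1
    refine (lintegral_mono fun y => ?_).trans h1
    calc ‖G y τ‖ₑ = ‖G y τ‖ₑ * ENNReal.ofReal 1 := by simp
      _ ≤ _ := by gcongr; norm_num

/-- The convolution with recent sources, measured in the scaled norm. -/
lemma scaledBound_recent (hK0 : 0 ≤ K) (hK1 : K ≤ 1) (hKL : K < L) :
    ∃ C : ℝ≥0∞, C ≠ ∞ ∧ ∀ (a t ρ : ℝ) (v : RN N × ℝ → ℝ≥0∞) (η : ℝ → ℝ≥0∞), 0 ≤ a → 0 < t →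
      1 ≤ ρ → t ≤ ρ * (1 + a) → Measurable v →
      (∀ᵐ s ∂(volume : Measure ℝ).restrict (Ioi a),
        ScaledBound K d (1 + s) (fun y => v (y, s)) (η s)) →
      ScaledBound K d t
        (fun x => ∫⁻ z in {z | a < z.2}, ‖positiveKernel G (x - z.1, t - z.2)‖ₑ * v z ∂spaceTime N)
        (C * ENNReal.ofReal (((1 + t) / t) ^ (K / d)) * ENNReal.ofReal (ρ ^ ((N : ℝ) / d)) *
          ∫⁻ s in Ioo a t, η s) := by
  obtain ⟨C₁, hC₁, h1⟩ := hG.lintegral_kernel_mul_spatialWeight hK0 hK1 hKL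
  obtain ⟨C₂, hC₂, h2⟩ := hG.lintegral_positiveKernel_le
  have hd := hG.d_pos
  refine ⟨C₁ + C₂, by finiteness, fun a t ρ v η ha ht hρ hta hv hη => ?_⟩
  have hm := hG.measurable_positiveKernel
  have hE : 1 ≤ ENNReal.ofReal (((1 + t) / t) ^ (K / d)) := by
    rw [ENNReal.one_le_ofReal]
    exact Real.one_le_rpow (by rw [le_div_iff₀ ht]; linarith) (by positivity)
  have hE' : 1 ≤ ENNReal.ofReal (ρ ^ ((N : ℝ) / d)) := by
    rw [ENNReal.one_le_ofReal]
    exact Real.one_le_rpow hρ (by positivity)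
  -- The extended kernel vanishes for `s ≥ t`, so the time integral stops at `t`.
  have hsplit : ∀ F : ℝ → ℝ≥0∞, (∀ s, t ≤ s → F s = 0) →
      ∫⁻ s in Ioi a, F s = ∫⁻ s in Ioo a t, F s := by
    intro F hF
    have : Ioo a t = Iio t ∩ Ioi a := by ext; simp [and_comm]
    rw [this, ← Measure.restrict_restrict measurableSet_Iio,
      ← lintegral_indicator measurableSet_Iio]
    refine lintegral_congr fun s => ?_
    by_cases hs : s < t
    · simp [hs]
    · simp [hs, hF s (not_lt.1 hs)]
  have hη' : ∀ᵐ s ∂(volume : Measure ℝ).restrict (Ioo a t),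
        ScaledBound K d (1 + s) (fun y => v (y, s)) (η s) :=
    ae_restrict_of_ae_restrict_of_subset Ioo_subset_Ioi_self hη
  rw [spaceTime_restrict_snd ha]
  constructor
  · have hmk : Measurable (Function.uncurry fun (x : RN N) (z : RN N × ℝ) =>
        ‖positiveKernel G (x - z.1, t - z.2)‖ₑ * v z) :=
      ((hm.comp (by fun_prop : Measurable fun q : RN N × (RN N × ℝ) =>
        (q.1 - q.2.1, t - q.2.2))).enorm).mul (hv.comp measurable_snd)
    have hm3 : Measurable (Function.uncurry fun (x : RN N) (z : RN N × ℝ) =>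
        ‖positiveKernel G (x - z.1, t - z.2)‖ₑ * v z * ENNReal.ofReal (spatialWeight K d t x)) :=
      hmk.mul ((measurable_spatialWeight t).ennreal_ofReal.comp measurable_fst)
    calc _ = ∫⁻ x, ∫⁻ z, ‖positiveKernel G (x - z.1, t - z.2)‖ₑ * v z *
            ENNReal.ofReal (spatialWeight K d t x) ∂((volume : Measure (RN N)).prod
              ((volume : Measure ℝ).restrict (Ioi a))) := by
          refine lintegral_congr fun x => ?_
          rw [lintegral_mul_const' _ _ ENNReal.ofReal_ne_top]
      _ = ∫⁻ z, (∫⁻ x, ‖positiveKernel G (x - z.1, t - z.2)‖ₑ * v z *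
            ENNReal.ofReal (spatialWeight K d t x)) ∂((volume : Measure (RN N)).prod
              ((volume : Measure ℝ).restrict (Ioi a))) := lintegral_lintegral_swap hm3.aemeasurable
      _ = ∫⁻ s in Ioi a, ∫⁻ y, (∫⁻ x, ‖positiveKernel G (x - y, t - s)‖ₑ * v (y, s) *
            ENNReal.ofReal (spatialWeight K d t x)) := by
          rw [lintegral_prod_symm']
          exact hm3.lintegral_prod_left'
      _ = ∫⁻ s in Ioo a t, ∫⁻ y, (∫⁻ x, ‖positiveKernel G (x - y, t - s)‖ₑ * v (y, s) *
            ENNReal.ofReal (spatialWeight K d t x)) := by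
          refine hsplit _ fun s hs => ?_
          simp [positiveKernel_of_nonpos G _ (sub_nonpos.2 hs)]
      _ ≤ ∫⁻ s in Ioo a t, C₁ * ENNReal.ofReal (((1 + t) / t) ^ (K / d)) * η s := by
          refine lintegral_mono_ae ?_
          filter_upwards [hη', ae_restrict_mem measurableSet_Ioo] with s hs hst
          have hs0 : 0 < 1 + s := by linarith [hst.1]
          calc _ ≤ ∫⁻ y, C₁ * ENNReal.ofReal (((1 + t) / t) ^ (K / d)) *
                (v (y, s) * ENNReal.ofReal (spatialWeight K d (1 + s) y)) := by
                refine lintegral_mono fun y => ?_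
                have e1 : ∀ x, ‖positiveKernel G (x - y, t - s)‖ₑ * v (y, s) *
                    ENNReal.ofReal (spatialWeight K d t x) = v (y, s) *
                    (‖G (x - y) (t - s)‖ₑ * ENNReal.ofReal (spatialWeight K d t x)) := by
                  intro x
                  rw [positiveKernel_of_pos G _ (sub_pos.2 hst.2)]; ring
                simp only [e1]
                have hms : Measurable (fun x => ‖G (x - y) (t - s)‖ₑ *
                    ENNReal.ofReal (spatialWeight K d t x)) :=
                  (((hG.continuous_slice (sub_pos.2 hst.2)).measurable.comp
                    (measurable_id.sub_const y)).enorm).mul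
                    (measurable_spatialWeight t).ennreal_ofReal
                rw [lintegral_const_mul _ hms]
                have e2 := h1 (t - s) t y (sub_pos.2 hst.2) (by linarith [hst.1])
                -- The weight passes from time `t` to the source's own time `1 + s` because `1 + s ≤
                -- ((1+t)/t) · t`. The cost is unbounded as `t → 0` but at most `2^{K/d}` for `t ≥
                -- 1`.
                have e3 := spatialWeight_le_of_le_mul (K := K) (d := d) (s := 1 + s) (t := t)
                  (c := (1 + t) / t) hK0 hd y hs0 ht (by rw [le_div_iff₀ ht]; linarith)
                  (by rw [div_mul_cancel₀ _ ht.ne']; linarith [hst.2])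
                calc _ ≤ v (y, s) * (C₁ * ENNReal.ofReal (((1 + t) / t) ^ (K / d) *
                      spatialWeight K d (1 + s) y)) := by
                      gcongr
                      exact e2.trans (by gcongr)
                  _ = _ := by rw [ENNReal.ofReal_mul (by positivity)]; ring
            _ = C₁ * ENNReal.ofReal (((1 + t) / t) ^ (K / d)) *
                ∫⁻ y, v (y, s) * ENNReal.ofReal (spatialWeight K d (1 + s) y) :=
                lintegral_const_mul' _ _ (by finiteness)
            _ ≤ _ := by gcongr; exact hs.1
      _ = C₁ * ENNReal.ofReal (((1 + t) / t) ^ (K / d)) * ∫⁻ s in Ioo a t, η s :=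
          lintegral_const_mul' _ _ (by finiteness)
      _ = C₁ * ENNReal.ofReal (((1 + t) / t) ^ (K / d)) * 1 * ∫⁻ s in Ioo a t, η s := by ring
      _ ≤ _ := by gcongr; exact le_self_add
  · refine Eventually.of_forall fun x => ?_
    have hmx : Measurable (fun z : RN N × ℝ => ‖positiveKernel G (x - z.1, t - z.2)‖ₑ * v z) :=
      ((hm.comp (by fun_prop : Measurable fun z : RN N × ℝ => (x - z.1, t - z.2))).enorm).mul hv
    calc _ = ∫⁻ s in Ioi a, ∫⁻ y, ‖positiveKernel G (x - y, t - s)‖ₑ * v (y, s) :=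
          lintegral_prod_symm' _ hmx
      _ = ∫⁻ s in Ioo a t, ∫⁻ y, ‖positiveKernel G (x - y, t - s)‖ₑ * v (y, s) := by
          refine hsplit _ fun s hs => ?_
          simp [positiveKernel_of_nonpos G _ (sub_nonpos.2 hs)]
      _ ≤ ∫⁻ s in Ioo a t, C₂ * ENNReal.ofReal (ρ ^ ((N : ℝ) / d)) *
            ENNReal.ofReal (t ^ (-((N : ℝ) / d))) * η s := by
          refine lintegral_mono_ae ?_
          filter_upwards [hη', ae_restrict_mem measurableSet_Ioo] with s hs hst
          -- Here `t ≤ ρ (1 + a)` enters: the decay of a source in `(a, t)` is comparable with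
          -- `t^{-N/d}`.
          have e4 : (1 + s) ^ (-((N : ℝ) / d)) ≤ ρ ^ ((N : ℝ) / d) * t ^ (-((N : ℝ) / d)) := by
            have : (ρ * (1 + s)) ^ (-((N : ℝ) / d)) ≤ t ^ (-((N : ℝ) / d)) :=
              Real.rpow_le_rpow_of_nonpos ht (by nlinarith [hst.1])
                (by have : 0 ≤ (N : ℝ) / d := by positivity
                    linarith)
            rwa [Real.mul_rpow (by linarith) (by linarith [hst.1]), Real.rpow_neg (by linarith),
              inv_mul_le_iff₀ (by positivity)] at this
          calc _ ≤ ∫⁻ y, (η s * ENNReal.ofReal (ρ ^ ((N : ℝ) / d) * t ^ (-((N : ℝ) / d)))) *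
                ‖positiveKernel G (x - y, t - s)‖ₑ := by
                refine lintegral_mono_ae ?_
                filter_upwards [hs.2] with y hy
                rw [mul_comm]
                gcongr
                exact hy.trans (by gcongr)
            _ = (η s * ENNReal.ofReal (ρ ^ ((N : ℝ) / d) * t ^ (-((N : ℝ) / d)))) *
                ∫⁻ y, ‖positiveKernel G (x - y, t - s)‖ₑ := by
                refine lintegral_const_mul _ ?_
                exact (hm.comp (by fun_prop : Measurable fun y : RN N => (x - y, t - s))).enorm
            _ ≤ (η s * ENNReal.ofReal (ρ ^ ((N : ℝ) / d) * t ^ (-((N : ℝ) / d)))) * C₂ := by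
                gcongr; exact h2 _ _
            _ = _ := by rw [ENNReal.ofReal_mul (by positivity)]; ring
      _ = C₂ * ENNReal.ofReal (ρ ^ ((N : ℝ) / d)) *
            ENNReal.ofReal (t ^ (-((N : ℝ) / d))) * ∫⁻ s in Ioo a t, η s :=
          lintegral_const_mul' _ _ (by finiteness)
      _ = C₂ * 1 * ENNReal.ofReal (ρ ^ ((N : ℝ) / d)) * (∫⁻ s in Ioo a t, η s) *
            ENNReal.ofReal (t ^ (-((N : ℝ) / d))) := by ring
      _ ≤ _ := by gcongr; exact le_add_self

/-- The main kernel estimate: the convolution of the defect with initial data `v₀` and a source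
`v`, in the scaled norm. -/
lemma scaledBound_defect (hK0 : 0 ≤ K) (hK1 : K ≤ 1) (hKL : K < L) :
    ∃ C : ℝ≥0∞, C ≠ ∞ ∧ ∀ (t : ℝ) (v₀ : RN N → ℝ≥0∞) (v : RN N × ℝ → ℝ≥0∞) (η : ℝ → ℝ≥0∞), 1 ≤ t →
      Measurable v₀ → Measurable v →
      (∀ᵐ s ∂(volume : Measure ℝ).restrict (Ioi 0),
        ScaledBound K d (1 + s) (fun y => v (y, s)) (η s)) →
      ScaledBound K d t
        (fun x => (∫⁻ y, ‖kernelDefect G t x (y, 0)‖ₑ * v₀ y) +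
          ∫⁻ z, ‖kernelDefect G t x z‖ₑ * v z ∂spaceTime N)
        (C * ((∫⁻ y, ENNReal.ofReal (defectWeight K d t (y, 0)) * v₀ y) +
          (∫⁻ z in {z | t / 2 < z.2}ᶜ, ENNReal.ofReal (defectWeight K d t z) * v z ∂spaceTime N) +
          ∫⁻ s in Ioi (t / 2), η s)) := by
  obtain ⟨C₁, hC₁, h1⟩ := hG.scaledBound_kernelDefect hK0 hK1 hKL
  obtain ⟨C₂, hC₂, h2⟩ := hG.scaledBound_recent hK0 hK1 hKL
  obtain ⟨C₃, hC₃, h3⟩ := hG.scaledBound_shifted hK0 hK1 hKL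
  have hd := hG.d_pos
  refine ⟨C₁ + (C₂ * ENNReal.ofReal (2 ^ (K / d)) * ENNReal.ofReal (2 ^ ((N : ℝ) / d)) + C₃), by finiteness,
    fun t v₀ v η ht hv₀ hv hη => ?_⟩
  have ht0 : 0 < t := by linarith
  have hm := hG.measurable_positiveKernel
  have hmD := hG.measurable_kernelDefect t
  have hη' : ∀ᵐ s ∂(volume : Measure ℝ).restrict (Ioi (t / 2)),
        ScaledBound K d (1 + s) (fun y => v (y, s)) (η s) :=
    ae_restrict_of_ae_restrict_of_subset (Ioi_subset_Ioi (by linarith)) hη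
  have hS : MeasurableSet {z : RN N × ℝ | t / 2 < z.2} :=
    measurableSet_lt measurable_const measurable_snd
  -- The estimate is split at `s = t/2`. Initial data and early sources use the size of the defect;
  -- for late sources the two terms are treated separately, each costing the tail of `η`.
  have b0 : ScaledBound K d t (fun x => ∫⁻ y, ‖kernelDefect G t x (y, 0)‖ₑ * v₀ y)
      (∫⁻ y, C₁ * ENNReal.ofReal (defectWeight K d t (y, 0)) * v₀ y) := by
    refine ScaledBound.lintegral_kernel (k := fun x y => ‖kernelDefect G t x (y, 0)‖ₑ) ?_ hv₀ ?_
    · exact (hmD.comp (by fun_prop : Measurable fun q : RN N × RN N => (q.1, (q.2, (0 : ℝ))))).enorm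
    · exact Eventually.of_forall fun y => h1 t (y, 0) ht le_rfl (by simp; linarith)
  have b1 : ScaledBound K d t
      (fun x => ∫⁻ z in {z | t / 2 < z.2}ᶜ, ‖kernelDefect G t x z‖ₑ * v z ∂spaceTime N)
      (∫⁻ z in {z | t / 2 < z.2}ᶜ, C₁ * ENNReal.ofReal (defectWeight K d t z) * v z ∂spaceTime N) := by
    refine ScaledBound.lintegral_kernel (k := fun x z => ‖kernelDefect G t x z‖ₑ) hmD.enorm hv ?_
    filter_upwards [ae_restrict_mem hS.compl, ae_restrict_of_ae (ae_spaceTime_pos N)] with z hz hz0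
    exact h1 t z ht hz0.le (by simpa using hz)
  -- With `a = t/2`, the requirement `t ≤ ρ (1 + a)` holds for `ρ = 2`.
  have b2 := h2 (t / 2) t 2 v η (by linarith) ht0 (by norm_num) (by linarith) hv hη'
  have b3 : ScaledBound K d t
      (fun x => ∫⁻ z in {z | t / 2 < z.2}, ‖positiveKernel G (x, t + 1)‖ₑ * v z ∂spaceTime N)
      (∫⁻ z in {z | t / 2 < z.2}, C₃ * v z ∂spaceTime N) := by
    refine ScaledBound.lintegral_kernel (k := fun x z => ‖positiveKernel G (x, t + 1)‖ₑ)
      (c := fun _ => C₃) ?_ hv ?_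
    · exact (hm.comp (by fun_prop : Measurable fun q : RN N × (RN N × ℝ) => (q.1, t + 1))).enorm
    · refine Eventually.of_forall fun z => ?_
      simp_rw [positiveKernel_of_pos G _ (show 0 < t + 1 by linarith)]
      exact h3 t ht
  have e3 : ∫⁻ z in {z | t / 2 < z.2}, C₃ * v z ∂spaceTime N ≤ C₃ * ∫⁻ s in Ioi (t / 2), η s := by
    rw [lintegral_const_mul' _ _ hC₃, spaceTime_restrict_snd (by linarith),
      lintegral_prod_symm' _ hv]
    refine mul_le_mul_right (lintegral_mono_ae ?_) _
    filter_upwards [hη', ae_restrict_mem measurableSet_Ioi] with s hs hst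
    exact hs.lintegral_le (by linarith [mem_Ioi.1 hst])
  have m0 : Measurable fun x => ∫⁻ y, ‖kernelDefect G t x (y, 0)‖ₑ * v₀ y := by
    refine Measurable.lintegral_prod_right' (f := fun q : RN N × RN N =>
      ‖kernelDefect G t q.1 (q.2, 0)‖ₑ * v₀ q.2) ?_
    exact (hmD.comp (by fun_prop : Measurable fun q : RN N × RN N =>
      (q.1, (q.2, (0 : ℝ))))).enorm.mul (hv₀.comp measurable_snd)
  have m1 : Measurable fun x =>
      ∫⁻ z in {z | t / 2 < z.2}ᶜ, ‖kernelDefect G t x z‖ₑ * v z ∂spaceTime N :=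
    Measurable.lintegral_prod_right' (f := fun q : RN N × (RN N × ℝ) =>
      ‖kernelDefect G t q.1 q.2‖ₑ * v q.2) (hmD.enorm.mul (hv.comp measurable_snd))
  have m2 : Measurable fun x => ∫⁻ z in {z | t / 2 < z.2},
      ‖positiveKernel G (x - z.1, t - z.2)‖ₑ * v z ∂spaceTime N :=
    Measurable.lintegral_prod_right' (f := fun q : RN N × (RN N × ℝ) =>
      ‖positiveKernel G (q.1 - q.2.1, t - q.2.2)‖ₑ * v q.2)
      ((hm.comp (by fun_prop : Measurable fun q : RN N × (RN N × ℝ) =>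
        (q.1 - q.2.1, t - q.2.2))).enorm.mul (hv.comp measurable_snd))
  have b := b0.add (b1.add (b2.add b3 m2.aemeasurable) m1.aemeasurable) m0.aemeasurable
  refine b.mono (Eventually.of_forall fun x => ?_) ?_
  · gcongr
    rw [← lintegral_add_compl _ hS, add_comm]
    gcongr
    rw [← lintegral_add_left]
    · refine lintegral_mono fun z => ?_
      rw [← add_mul]
      gcongr
      exact enorm_sub_le
    · exact ((hm.comp (by fun_prop : Measurable fun z : RN N × ℝ =>
        (x - z.1, t - z.2))).enorm).mul hv
  · have e0 : ∫⁻ y, C₁ * ENNReal.ofReal (defectWeight K d t (y, 0)) * v₀ y =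
        C₁ * ∫⁻ y, ENNReal.ofReal (defectWeight K d t (y, 0)) * v₀ y := by
      simp_rw [mul_assoc]; exact lintegral_const_mul' _ _ hC₁
    have e1 : ∫⁻ z in {z | t / 2 < z.2}ᶜ, C₁ * ENNReal.ofReal (defectWeight K d t z) * v z ∂spaceTime N
        = C₁ * ∫⁻ z in {z | t / 2 < z.2}ᶜ, ENNReal.ofReal (defectWeight K d t z) * v z ∂spaceTime N := by
      simp_rw [mul_assoc]; exact lintegral_const_mul' _ _ hC₁
    have e2 : C₂ * ENNReal.ofReal (((1 + t) / t) ^ (K / d)) *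
        ENNReal.ofReal (2 ^ ((N : ℝ) / d)) * ∫⁻ s in Ioo (t / 2) t, η s ≤
        C₂ * ENNReal.ofReal (2 ^ (K / d)) * ENNReal.ofReal (2 ^ ((N : ℝ) / d)) * ∫⁻ s in Ioi (t / 2), η s := by
      gcongr
      · rw [div_le_iff₀ ht0]; linarith
      · exact Ioo_subset_Ioi_self
    rw [e0, e1]
    calc _ ≤ C₁ * (∫⁻ y, ENNReal.ofReal (defectWeight K d t (y, 0)) * v₀ y) +
          (C₁ * (∫⁻ z in {z | t / 2 < z.2}ᶜ,
            ENNReal.ofReal (defectWeight K d t z) * v z ∂spaceTime N) +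
          (C₂ * ENNReal.ofReal (2 ^ (K / d)) * ENNReal.ofReal (2 ^ ((N : ℝ) / d)) * (∫⁻ s in Ioi (t / 2), η s) +
            C₃ * ∫⁻ s in Ioi (t / 2), η s)) := by
          gcongr
      _ = C₁ * (∫⁻ y, ENNReal.ofReal (defectWeight K d t (y, 0)) * v₀ y) +
          C₁ * (∫⁻ z in {z | t / 2 < z.2}ᶜ,
            ENNReal.ofReal (defectWeight K d t z) * v z ∂spaceTime N) +
          (C₂ * ENNReal.ofReal (2 ^ (K / d)) * ENNReal.ofReal (2 ^ ((N : ℝ) / d)) + C₃) * ∫⁻ s in Ioi (t / 2), η s := by ring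
      _ ≤ _ := by
          rw [mul_add, mul_add]
          exact add_le_add (add_le_add (mul_le_mul_left le_self_add _)
            (mul_le_mul_left le_self_add _)) (mul_le_mul_left le_add_self _)

end IsGeneralizedHeatKernel

/-! ### Elementary time integrals. -/

section Integrals

lemma lintegral_Ioi_rpow_le {b c t : ℝ} (hb : 0 < b) (hc : 0 ≤ c) (ht : 0 < t) :
    ∫⁻ s in Ioi (t / 2), ENNReal.ofReal (c * (1 + s) ^ (-b - 1)) ≤
      ENNReal.ofReal (c * (2 ^ b / b) * t ^ (-b)) := by
  have ht2 : 0 < t / 2 := by linarith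
  have hi : IntegrableOn (fun s : ℝ => s ^ (-b - 1)) (Ioi (t / 2)) :=
    integrableOn_Ioi_rpow_of_lt (by linarith) ht2
  calc _ ≤ ∫⁻ s in Ioi (t / 2), ENNReal.ofReal (c * s ^ (-b - 1)) := by
        refine setLIntegral_mono' measurableSet_Ioi fun s hs => ?_
        have hs : t / 2 < s := hs
        refine ENNReal.ofReal_le_ofReal ?_
        gcongr ?_ * ?_
        exact Real.rpow_le_rpow_of_nonpos (by linarith) (by linarith) (by linarith)
    _ = ENNReal.ofReal (∫ s in Ioi (t / 2), c * s ^ (-b - 1)) := by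
        rw [ofReal_integral_eq_lintegral_ofReal (hi.const_mul c)]
        filter_upwards [ae_restrict_mem measurableSet_Ioi] with s hs
        have hs : t / 2 < s := hs
        have : 0 < s := by linarith
        positivity
    _ = _ := by
        rw [integral_const_mul, integral_Ioi_rpow_of_lt (by linarith) ht2]
        congr 1
        have e : -b - 1 + 1 = -b := by ring
        rw [e, Real.div_rpow ht.le (by norm_num), Real.rpow_neg (by norm_num : (0 : ℝ) ≤ 2)]
        field_simp

lemma lintegral_Ioc_eq_of_hasDerivAt {f F : ℝ → ℝ} {T : ℝ} (hT : 0 ≤ T)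
    (hF : ∀ s ∈ Icc 0 T, HasDerivAt F (f s) s) (hf : ContinuousOn f (Icc 0 T))
    (hf0 : ∀ s ∈ Icc 0 T, 0 ≤ f s) :
    ∫⁻ s in Ioc 0 T, ENNReal.ofReal (f s) = ENNReal.ofReal (F T - F 0) := by
  have hi : IntervalIntegrable f volume 0 T := by
    apply ContinuousOn.intervalIntegrable
    rwa [uIcc_of_le hT]
  rw [← intervalIntegral.integral_eq_sub_of_hasDerivAt (by rwa [uIcc_of_le hT]) hi,
    intervalIntegral.integral_of_le hT, ofReal_integral_eq_lintegral_ofReal hi.1]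
  filter_upwards [ae_restrict_mem measurableSet_Ioc] with s hs
  exact hf0 s (Ioc_subset_Icc_self hs)

lemma lintegral_Ioc_rpow_le {e T : ℝ} (he : 0 < e) (hT : 0 ≤ T) :
    ∫⁻ s in Ioc 0 T, ENNReal.ofReal ((1 + s) ^ (e - 1)) ≤ ENNReal.ofReal ((1 + T) ^ e / e) := by
  rw [lintegral_Ioc_eq_of_hasDerivAt (F := fun s => (1 + s) ^ e / e) hT]
  · refine ENNReal.ofReal_le_ofReal ?_
    have : 0 ≤ (1 + (0 : ℝ)) ^ e / e := by positivity
    linarith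
  · intro s hs
    have h1 : HasDerivAt (fun s : ℝ => 1 + s) 1 s := (hasDerivAt_id s).const_add 1
    have := (h1.rpow_const (p := e) (Or.inl (by linarith [hs.1]))).div_const e
    rwa [one_mul, mul_div_cancel_left₀ _ he.ne'] at this
  · intro s hs
    refine ContinuousAt.continuousWithinAt ?_
    exact ContinuousAt.rpow_const (by fun_prop) (Or.inl (by linarith [hs.1]))
  · intro s hs
    have := hs.1
    positivity

lemma lintegral_Ioc_inv_le {T : ℝ} (hT : 0 ≤ T) :
    ∫⁻ s in Ioc 0 T, ENNReal.ofReal ((1 + s)⁻¹) ≤ ENNReal.ofReal (Real.log (1 + T)) := by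
  rw [lintegral_Ioc_eq_of_hasDerivAt (F := fun s => Real.log (1 + s)) hT]
  · simp
  · intro s hs
    have h1 : HasDerivAt (fun s : ℝ => 1 + s) 1 s := (hasDerivAt_id s).const_add 1
    simpa using h1.log (by linarith [hs.1])
  · intro s hs
    refine ContinuousAt.continuousWithinAt ?_
    exact ContinuousAt.inv₀ (by fun_prop) (by linarith [hs.1])
  · intro s hs
    have := hs.1
    positivity

lemma lintegral_Ioi_zero_rpow_lt_top {b : ℝ} (hb : 0 < b) :
    ∫⁻ s in Ioi (0 : ℝ), ENNReal.ofReal ((1 + s) ^ (-b - 1)) < ∞ := by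
  have h : ∫⁻ s : ℝ, ENNReal.ofReal ((1 + ‖s‖) ^ (-(b + 1))) < ∞ :=
    finite_integral_one_add_norm (by simp; linarith)
  refine lt_of_le_of_lt ?_ h
  refine le_trans (le_of_eq ?_) (setLIntegral_le_lintegral (Ioi 0) _)
  refine setLIntegral_congr_fun measurableSet_Ioi fun s hs => ?_
  have hs : 0 < s := hs
  simp only [Real.norm_of_nonneg hs.le]
  ring_nf

end Integrals

/-! ### Rates for the size of the defect. -/

/-- The quantity controlling the convolution of the kernel defect with data `v₀` and a source
`v`, the latter having scaled bounds `η`. -/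
noncomputable def defectSize {N : ℕ} (K d : ℝ) (v₀ : RN N → ℝ≥0∞) (v : RN N × ℝ → ℝ≥0∞)
    (η : ℝ → ℝ≥0∞) (t : ℝ) : ℝ≥0∞ :=
  (∫⁻ y, ENNReal.ofReal (defectWeight K d t (y, 0)) * v₀ y) +
    (∫⁻ z in {z | t / 2 < z.2}ᶜ, ENNReal.ofReal (defectWeight K d t z) * v z ∂spaceTime N) +
    ∫⁻ s in Ioi (t / 2), η s

section Weight

variable {N : ℕ} {K d : ℝ}

/-- The right side is `2 ((1+s)^{K/d} + ‖y‖^K)`, a majorant free of `t`. The branch of the minimum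
with exponent `K` gives the second term. For the first, `r = (1+s)/t` is at most `2`, and `K < d`
gives `r ≤ 2 r^{K/d}`. -/
lemma rpow_mul_defectWeight_le (hK0 : 0 ≤ K) (hKd : K < d) {t : ℝ} (ht : 1 ≤ t) {z : RN N × ℝ}
    (hz : 0 ≤ z.2) (hzt : z.2 ≤ t / 2) :
    t ^ (K / d) * defectWeight K d t z ≤
      2 * (1 + z.2) ^ (K / d) * spatialWeight K d (1 + z.2) z.1 := by
  have hd : 0 < d := by linarith
  have ht0 : 0 < t := by linarith
  have hs0 : 0 < 1 + z.2 := by linarith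
  have hKd1 : K / d < 1 := by rw [div_lt_one hd]; exact hKd
  have hKd0 : 0 ≤ K / d := by positivity
  unfold defectWeight spatialWeight
  have h1 : t ^ (K / d) * (‖z.1‖ ^ K * t ^ (-(K / d))) = ‖z.1‖ ^ K := by
    rw [Real.rpow_neg ht0.le]; field_simp
  have h2 : (1 + z.2) ^ (K / d) * ((1 + z.2) ^ (-(K / d)) * ‖z.1‖ ^ K) = ‖z.1‖ ^ K := by
    rw [Real.rpow_neg hs0.le]; field_simp
  have h3 : t ^ (K / d) * ((1 + z.2) / t) ≤ 2 * (1 + z.2) ^ (K / d) := by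
    set r := (1 + z.2) / t with hr
    have hr0 : 0 < r := by positivity
    have hr2 : r ≤ 2 := by rw [hr, div_le_iff₀ ht0]; linarith
    have e1 : 1 + z.2 = r * t := by rw [hr]; field_simp
    have e2 : r = r ^ (K / d) * r ^ (1 - K / d) := by
      rw [← Real.rpow_add hr0]; simp
    have e3 : r ^ (1 - K / d) ≤ 2 := by
      calc r ^ (1 - K / d) ≤ 2 ^ (1 - K / d) := Real.rpow_le_rpow hr0.le hr2 (by linarith)
        _ ≤ 2 ^ (1 : ℝ) := Real.rpow_le_rpow_of_exponent_le (by norm_num) (by linarith)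
        _ = 2 := by norm_num
    rw [e1, Real.mul_rpow hr0.le ht0.le]
    have h4 : 0 < t ^ (K / d) := by positivity
    have h5 : 0 < r ^ (K / d) := by positivity
    calc t ^ (K / d) * r = t ^ (K / d) * (r ^ (K / d) * r ^ (1 - K / d)) := by rw [← e2]
      _ ≤ t ^ (K / d) * (r ^ (K / d) * 2) := by gcongr
      _ = _ := by ring
  have h4 : t ^ (K / d) * min (‖z.1‖ * t ^ (-(1 / d))) (‖z.1‖ ^ K * t ^ (-(K / d))) ≤ ‖z.1‖ ^ K := by
    exact (mul_le_mul_of_nonneg_left (min_le_right _ _) (by positivity)).trans h1.le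
  have h5 : 0 ≤ ‖z.1‖ ^ K := by positivity
  calc _ = t ^ (K / d) * min (‖z.1‖ * t ^ (-(1 / d))) (‖z.1‖ ^ K * t ^ (-(K / d))) +
        t ^ (K / d) * ((1 + z.2) / t) := by ring
    _ ≤ ‖z.1‖ ^ K + 2 * (1 + z.2) ^ (K / d) := add_le_add h4 h3
    _ ≤ 2 * ((1 + z.2) ^ (K / d) +
          (1 + z.2) ^ (K / d) * ((1 + z.2) ^ (-(K / d)) * ‖z.1‖ ^ K)) := by rw [h2]; linarith
    _ = _ := by ring

/-- For a fixed source point the linear branch of the minimum wins: `t^{(K-1)/d}` tends to zero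
because `K < 1`, and `t^{K/d-1}` because `K < d`. This is what improves `O` to `o`. -/
lemma tendsto_rpow_mul_defectWeight (hK0 : 0 ≤ K) (hK1 : K < 1) (hKd : K < d) {z : RN N × ℝ}
    (hz : 0 ≤ z.2) : Tendsto (fun t => t ^ (K / d) * defectWeight K d t z) atTop (𝓝 0) := by
  have hd : 0 < d := by linarith
  have hlim : Tendsto (fun t : ℝ => ‖z.1‖ * t ^ (-((1 - K) / d)) + (1 + z.2) * t ^ (-(1 - K / d)))
      atTop (𝓝 (‖z.1‖ * 0 + (1 + z.2) * 0)) := by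
    refine ((tendsto_rpow_neg_atTop ?_).const_mul _).add ((tendsto_rpow_neg_atTop ?_).const_mul _)
    · exact div_pos (by linarith) hd
    · rw [sub_pos, div_lt_one hd]; exact hKd
  simp only [mul_zero, add_zero] at hlim
  refine squeeze_zero' ?_ ?_ hlim
  · filter_upwards [eventually_gt_atTop 0] with t ht
    have := defectWeight_nonneg (K := K) (d := d) ht hz
    positivity
  · filter_upwards [eventually_gt_atTop 0] with t ht
    unfold defectWeight
    have e1 : t ^ (-((1 - K) / d)) = t ^ (K / d) * t ^ (-(1 / d)) := by
      rw [← Real.rpow_add ht]; congr 1; ring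
    have e2 : t ^ (-(1 - K / d)) = t ^ (K / d) * t⁻¹ := by
      rw [← Real.rpow_neg_one, ← Real.rpow_add ht]; congr 1; ring
    rw [e1, e2]
    calc _ ≤ t ^ (K / d) * (‖z.1‖ * t ^ (-(1 / d)) + (1 + z.2) / t) := by
          gcongr; exact min_le_left _ _
      _ = _ := by rw [div_eq_mul_inv]; ring

lemma spaceTime_restrict_compl {a : ℝ} :
    (spaceTime N).restrict {z | a < z.2}ᶜ =
      (volume : Measure (RN N)).prod ((volume : Measure ℝ).restrict (Ioc 0 a)) := by
  have : {z : RN N × ℝ | a < z.2}ᶜ = univ ×ˢ Iic a := by ext z; simp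
  rw [this, spaceTime, ← Measure.prod_restrict, Measure.restrict_univ,
    Measure.restrict_restrict measurableSet_Iic, inter_comm, Ioi_inter_Iic]

/-- Integrals of a source against the weight `(1+s)^{K/d} + |y|^K`. -/
lemma lintegral_prod_weight_le {v : RN N × ℝ → ℝ≥0∞} {η : ℝ → ℝ≥0∞} (hv : Measurable v)
    {I : Set ℝ} (hI : I ⊆ Ioi 0)
    (hη : ∀ᵐ s ∂(volume : Measure ℝ).restrict (Ioi 0),
        ScaledBound K d (1 + s) (fun y => v (y, s)) (η s)) :
    ∫⁻ z, ENNReal.ofReal (2 * (1 + z.2) ^ (K / d) * spatialWeight K d (1 + z.2) z.1) * v z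
      ∂((volume : Measure (RN N)).prod ((volume : Measure ℝ).restrict I)) ≤
    ∫⁻ s in I, ENNReal.ofReal (2 * (1 + s) ^ (K / d)) * η s := by
  have hm : Measurable fun z : RN N × ℝ =>
      ENNReal.ofReal (2 * (1 + z.2) ^ (K / d) * spatialWeight K d (1 + z.2) z.1) * v z := by
    unfold spatialWeight; fun_prop
  rw [lintegral_prod_symm' _ hm]
  refine lintegral_mono_ae ?_
  filter_upwards [ae_restrict_of_ae_restrict_of_subset hI hη,
    ae_restrict_of_ae_restrict_of_subset hI (ae_restrict_mem measurableSet_Ioi)] with s hs hs0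
  have hs0 : 0 < s := hs0
  calc _ = ∫⁻ y, ENNReal.ofReal (2 * (1 + s) ^ (K / d)) *
        (v (y, s) * ENNReal.ofReal (spatialWeight K d (1 + s) y)) := by
        refine lintegral_congr fun y => ?_
        rw [ENNReal.ofReal_mul (by positivity)]; ring
    _ = ENNReal.ofReal (2 * (1 + s) ^ (K / d)) *
        ∫⁻ y, v (y, s) * ENNReal.ofReal (spatialWeight K d (1 + s) y) :=
        lintegral_const_mul' _ _ ENNReal.ofReal_ne_top
    _ ≤ _ := by gcongr; exact hs.1

variable {v₀ : RN N → ℝ≥0∞} {v : RN N × ℝ → ℝ≥0∞} {b c : ℝ}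

/-- Dominated convergence handles the data and the early sources; the majorant is integrable since
`(1+s)^{K/d-b-1}` is, for `b > K/d`. The late sources contribute `O(t^{-b})`, which is also
`o(t^{-K/d})`. -/
lemma tendsto_defectSize (hK0 : 0 ≤ K) (hK1 : K < 1) (hKd : K < d) (hv₀ : Measurable v₀)
    (hv : Measurable v)
    (hφ : ∫⁻ y, ENNReal.ofReal (spatialWeight K d 1 y) * v₀ y ≠ ∞) (hc : 0 ≤ c) (hb : K / d < b)
    (hη : ∀ᵐ s ∂(volume : Measure ℝ).restrict (Ioi 0),
      ScaledBound K d (1 + s) (fun y => v (y, s)) (ENNReal.ofReal (c * (1 + s) ^ (-b - 1)))) :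
    Tendsto (fun t => ENNReal.ofReal (t ^ (K / d)) *
      defectSize K d v₀ v (fun s => ENNReal.ofReal (c * (1 + s) ^ (-b - 1))) t) atTop (𝓝 0) := by
  have hd : 0 < d := by linarith
  have hb0 : 0 < b := lt_of_le_of_lt (by positivity) hb
  have hpt : ∀ z : RN N × ℝ, 0 ≤ z.2 → ∀ a : ℝ≥0∞, a ≠ ∞ → Tendsto (fun t : ℝ =>
      ENNReal.ofReal (t ^ (K / d) * defectWeight K d t z) * a) atTop (𝓝 0) := by
    intro z hz a ha
    have h1 := ENNReal.tendsto_ofReal (tendsto_rpow_mul_defectWeight hK0 hK1 hKd hz)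
    rw [ENNReal.ofReal_zero] at h1
    simpa using ENNReal.Tendsto.mul_const h1 (Or.inr ha)
  have l0 : Tendsto (fun t : ℝ => ∫⁻ y, ENNReal.ofReal (t ^ (K / d) * defectWeight K d t (y, 0)) *
      v₀ y) atTop (𝓝 (∫⁻ _ : RN N, 0)) := by
    refine tendsto_lintegral_filter_of_dominated_convergence
      (fun y => 2 * (ENNReal.ofReal (spatialWeight K d 1 y) * v₀ y)) ?_ ?_ ?_ ?_
    · refine Eventually.of_forall fun t => ?_
      have := (measurable_defectWeight (N := N) K d t).comp
        (by fun_prop : Measurable fun y : RN N => (y, (0 : ℝ)))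
      exact ((this.const_mul _).ennreal_ofReal).mul hv₀
    · filter_upwards [eventually_ge_atTop 1] with t ht
      refine Eventually.of_forall fun y => ?_
      rw [← mul_assoc]
      gcongr
      have := rpow_mul_defectWeight_le (N := N) hK0 hKd ht (z := (y, 0)) le_rfl (by simp; linarith)
      simp only [add_zero, Real.one_rpow, mul_one] at this
      calc _ ≤ _ := ENNReal.ofReal_le_ofReal this
        _ = _ := by rw [ENNReal.ofReal_mul (by norm_num)]; simp
    · rw [lintegral_const_mul' _ _ (by simp)]
      finiteness
    · have : ∀ᵐ y, ENNReal.ofReal (spatialWeight K d 1 y) * v₀ y < ∞ :=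
        ae_lt_top (((measurable_spatialWeight 1).ennreal_ofReal).mul hv₀) hφ
      filter_upwards [this] with y hy
      refine hpt (y, 0) le_rfl _ ?_
      intro h
      rw [h, ENNReal.mul_top] at hy
      · simp at hy
      · simpa using lt_of_lt_of_le one_pos (spatialWeight_one_le (K := K) (d := d) y one_pos)
  -- The indicator moves the domain, which depends on `t`, into the integrand.
  have l1 : Tendsto (fun t : ℝ => ∫⁻ z, {z : RN N × ℝ | t / 2 < z.2}ᶜ.indicator (fun z =>
      ENNReal.ofReal (t ^ (K / d) * defectWeight K d t z) * v z) z ∂spaceTime N) atTop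
      (𝓝 (∫⁻ _, 0 ∂spaceTime N)) := by
    have hS : ∀ t : ℝ, MeasurableSet {z : RN N × ℝ | t / 2 < z.2}ᶜ := fun t =>
      (measurableSet_lt measurable_const measurable_snd).compl
    have hbound : ∫⁻ z, ENNReal.ofReal (2 * (1 + z.2) ^ (K / d) *
        spatialWeight K d (1 + z.2) z.1) * v z ∂spaceTime N ≠ ∞ := by
      refine (lt_of_le_of_lt (lintegral_prod_weight_le hv subset_rfl hη) ?_).ne
      have h3 : ∫⁻ s in Ioi (0 : ℝ), ENNReal.ofReal (2 * c) *
          ENNReal.ofReal ((1 + s) ^ (-(b - K / d) - 1)) < ∞ := by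
        rw [lintegral_const_mul' _ _ ENNReal.ofReal_ne_top]
        exact ENNReal.mul_lt_top ENNReal.ofReal_lt_top (lintegral_Ioi_zero_rpow_lt_top (by linarith))
      refine lt_of_le_of_lt (le_of_eq ?_) h3
      refine setLIntegral_congr_fun measurableSet_Ioi fun s hs => ?_
      have hs : 0 < s := hs
      rw [← ENNReal.ofReal_mul (by positivity), ← ENNReal.ofReal_mul (by positivity)]
      congr 1
      have : (1 + s) ^ (-(b - K / d) - 1) = (1 + s) ^ (K / d) * (1 + s) ^ (-b - 1) := by
        rw [← Real.rpow_add (by positivity)]; congr 1; ring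
      rw [this]; ring
    have hmW : Measurable fun z : RN N × ℝ => ENNReal.ofReal (2 * (1 + z.2) ^ (K / d) *
        spatialWeight K d (1 + z.2) z.1) * v z := by
      unfold spatialWeight; fun_prop
    refine tendsto_lintegral_filter_of_dominated_convergence (fun z =>
      ENNReal.ofReal (2 * (1 + z.2) ^ (K / d) * spatialWeight K d (1 + z.2) z.1) * v z)
      ?_ ?_ hbound ?_
    · refine Eventually.of_forall fun t => ?_
      exact ((((measurable_defectWeight K d t).const_mul _).ennreal_ofReal).mul hv).indicator (hS t)
    · filter_upwards [eventually_ge_atTop 1] with t ht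
      filter_upwards [ae_spaceTime_pos N] with z hz
      by_cases h : t / 2 < z.2
      · simp [h]
      · rw [indicator_of_mem (by simpa using h)]
        exact mul_le_mul_left (ENNReal.ofReal_le_ofReal
          (rpow_mul_defectWeight_le hK0 hKd ht hz.le (not_lt.1 h))) _
    · filter_upwards [ae_lt_top hmW hbound, ae_spaceTime_pos N] with z hz hz0
      have hvz : v z ≠ ∞ := by
        intro h
        rw [h, ENNReal.mul_top] at hz
        · simp at hz
        · have h1 := spatialWeight_one_le (K := K) (d := d) z.1 (show 0 < 1 + z.2 by linarith)
          simp only [ne_eq, ENNReal.ofReal_eq_zero, not_le]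
          positivity
      refine tendsto_of_tendsto_of_tendsto_of_le_of_le tendsto_const_nhds (hpt z hz0.le _ hvz)
        (fun _ => zero_le) fun t => indicator_le_self _ _ _
  have l2 : Tendsto (fun t : ℝ => ENNReal.ofReal (c * (2 ^ b / b) * t ^ (-(b - K / d)))) atTop
      (𝓝 0) := by
    have := ENNReal.tendsto_ofReal
      ((tendsto_rpow_neg_atTop (show 0 < b - K / d by linarith)).const_mul (c * (2 ^ b / b)))
    simpa using this
  have lsum := (l0.add l1).add l2
  simp only [lintegral_zero, add_zero] at lsum
  refine tendsto_of_tendsto_of_tendsto_of_le_of_le' tendsto_const_nhds lsum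
    (Eventually.of_forall fun _ => zero_le) ?_
  filter_upwards [eventually_ge_atTop 1] with t ht
  have ht0 : 0 < t := by linarith
  have hS : MeasurableSet {z : RN N × ℝ | t / 2 < z.2}ᶜ :=
    (measurableSet_lt measurable_const measurable_snd).compl
  unfold defectSize
  rw [mul_add, mul_add, ← lintegral_const_mul' _ _ ENNReal.ofReal_ne_top,
    ← lintegral_const_mul' _ _ ENNReal.ofReal_ne_top, lintegral_indicator hS]
  have hp : 0 ≤ t ^ (K / d) := by positivity
  refine add_le_add (add_le_add (le_of_eq ?_) (le_of_eq ?_)) ?_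
  · refine lintegral_congr fun y => ?_
    rw [← mul_assoc, ENNReal.ofReal_mul hp]
  · refine lintegral_congr fun y => ?_
    rw [← mul_assoc, ENNReal.ofReal_mul hp]
  · calc _ ≤ ENNReal.ofReal (t ^ (K / d)) * ENNReal.ofReal (c * (2 ^ b / b) * t ^ (-b)) := by
          gcongr; exact lintegral_Ioi_rpow_le hb0 hc ht0
      _ = _ := by
          rw [← ENNReal.ofReal_mul hp]
          congr 1
          have : t ^ (-(b - K / d)) = t ^ (K / d) * t ^ (-b) := by
            rw [← Real.rpow_add ht0]; congr 1; ring
          rw [this]; ring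

/-- The size of the defect, up to an integral of the source over past times. -/
lemma defectSize_le (hK0 : 0 ≤ K) (hKd : K < d) (hv : Measurable v)
    (hφ : ∫⁻ y, ENNReal.ofReal (spatialWeight K d 1 y) * v₀ y ≠ ∞) (hc : 0 ≤ c) (hb : 0 < b)
    (hη : ∀ᵐ s ∂(volume : Measure ℝ).restrict (Ioi 0),
      ScaledBound K d (1 + s) (fun y => v (y, s)) (ENNReal.ofReal (c * (1 + s) ^ (-b - 1)))) :
    ∃ B : ℝ, 0 ≤ B ∧ ∀ t : ℝ, 1 ≤ t → ∀ J : ℝ, 0 ≤ J →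
      ∫⁻ s in Ioc 0 (t / 2), ENNReal.ofReal ((1 + s) ^ (K / d - b - 1)) ≤ ENNReal.ofReal J →
      defectSize K d v₀ v (fun s => ENNReal.ofReal (c * (1 + s) ^ (-b - 1))) t ≤
        ENNReal.ofReal (B * (t ^ (-(K / d)) * (1 + J) + t ^ (-b))) := by
  set Φ := (∫⁻ y, ENNReal.ofReal (spatialWeight K d 1 y) * v₀ y).toReal with hΦdef
  have hΦ0 : 0 ≤ Φ := ENNReal.toReal_nonneg
  have hΦ : ∫⁻ y, ENNReal.ofReal (spatialWeight K d 1 y) * v₀ y = ENNReal.ofReal Φ :=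
    (ENNReal.ofReal_toReal hφ).symm
  -- The three summands come from the data, the early sources and the tail, in this order.
  refine ⟨2 * Φ + 2 * c + c * (2 ^ b / b), by positivity, fun t ht J hJ0 hJ => ?_⟩
  have hd : 0 < d := by linarith
  have ht0 : 0 < t := by linarith
  have hinv : ∀ z : RN N × ℝ, 0 ≤ z.2 → z.2 ≤ t / 2 → ENNReal.ofReal (defectWeight K d t z) ≤
      ENNReal.ofReal (t ^ (-(K / d))) *
        ENNReal.ofReal (2 * (1 + z.2) ^ (K / d) * spatialWeight K d (1 + z.2) z.1) := by
    intro z hz hzt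
    rw [← ENNReal.ofReal_mul (by positivity)]
    refine ENNReal.ofReal_le_ofReal ?_
    rw [Real.rpow_neg ht0.le, ← div_eq_inv_mul, le_div_iff₀ (by positivity), mul_comm]
    exact rpow_mul_defectWeight_le hK0 hKd ht hz hzt
  have e0 : ∫⁻ y, ENNReal.ofReal (defectWeight K d t (y, 0)) * v₀ y ≤
      ENNReal.ofReal (t ^ (-(K / d)) * (2 * Φ)) := by
    calc _ ≤ ∫⁻ y, ENNReal.ofReal (t ^ (-(K / d)) * 2) *
          (ENNReal.ofReal (spatialWeight K d 1 y) * v₀ y) := by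
          refine lintegral_mono fun y => ?_
          have := hinv (y, 0) le_rfl (by simp; linarith)
          simp only [add_zero, Real.one_rpow, mul_one] at this
          calc _ ≤ _ := mul_le_mul_left this _
            _ = _ := by
              rw [ENNReal.ofReal_mul (by norm_num), ENNReal.ofReal_mul (by positivity)]; ring
      _ = ENNReal.ofReal (t ^ (-(K / d)) * 2) * ENNReal.ofReal Φ := by
          rw [lintegral_const_mul' _ _ ENNReal.ofReal_ne_top, hΦ]
      _ = _ := by rw [← ENNReal.ofReal_mul (by positivity)]; ring_nf
  have e1 : ∫⁻ z in {z | t / 2 < z.2}ᶜ, ENNReal.ofReal (defectWeight K d t z) * v z ∂spaceTime N ≤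
      ENNReal.ofReal (t ^ (-(K / d)) * (2 * c * J)) := by
    have hS : MeasurableSet {z : RN N × ℝ | t / 2 < z.2}ᶜ :=
      (measurableSet_lt measurable_const measurable_snd).compl
    calc _ ≤ ∫⁻ z in {z | t / 2 < z.2}ᶜ, ENNReal.ofReal (t ^ (-(K / d))) *
          (ENNReal.ofReal (2 * (1 + z.2) ^ (K / d) * spatialWeight K d (1 + z.2) z.1) * v z)
            ∂spaceTime N := by
          refine lintegral_mono_ae ?_
          filter_upwards [ae_restrict_mem hS, ae_restrict_of_ae (ae_spaceTime_pos N)] with z hz hz0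
          rw [← mul_assoc]
          gcongr
          exact hinv z hz0.le (by simpa using hz)
      _ = ENNReal.ofReal (t ^ (-(K / d))) * ∫⁻ z in {z | t / 2 < z.2}ᶜ,
          ENNReal.ofReal (2 * (1 + z.2) ^ (K / d) * spatialWeight K d (1 + z.2) z.1) * v z
            ∂spaceTime N := lintegral_const_mul' _ _ ENNReal.ofReal_ne_top
      _ ≤ ENNReal.ofReal (t ^ (-(K / d))) * ∫⁻ s in Ioc 0 (t / 2),
          ENNReal.ofReal (2 * (1 + s) ^ (K / d)) * ENNReal.ofReal (c * (1 + s) ^ (-b - 1)) := by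
          rw [spaceTime_restrict_compl]
          gcongr
          exact lintegral_prod_weight_le hv Ioc_subset_Ioi_self hη
      _ = ENNReal.ofReal (t ^ (-(K / d))) * (ENNReal.ofReal (2 * c) * ∫⁻ s in Ioc 0 (t / 2),
          ENNReal.ofReal ((1 + s) ^ (K / d - b - 1))) := by
          congr 1
          rw [← lintegral_const_mul' _ _ ENNReal.ofReal_ne_top]
          refine setLIntegral_congr_fun measurableSet_Ioc fun s hs => ?_
          have hs : 0 < s := hs.1
          rw [← ENNReal.ofReal_mul (by positivity), ← ENNReal.ofReal_mul (by positivity)]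
          congr 1
          have : (1 + s) ^ (K / d - b - 1) = (1 + s) ^ (K / d) * (1 + s) ^ (-b - 1) := by
            rw [← Real.rpow_add (by positivity)]; congr 1; ring
          rw [this]; ring
      _ ≤ ENNReal.ofReal (t ^ (-(K / d))) * (ENNReal.ofReal (2 * c) * ENNReal.ofReal J) := by
          gcongr
      _ = _ := by rw [← ENNReal.ofReal_mul (by positivity), ← ENNReal.ofReal_mul (by positivity)]
  have e2 := lintegral_Ioi_rpow_le hb hc ht0
  unfold defectSize
  calc _ ≤ _ := add_le_add (add_le_add e0 e1) e2
    _ = ENNReal.ofReal (t ^ (-(K / d)) * (2 * Φ) + t ^ (-(K / d)) * (2 * c * J) +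
        c * (2 ^ b / b) * t ^ (-b)) := by
        rw [← ENNReal.ofReal_add (by positivity) (by positivity),
          ← ENNReal.ofReal_add (by positivity) (by positivity)]
    _ ≤ _ := by
        refine ENNReal.ofReal_le_ofReal ?_
        have h1 : 0 < t ^ (-(K / d)) := by positivity
        have h2 : 0 < t ^ (-b) := by positivity
        have h3 : 0 ≤ c * (2 ^ b / b) := by positivity
        have h4 : 0 ≤ t ^ (-(K / d)) * J := by positivity
        nlinarith [mul_nonneg hΦ0 h1.le, mul_nonneg hc h1.le, mul_nonneg h3 h1.le,
          mul_nonneg hΦ0 h2.le, mul_nonneg hc h2.le, mul_nonneg hΦ0 h4, mul_nonneg h3 h4]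

/-- For `b < K/d` the integral over past times grows like `t^{K/d-b}`. Multiplied by `t^{-K/d}` this
is `t^{-b}`, the same rate as the tail, while the data decay at least as fast. -/
lemma defectSize_le_of_lt (hK0 : 0 ≤ K) (hKd : K < d) (hv : Measurable v)
    (hφ : ∫⁻ y, ENNReal.ofReal (spatialWeight K d 1 y) * v₀ y ≠ ∞) (hc : 0 ≤ c) (hb : 0 < b)
    (hbK : b < K / d)
    (hη : ∀ᵐ s ∂(volume : Measure ℝ).restrict (Ioi 0),
      ScaledBound K d (1 + s) (fun y => v (y, s)) (ENNReal.ofReal (c * (1 + s) ^ (-b - 1)))) :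
    ∃ B : ℝ, 0 ≤ B ∧ ∀ t : ℝ, 1 ≤ t →
      defectSize K d v₀ v (fun s => ENNReal.ofReal (c * (1 + s) ^ (-b - 1))) t ≤
        ENNReal.ofReal (B * t ^ (-b)) := by
  obtain ⟨B, hB, h⟩ := defectSize_le hK0 hKd hv hφ hc hb hη
  have he : 0 < K / d - b := by linarith
  set Q := (2 : ℝ) ^ (K / d - b) / (K / d - b)
  have hQ : 0 < Q := by positivity
  refine ⟨B * (2 + Q), by positivity, fun t ht => ?_⟩
  have ht0 : 0 < t := by linarith
  refine (h t ht ((1 + t / 2) ^ (K / d - b) / (K / d - b)) (by positivity)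
    (lintegral_Ioc_rpow_le he (by linarith))).trans (ENNReal.ofReal_le_ofReal ?_)
  have h1 : (1 + t / 2) ^ (K / d - b) / (K / d - b) ≤ Q * t ^ (K / d - b) := by
    have : (1 + t / 2) ^ (K / d - b) ≤ (2 * t) ^ (K / d - b) :=
      Real.rpow_le_rpow (by positivity) (by linarith) he.le
    rw [Real.mul_rpow (by norm_num) ht0.le] at this
    calc _ ≤ (2 ^ (K / d - b) * t ^ (K / d - b)) / (K / d - b) := by gcongr
      _ = _ := by ring
  have h2 : t ^ (-(K / d)) * t ^ (K / d - b) = t ^ (-b) := by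
    rw [← Real.rpow_add ht0]; congr 1; ring
  have h3 : t ^ (-(K / d)) ≤ t ^ (-b) := Real.rpow_le_rpow_of_exponent_le ht (by linarith)
  have h4 : 0 < t ^ (-(K / d)) := by positivity
  calc _ ≤ B * (t ^ (-(K / d)) * (1 + Q * t ^ (K / d - b)) + t ^ (-b)) := by gcongr
    _ = B * (t ^ (-(K / d)) + Q * (t ^ (-(K / d)) * t ^ (K / d - b)) + t ^ (-b)) := by ring
    _ ≤ B * (t ^ (-b) + Q * t ^ (-b) + t ^ (-b)) := by rw [h2]; gcongr
    _ = _ := by ring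

/-- The exponent in the past integral is now `-1`, whence a logarithm. The form `1 + log t` keeps
the bound valid down to `t = 1`. -/
lemma defectSize_le_of_eq (hK0 : 0 ≤ K) (hKd : K < d) (hv : Measurable v)
    (hφ : ∫⁻ y, ENNReal.ofReal (spatialWeight K d 1 y) * v₀ y ≠ ∞) (hc : 0 ≤ c) (hb : 0 < b)
    (hbK : b = K / d)
    (hη : ∀ᵐ s ∂(volume : Measure ℝ).restrict (Ioi 0),
      ScaledBound K d (1 + s) (fun y => v (y, s)) (ENNReal.ofReal (c * (1 + s) ^ (-b - 1)))) :
    ∃ B : ℝ, 0 ≤ B ∧ ∀ t : ℝ, 1 ≤ t →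
      defectSize K d v₀ v (fun s => ENNReal.ofReal (c * (1 + s) ^ (-b - 1))) t ≤
        ENNReal.ofReal (B * (t ^ (-b) * (1 + Real.log t))) := by
  obtain ⟨B, hB, h⟩ := defectSize_le hK0 hKd hv hφ hc hb hη
  refine ⟨3 * B, by positivity, fun t ht => ?_⟩
  have ht0 : 0 < t := by linarith
  have hlog : 0 ≤ Real.log t := Real.log_nonneg ht
  refine (h t ht (1 + Real.log t) (by positivity) ?_).trans (ENNReal.ofReal_le_ofReal ?_)
  · have e : ∀ s : ℝ, (1 + s) ^ (K / d - b - 1) = (1 + s)⁻¹ := fun s => by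
      rw [← hbK, sub_self, zero_sub, Real.rpow_neg_one]
    simp_rw [e]
    refine (lintegral_Ioc_inv_le (by linarith)).trans (ENNReal.ofReal_le_ofReal ?_)
    calc Real.log (1 + t / 2) ≤ Real.log (2 * t) := Real.log_le_log (by linarith) (by linarith)
      _ = Real.log 2 + Real.log t := Real.log_mul (by norm_num) ht0.ne'
      _ ≤ _ := by linarith [Real.log_two_lt_d9]
  · rw [← hbK]
    have h4 : 0 < t ^ (-b) := by positivity
    nlinarith [mul_nonneg hB h4.le, mul_nonneg (mul_nonneg hB h4.le) hlog]

end Weight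

/-! ### Measurability and decay of the nonlinearity. -/

namespace IsPowerNonlinearity

variable {N : ℕ} {Cstar A p : ℝ} {F : RN N → ℝ → ℝ → ℝ} (hF : IsPowerNonlinearity N Cstar A p F)
include hF

lemma continuous_right (hp : 1 ≤ p) (x : RN N) {t : ℝ} (ht : 0 < t) : Continuous (F x t) := by
  rw [continuous_iff_continuousAt]
  intro v
  rw [ContinuousAt, tendsto_iff_norm_sub_tendsto_zero]
  have hc : Continuous fun w : ℝ =>
      Cstar * (1 + t) ^ A * max (|w| ^ (p - 1)) (|v| ^ (p - 1)) * |w - v| := by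
    have : Continuous fun w : ℝ => |w| ^ (p - 1) :=
      (Real.continuous_rpow_const (by linarith)).comp continuous_abs
    fun_prop
  have hl := hc.tendsto v
  simp only [sub_self, abs_zero, mul_zero] at hl
  exact squeeze_zero (fun _ => norm_nonneg _) (fun w => hF.lipschitz x t ht w v) hl

/-- Compositions of the nonlinearity with measurable functions are measurable. -/
lemma aestronglyMeasurable_comp (hp : 1 ≤ p) {w : RN N × ℝ → ℝ}
    (hw : AEStronglyMeasurable w (spaceTime N)) :
    AEStronglyMeasurable (fun z => F z.1 z.2 (w z)) (spaceTime N) := by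
  set w' := hw.mk w
  have hw' : StronglyMeasurable w' := hw.stronglyMeasurable_mk
  -- The Carathéodory argument: for a simple function the composition is a finite sum of `F(·,·,v)`
  -- cut off to level sets, and continuity in `v` passes to the limit.
  refine aestronglyMeasurable_of_tendsto_ae atTop
    (f := fun (n : ℕ) z => F z.1 z.2 (hw'.approx n z)) (fun n => ?_) ?_
  · set s := hw'.approx n
    have e : (fun z : RN N × ℝ => F z.1 z.2 (s z)) =
        fun z => ∑ v ∈ s.range, (s ⁻¹' {v}).indicator (fun z : RN N × ℝ => F z.1 z.2 v) z := by
      ext z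
      rw [Finset.sum_eq_single (s z)]
      · simp
      · intro v _ hv
        simp [Set.indicator, hv.symm]
      · intro h
        exact absurd (s.mem_range_self z) h
    rw [e]
    exact Finset.aestronglyMeasurable_fun_sum _ fun v _ =>
      (hF.measurable v).indicator (s.measurableSet_fiber v)
  · filter_upwards [hw.ae_eq_mk, ae_spaceTime_pos N] with z hz hz0
    rw [hz]
    exact ((hF.continuous_right hp z.1 hz0).tendsto _).comp (hw'.tendsto_approx z)

/-- The nonlinearity is Lipschitz with an integrable-in-time constant on functions with the decay
of the kernel. -/
lemma abs_sub_le_decay (hC : 0 ≤ Cstar) (hp : 1 ≤ p) {d b : ℝ} (hb : 0 ≤ b) {x : RN N} {t v₁ v₂ : ℝ}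
    (ht : 0 < t) (h₁ : |v₁| ≤ b * (1 + t) ^ (-((N : ℝ) / d)))
    (h₂ : |v₂| ≤ b * (1 + t) ^ (-((N : ℝ) / d))) :
    |F x t v₁ - F x t v₂| ≤
      Cstar * b ^ (p - 1) * (1 + t) ^ (-decayRate N d A p - 1) * |v₁ - v₂| := by
  have h1t : 0 < 1 + t := by linarith
  have hp0 : 0 ≤ p - 1 := by linarith
  have e : (b * (1 + t) ^ (-((N : ℝ) / d))) ^ (p - 1) =
      b ^ (p - 1) * (1 + t) ^ (-((N : ℝ) * (p - 1) / d)) := by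
    rw [Real.mul_rpow hb (by positivity), ← Real.rpow_mul h1t.le]
    congr 2; ring
  have hm : max (|v₁| ^ (p - 1)) (|v₂| ^ (p - 1)) ≤
      b ^ (p - 1) * (1 + t) ^ (-((N : ℝ) * (p - 1) / d)) := by
    rw [← e]
    exact max_le (Real.rpow_le_rpow (abs_nonneg _) h₁ hp0)
      (Real.rpow_le_rpow (abs_nonneg _) h₂ hp0)
  -- The exponent `A - N(p-1)/d` equals `-A_p - 1`; positivity of `A_p` is thus integrability in
  -- time.
  have e2 : (1 + t) ^ (-decayRate N d A p - 1) =
      (1 + t) ^ A * (1 + t) ^ (-((N : ℝ) * (p - 1) / d)) := by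
    rw [← Real.rpow_add h1t]; congr 1; unfold decayRate; ring
  calc _ ≤ _ := hF.lipschitz x t ht v₁ v₂
    _ ≤ Cstar * (1 + t) ^ A * (b ^ (p - 1) * (1 + t) ^ (-((N : ℝ) * (p - 1) / d))) * |v₁ - v₂| := by
        gcongr
    _ = _ := by rw [e2]; ring

end IsPowerNonlinearity

/-! ### From the scaled norm to `L^q` and weighted `L^1` norms. -/

namespace ScaledBound

variable {N : ℕ} {K d l t : ℝ} {w : RN N → ℝ} {ε : ℝ≥0∞} {q : ℝ≥0∞}

/-- Interpolation between `L^1` and `L^∞`. -/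
lemma eLpNorm_le (h : ScaledBound K d t (fun x => ‖w x‖ₑ) ε) (hε : ε ≠ ∞) (ht : 0 < t)
    (hq : 1 ≤ q) :
    eLpNorm w q volume ≤ ε * ENNReal.ofReal (t ^ (-lqExponent N d q)) := by
  rcases eq_or_ne q ∞ with rfl | hqt
  · rw [eLpNorm_exponent_top]
    refine (eLpNormEssSup_le_of_ae_enorm_bound h.2).trans (le_of_eq ?_)
    simp [lqExponent]
  · have hq0 : q ≠ 0 := (lt_of_lt_of_le one_pos hq).ne'
    have hqr : 1 ≤ q.toReal := by
      rw [← ENNReal.toReal_one]; exact ENNReal.toReal_mono hqt hq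
    rw [eLpNorm_eq_lintegral_rpow_enorm_toReal hq0 hqt]
    set r := q.toReal
    have hr0 : 0 < r := by linarith
    set S := ENNReal.ofReal (t ^ (-((N : ℝ) / d)))
    -- All but one power of `|w|` is estimated by the sup bound, the last by the `L^1` bound.
    have h1 : ∫⁻ x, ‖w x‖ₑ ^ r ≤ (ε * S) ^ (r - 1) * ε := by
      calc _ ≤ ∫⁻ x, (ε * S) ^ (r - 1) * ‖w x‖ₑ := by
            refine lintegral_mono_ae ?_
            filter_upwards [h.2] with x hx
            calc ‖w x‖ₑ ^ r = ‖w x‖ₑ ^ (r - 1) * ‖w x‖ₑ := by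
                  conv_rhs => rw [← ENNReal.rpow_one (‖w x‖ₑ), ← ENNReal.rpow_mul, one_mul]
                  rw [← ENNReal.rpow_add_of_nonneg _ _ (by linarith) zero_le_one]
                  congr 1; ring
              _ ≤ _ := by
                gcongr
        _ = (ε * S) ^ (r - 1) * ∫⁻ x, ‖w x‖ₑ :=
            lintegral_const_mul' _ _ (ENNReal.rpow_ne_top_of_nonneg (by linarith) (by finiteness))
        _ ≤ _ := by gcongr; exact h.lintegral_le ht
    calc _ ≤ ((ε * S) ^ (r - 1) * ε) ^ (1 / r) := by gcongr
      _ = (ε ^ r * S ^ (r - 1)) ^ (1 / r) := by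
          congr 1
          rw [ENNReal.mul_rpow_of_nonneg _ _ (by linarith)]
          have : ε ^ r = ε ^ (r - 1) * ε := by
            conv_rhs => rw [← ENNReal.rpow_one ε, ← ENNReal.rpow_mul, one_mul]
            rw [← ENNReal.rpow_add_of_nonneg _ _ (by linarith) zero_le_one]
            congr 1; ring
          rw [this]; ring
      _ = ε * S ^ ((r - 1) * (1 / r)) := by
          rw [ENNReal.mul_rpow_of_nonneg _ _ (by positivity), ← ENNReal.rpow_mul, ← ENNReal.rpow_mul,
            mul_one_div_cancel hr0.ne', ENNReal.rpow_one]
      _ = _ := by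
          congr 1
          rw [ENNReal.ofReal_rpow_of_nonneg (by positivity) (by
            refine mul_nonneg (by linarith) (by positivity)), ← Real.rpow_mul ht.le]
          congr 2
          unfold lqExponent
          rw [ENNReal.toReal_inv]
          change _ = -((N : ℝ) / d * (1 - r⁻¹))
          field_simp

lemma memLp (h : ScaledBound K d t (fun x => ‖w x‖ₑ) ε) (hε : ε ≠ ∞) (ht : 0 < t)
    (hw : AEStronglyMeasurable w volume) (hq : 1 ≤ q) : MemLp w q volume :=
  ⟨hw, lt_of_le_of_lt (h.eLpNorm_le hε ht hq) (by finiteness)⟩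

/-- In the variable `z = t^{-1/d}‖x‖` one has `z^l ≤ 1 + z^K` for `0 ≤ l ≤ K`, so the single
exponent `K` controls all smaller ones. -/
lemma lintegral_weight_le (h : ScaledBound K d t (fun x => ‖w x‖ₑ) ε) (ht : 0 < t)
    (hl0 : 0 ≤ l) (hlK : l ≤ K) :
    ∫⁻ x, ‖|w x| * (1 + ‖x‖ ^ l)‖ₑ ≤ ENNReal.ofReal (1 + t ^ (l / d)) * ε := by
  calc _ ≤ ∫⁻ x, ENNReal.ofReal (1 + t ^ (l / d)) *
        (‖w x‖ₑ * ENNReal.ofReal (spatialWeight K d t x)) := by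
        refine lintegral_mono fun x => ?_
        rw [enorm_mul, Real.enorm_abs, Real.enorm_eq_ofReal (show 0 ≤ 1 + ‖x‖ ^ l by positivity), mul_left_comm,
          ← ENNReal.ofReal_mul (by positivity)]
        gcongr
        set z := t ^ (-(1 / d)) * ‖x‖ with hz
        have hz0 : 0 ≤ z := by positivity
        have e1 : t ^ (l / d) * z ^ l = ‖x‖ ^ l := by
          rw [hz, Real.mul_rpow (by positivity) (norm_nonneg _), ← Real.rpow_mul ht.le, ← mul_assoc,
            ← Real.rpow_add ht]
          have : l / d + -(1 / d) * l = 0 := by ring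
          rw [this]; simp
        have e2 : spatialWeight K d t x = 1 + z ^ K := by
          unfold spatialWeight
          rw [hz, Real.mul_rpow (by positivity) (norm_nonneg _), ← Real.rpow_mul ht.le]
          congr 3; ring
        have e3 : z ^ l ≤ 1 + z ^ K := by
          rcases le_total z 1 with h1 | h1
          · have := Real.rpow_le_one hz0 h1 hl0
            have : 0 ≤ z ^ K := by positivity
            linarith
          · have := Real.rpow_le_rpow_of_exponent_le h1 hlK
            linarith
        have e4 : 0 ≤ z ^ K := by positivity
        have e5 : 0 < t ^ (l / d) := by positivity
        rw [e2, ← e1]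
        nlinarith
    _ = ENNReal.ofReal (1 + t ^ (l / d)) *
        ∫⁻ x, ‖w x‖ₑ * ENNReal.ofReal (spatialWeight K d t x) :=
        lintegral_const_mul' _ _ ENNReal.ofReal_ne_top
    _ ≤ _ := by gcongr; exact h.1

lemma memWeightedL1 (h : ScaledBound K d t (fun x => ‖w x‖ₑ) ε) (hε : ε ≠ ∞)
    (ht : 0 < t) (hw : AEStronglyMeasurable w volume) (hl0 : 0 ≤ l) (hlK : l ≤ K) :
    MemWeightedL1 l w := by
  refine ⟨hw, ?_, lt_of_le_of_lt (h.lintegral_weight_le ht hl0 hlK) (by finiteness)⟩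
  exact (hw.norm.congr (Eventually.of_forall fun x => rfl)).mul
    (by fun_prop : Measurable fun x : RN N => 1 + ‖x‖ ^ l).aestronglyMeasurable

/-- The scaled bound controls all the scaled norms at large times. -/
lemma scaledNorm_le {w : RN N → ℝ → ℝ} (h : ScaledBound K d t (fun x => ‖w x t‖ₑ) ε) (hε : ε ≠ ∞)
    (hd : 0 < d) (ht : 1 ≤ t) (hw : AEStronglyMeasurable (fun x => w x t) volume) (hq : 1 ≤ q)
    (hl0 : 0 ≤ l) (hlK : l ≤ K) :
    scaledNorm d q l w t ≤ 3 * ε.toReal := by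
  have ht0 : 0 < t := by linarith
  have h1 : t ^ lqExponent N d q * lqNorm q (fun x => w x t) ≤ ε.toReal := by
    unfold lqNorm
    have := ENNReal.toReal_mono (by finiteness) (h.eLpNorm_le hε ht0 hq)
    rw [ENNReal.toReal_mul, ENNReal.toReal_ofReal (by positivity), Real.rpow_neg ht0.le] at this
    have hp : 0 < t ^ lqExponent N d q := by positivity
    calc _ ≤ t ^ lqExponent N d q * (ε.toReal * (t ^ lqExponent N d q)⁻¹) := by gcongr
      _ = _ := by field_simp
  have h2 : weightedL1Norm l (fun x => w x t) ≤ (1 + t ^ (l / d)) * ε.toReal := by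
    unfold weightedL1Norm
    rw [integral_eq_lintegral_of_nonneg_ae (Eventually.of_forall fun y => by positivity)
      (h.memWeightedL1 hε ht0 hw hl0 hlK).2.1]
    have e : ∀ y : RN N, ENNReal.ofReal (|w y t| * (1 + ‖y‖ ^ l)) = ‖|w y t| * (1 + ‖y‖ ^ l)‖ₑ :=
      fun y => (Real.enorm_eq_ofReal (by positivity)).symm
    simp_rw [e]
    have := ENNReal.toReal_mono (by finiteness) (h.lintegral_weight_le ht0 hl0 hlK)
    rwa [ENNReal.toReal_mul, ENNReal.toReal_ofReal (by positivity)] at this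
  have h3 : t ^ (-(l / d)) * weightedL1Norm l (fun x => w x t) ≤ 2 * ε.toReal := by
    have hp : 0 < t ^ (l / d) := by positivity
    have hp1 : 1 ≤ t ^ (l / d) := Real.one_le_rpow ht (by positivity)
    rw [Real.rpow_neg ht0.le, inv_mul_le_iff₀ hp]
    refine h2.trans ?_
    have : 0 ≤ ε.toReal := ENNReal.toReal_nonneg
    nlinarith
  -- The `L^q` part contributes `1` and the weighted part `2`, since `1 + t^{l/d} ≤ 2 t^{l/d}` for
  -- `t ≥ 1`.
  unfold scaledNorm
  linarith

end ScaledBound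

/-! ### Scaled bounds for `u` and `g`. -/

/-- The a priori bounds, in the scaled norm. -/
lemma HasHeatBounds.scaledBound {N : ℕ} {d K : ℝ} {u : RN N → ℝ → ℝ} (hub : HasHeatBounds d K u)
    (hK0 : 0 ≤ K) : ∃ C : ℝ, 0 ≤ C ∧ ∀ t : ℝ, 0 < t →
      ScaledBound K d (1 + t) (fun x => ‖u x t‖ₑ) (ENNReal.ofReal C) := by
  -- Only the exponents `q = 1`, `q = ∞` and `l = K` are needed; the rest follows by interpolation.
  obtain ⟨C₁, h1⟩ := (hub 1 K le_rfl hK0 le_rfl).1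
  obtain ⟨C₂, h2⟩ := (hub 1 K le_rfl hK0 le_rfl).2
  obtain ⟨C₃, h3⟩ := (hub ∞ K le_top hK0 le_rfl).1
  refine ⟨max (max C₁ 0 + max C₂ 0) (max C₃ 0), by positivity, fun t ht => ⟨?_, ?_⟩⟩
  · obtain ⟨m1, b1⟩ := h1 t ht
    obtain ⟨m2, b2⟩ := h2 t ht
    have ht1 : 0 < 1 + t := by linarith
    have hi : Integrable (fun x => |u x t|) := (memLp_one_iff_integrable.1 m1).abs
    have n1 : ∫ x, |u x t| ≤ C₁ := by
      have e : lqNorm 1 (fun x => u x t) = ∫ x, |u x t| := by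
        unfold lqNorm
        rw [eLpNorm_one_eq_lintegral_enorm, ← integral_norm_eq_lintegral_enorm m1.1]
        rfl
      rw [e] at b1
      simpa [lqExponent] using b1
    have hsum : Integrable (fun x => |u x t| + (1 + t) ^ (-(K / d)) *
        (|u x t| * (1 + ‖x‖ ^ K))) := hi.add (m2.2.const_mul _)
    calc _ ≤ ∫⁻ x, ENNReal.ofReal (|u x t| + (1 + t) ^ (-(K / d)) * (|u x t| * (1 + ‖x‖ ^ K))) := by
          refine lintegral_mono fun x => ?_
          beta_reduce
          rw [Real.enorm_eq_ofReal_abs, ← ENNReal.ofReal_mul (abs_nonneg _)]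
          refine ENNReal.ofReal_le_ofReal ?_
          unfold spatialWeight
          have : 0 ≤ (1 + t) ^ (-(K / d)) * |u x t| := by positivity
          nlinarith
      _ = ENNReal.ofReal (∫ x, (|u x t| + (1 + t) ^ (-(K / d)) * (|u x t| * (1 + ‖x‖ ^ K)))) :=
          (ofReal_integral_eq_lintegral_ofReal hsum
            (Eventually.of_forall fun x => by positivity)).symm
      _ ≤ _ := by
          refine ENNReal.ofReal_le_ofReal ?_
          rw [integral_add hi (m2.2.const_mul _), integral_const_mul]
          refine le_trans (add_le_add (n1.trans (le_max_left C₁ 0)) (b2.trans (le_max_left C₂ 0)))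
            (le_max_left _ _)
  · obtain ⟨m3, b3⟩ := h3 t ht
    have ht1 : 0 < 1 + t := by linarith
    filter_upwards [ae_le_eLpNormEssSup (f := fun x => u x t) (μ := volume)] with x hx
    refine hx.trans ?_
    rw [← eLpNorm_exponent_top, ← ENNReal.ofReal_toReal m3.2.ne, ← ENNReal.ofReal_mul (by positivity)]
    refine ENNReal.ofReal_le_ofReal ?_
    have e : lqExponent N d ∞ = (N : ℝ) / d := by simp [lqExponent]
    rw [e] at b3
    change lqNorm ∞ (fun x => u x t) ≤ _
    rw [Real.rpow_neg ht1.le, ← div_eq_mul_inv, le_div_iff₀ (by positivity), mul_comm]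
    exact b3.trans ((le_max_left _ _).trans (le_max_right _ _))

lemma IsGeneralizedHeatKernel.scaledBound_shiftedKernel {N γ : ℕ} {d L K : ℝ} {G : RN N → ℝ → ℝ}
    (hG : IsGeneralizedHeatKernel N γ d L G) (hK0 : 0 ≤ K) (hK1 : K ≤ 1) (hKL : K < L) :
    ∃ C : ℝ, 0 ≤ C ∧ ∀ t : ℝ, 0 < t →
      ScaledBound K d (1 + t) (fun x => ‖shiftedKernel G x t‖ₑ) (ENNReal.ofReal C) := by
  obtain ⟨C₁, hC₁, h1⟩ := hG.lintegral_kernel_mul_spatialWeight hK0 hK1 hKL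
  obtain ⟨C₂, hC₂, h2⟩ := hG.abs_le_rpow
  have hd := hG.d_pos
  refine ⟨max (C₁ * 2).toReal C₂, by positivity, fun t ht => ⟨?_, Eventually.of_forall fun x => ?_⟩⟩
  · have h0 := h1 (t + 1) (1 + t) 0 (by linarith) (by linarith)
    simp only [sub_zero] at h0
    have hW : ENNReal.ofReal (spatialWeight K d (1 + t) (0 : RN N)) ≤ 2 := by
      have h3 : (1 + t) ^ (-(K / d)) * ‖(0 : RN N)‖ ^ K ≤ 1 * 1 := by
        gcongr
        · exact Real.rpow_le_one_of_one_le_of_nonpos (by linarith)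
            (by have : 0 ≤ K / d := by positivity
                linarith)
        · rw [norm_zero]; exact Real.zero_rpow_le_one K
      calc _ ≤ ENNReal.ofReal 2 := ENNReal.ofReal_le_ofReal (by unfold spatialWeight; linarith)
        _ = 2 := by simp
    calc _ ≤ C₁ * 2 := h0.trans (by gcongr)
      _ = ENNReal.ofReal (C₁ * 2).toReal := (ENNReal.ofReal_toReal (by finiteness)).symm
      _ ≤ _ := ENNReal.ofReal_le_ofReal (le_max_left _ _)
  · beta_reduce
    rw [← ENNReal.ofReal_mul (by positivity), Real.enorm_eq_ofReal_abs]
    refine ENNReal.ofReal_le_ofReal ((h2 x (t + 1) (by linarith)).trans ?_)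
    rw [add_comm t 1]
    gcongr
    exact le_max_right _ _

/-! ### Decaying sources and their asymptotic remainder. -/

/-- A measurable source whose time slices obey a scaled bound that decays like
`(1+s)^{-b-1}`. -/
structure IsDecayingSource {N : ℕ} (K d b c : ℝ) (h : RN N → ℝ → ℝ) : Prop where
  measurable : AEStronglyMeasurable (fun z : RN N × ℝ => h z.1 z.2) (spaceTime N)
  bound : ∀ s : ℝ, 0 < s →
    ScaledBound K d (1 + s) (fun x => ‖h x s‖ₑ) (ENNReal.ofReal (c * (1 + s) ^ (-b - 1)))
  rate_pos : 0 < b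
  const_nonneg : 0 ≤ c

/-- `e^{tℒ}φ + ∫_0^t e^{(t-s)ℒ}h(s) ds - (∫φ + ∫_0^∞∫h) g(t)`. -/
noncomputable def asymptoticRemainder {N : ℕ} (G : RN N → ℝ → ℝ) (φ : RN N → ℝ)
    (h : RN N → ℝ → ℝ) (x : RN N) (t : ℝ) : ℝ :=
  kernelSemigroup G t φ x + duhamel G h x t -
    ((∫ y, φ y) + ∫ s in Ioi (0 : ℝ), ∫ y, h y s) * shiftedKernel G x t

namespace IsDecayingSource

variable {N : ℕ} {K d b c : ℝ} {h : RN N → ℝ → ℝ} (hh : IsDecayingSource K d b c h)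
include hh

/-- The kernel estimates are for Borel functions. A representative agrees with the source almost
everywhere in space-time, hence on almost every time slice, so it inherits the bounds at almost
every time. -/
lemma exists_measurable : ∃ v : RN N × ℝ → ℝ≥0∞, Measurable v ∧
    (∀ᵐ z ∂spaceTime N, ‖h z.1 z.2‖ₑ = v z) ∧
    ∀ᵐ s ∂(volume : Measure ℝ).restrict (Ioi 0),
      ScaledBound K d (1 + s) (fun y => v (y, s)) (ENNReal.ofReal (c * (1 + s) ^ (-b - 1))) := by
  have hm := hh.measurable
  refine ⟨fun z => ‖hm.mk _ z‖ₑ, hm.stronglyMeasurable_mk.measurable.enorm, ?_, ?_⟩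
  · filter_upwards [hm.ae_eq_mk] with z hz
    rw [hz]
  · have h1 : ∀ᵐ z ∂((volume : Measure ℝ).restrict (Ioi 0)).prod (volume : Measure (RN N)),
        h z.2 z.1 = hm.mk _ (z.2, z.1) :=
      Measure.measurePreserving_swap.quasiMeasurePreserving.ae hm.ae_eq_mk
    filter_upwards [Measure.ae_ae_of_ae_prod h1, ae_restrict_mem measurableSet_Ioi] with s hs hs0
    refine (hh.bound s hs0).mono ?_ le_rfl
    filter_upwards [hs] with y hy
    exact le_of_eq (by rw [← hy])

lemma lintegral_rate_lt_top :
    ∫⁻ s in Ioi (0 : ℝ), ENNReal.ofReal (c * (1 + s) ^ (-b - 1)) < ∞ := by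
  simp_rw [ENNReal.ofReal_mul hh.const_nonneg]
  rw [lintegral_const_mul' _ _ ENNReal.ofReal_ne_top]
  exact ENNReal.mul_lt_top ENNReal.ofReal_lt_top (lintegral_Ioi_zero_rpow_lt_top hh.rate_pos)

lemma integrable : Integrable (fun z : RN N × ℝ => h z.1 z.2) (spaceTime N) := by
  refine ⟨hh.measurable, ?_⟩
  obtain ⟨v, hv, hhv, hη⟩ := hh.exists_measurable
  unfold HasFiniteIntegral
  rw [lintegral_congr_ae hhv, spaceTime, lintegral_prod_symm' _ hv]
  refine lt_of_le_of_lt (lintegral_mono_ae ?_) hh.lintegral_rate_lt_top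
  filter_upwards [hη, ae_restrict_mem measurableSet_Ioi] with s hs hs0
  exact hs.lintegral_le (by linarith [mem_Ioi.1 hs0])

lemma integral_eq : ∫ s in Ioi (0 : ℝ), ∫ y, h y s = ∫ z, h z.1 z.2 ∂spaceTime N :=
  (integral_prod_symm _ hh.integrable).symm

variable {γ : ℕ} {L : ℝ} {G : RN N → ℝ → ℝ} (hG : IsGeneralizedHeatKernel N γ d L G)
include hG

/-- The space-time convolution of the kernel with the source, in the scaled norm. -/
lemma scaledBound_lintegral (hK0 : 0 ≤ K) (hK1 : K ≤ 1) (hKL : K < L) {t : ℝ} (ht : 0 < t) :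
    ∃ ε : ℝ≥0∞, ε ≠ ∞ ∧ (∀ x, ∫⁻ z, ‖positiveKernel G (x - z.1, t - z.2)‖ₑ * ‖h z.1 z.2‖ₑ
        ∂spaceTime N < ∞) ∧
      ScaledBound K d t (fun x => ∫⁻ z, ‖positiveKernel G (x - z.1, t - z.2)‖ₑ * ‖h z.1 z.2‖ₑ
        ∂spaceTime N) ε := by
  obtain ⟨v, hv, hhv, hη⟩ := hh.exists_measurable
  obtain ⟨C, hC, h1⟩ := hG.scaledBound_recent hK0 hK1 hKL
  obtain ⟨C₂, hC₂, h2⟩ := hG.lintegral_positiveKernel_le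
  have hm := hG.measurable_positiveKernel
  -- All sources count as recent here: with `a = 0` one may take `ρ = 1 + t`, which is enough at a
  -- fixed time.
  have b1 := h1 0 t (1 + t) v _ le_rfl ht (by linarith) (by linarith) hv hη
  have hres : (spaceTime N).restrict {z | 0 < z.2} = spaceTime N := spaceTime_restrict_snd le_rfl
  rw [hres] at b1
  have hlt : ∫⁻ s in Ioo 0 t, ENNReal.ofReal (c * (1 + s) ^ (-b - 1)) ≠ ∞ :=
    (lt_of_le_of_lt (lintegral_mono_set Ioo_subset_Ioi_self) hh.lintegral_rate_lt_top).ne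
  have hcongr : ∀ x, ∫⁻ z, ‖positiveKernel G (x - z.1, t - z.2)‖ₑ * ‖h z.1 z.2‖ₑ ∂spaceTime N =
      ∫⁻ z, ‖positiveKernel G (x - z.1, t - z.2)‖ₑ * v z ∂spaceTime N := by
    intro x
    refine lintegral_congr_ae ?_
    filter_upwards [hhv] with z hz
    rw [hz]
  simp_rw [hcongr]
  refine ⟨_, by finiteness, fun x => ?_, b1⟩
  have hmx : Measurable (fun z : RN N × ℝ => ‖positiveKernel G (x - z.1, t - z.2)‖ₑ * v z) :=
    ((hm.comp (by fun_prop : Measurable fun z : RN N × ℝ => (x - z.1, t - z.2))).enorm).mul hv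
  -- Finiteness is shown at every `x`, which the scaled bound does not give, because the Duhamel
  -- term is evaluated pointwise.
  rw [spaceTime, lintegral_prod_symm' _ hmx]
  have hfin : ∫⁻ s in Ioi (0 : ℝ), C₂ * ENNReal.ofReal (c * (1 + s) ^ (-b - 1)) < ∞ := by
    rw [lintegral_const_mul' _ _ hC₂]
    exact ENNReal.mul_lt_top hC₂.lt_top hh.lintegral_rate_lt_top
  refine lt_of_le_of_lt (lintegral_mono_ae ?_) hfin
  filter_upwards [hη, ae_restrict_mem measurableSet_Ioi] with s hs hs0
  have hs0 : 0 < s := hs0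
  have hd := hG.d_pos
  calc _ ≤ ∫⁻ y, ENNReal.ofReal (c * (1 + s) ^ (-b - 1)) *
        ‖positiveKernel G (x - y, t - s)‖ₑ := by
        refine lintegral_mono_ae ?_
        filter_upwards [hs.2] with y hy
        rw [mul_comm]
        gcongr
        refine hy.trans ?_
        have h3 : (1 + s) ^ (-((N : ℝ) / d)) ≤ 1 :=
          Real.rpow_le_one_of_one_le_of_nonpos (by linarith)
            (by have : 0 ≤ (N : ℝ) / d := by positivity
                linarith)
        calc _ ≤ ENNReal.ofReal (c * (1 + s) ^ (-b - 1)) * ENNReal.ofReal 1 := by gcongr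
          _ = _ := by simp
    _ = ENNReal.ofReal (c * (1 + s) ^ (-b - 1)) * ∫⁻ y, ‖positiveKernel G (x - y, t - s)‖ₑ :=
        lintegral_const_mul _
          (hm.comp (by fun_prop : Measurable fun y : RN N => (x - y, t - s))).enorm
    _ ≤ ENNReal.ofReal (c * (1 + s) ^ (-b - 1)) * C₂ := by gcongr; exact h2 _ _
    _ = _ := mul_comm _ _

lemma aestronglyMeasurable_kernel_mul (x : RN N) (t : ℝ) : AEStronglyMeasurable
    (fun z : RN N × ℝ => positiveKernel G (x - z.1, t - z.2) * h z.1 z.2) (spaceTime N) :=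
  (hG.measurable_positiveKernel.comp
    (by fun_prop : Measurable fun z : RN N × ℝ => (x - z.1, t - z.2))).aestronglyMeasurable.mul
    hh.measurable

lemma integrable_kernel_mul (hK0 : 0 ≤ K) (hK1 : K ≤ 1) (hKL : K < L) (x : RN N) {t : ℝ}
    (ht : 0 < t) : Integrable (fun z : RN N × ℝ =>
      positiveKernel G (x - z.1, t - z.2) * h z.1 z.2) (spaceTime N) := by
  obtain ⟨ε, -, h1, -⟩ := hh.scaledBound_lintegral hG hK0 hK1 hKL ht
  refine ⟨hh.aestronglyMeasurable_kernel_mul hG x t, ?_⟩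
  unfold HasFiniteIntegral
  simp_rw [enorm_mul]
  exact h1 x

/-- With the kernel extended by zero the iterated integral over `0 < s < t` is an integral over all
of space-time; Fubini applies since the convolution converges absolutely at each point. -/
lemma duhamel_eq (hK0 : 0 ≤ K) (hK1 : K ≤ 1) (hKL : K < L) (x : RN N) {t : ℝ} (ht : 0 < t) :
    duhamel G h x t = ∫ z, positiveKernel G (x - z.1, t - z.2) * h z.1 z.2 ∂spaceTime N := by
  have hi := hh.integrable_kernel_mul hG hK0 hK1 hKL x ht
  unfold spaceTime at hi ⊢
  rw [integral_prod_symm _ hi]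
  unfold duhamel kernelSemigroup
  rw [intervalIntegral.integral_of_le ht.le, integral_Ioc_eq_integral_Ioo]
  have e1 : ∫ s in Ioo 0 t, ∫ y, G (x - y) (t - s) * h y s =
      ∫ s in Ioo 0 t, ∫ y, positiveKernel G (x - y, t - s) * h y s := by
    refine setIntegral_congr_fun measurableSet_Ioo fun s hs => ?_
    simp only [positiveKernel_of_pos G _ (sub_pos.2 hs.2)]
  rw [e1]
  refine (setIntegral_eq_of_subset_of_forall_sdiff_eq_zero measurableSet_Ioi
    Ioo_subset_Ioi_self ?_).symm
  intro s hs
  have : t ≤ s := by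
    by_contra hlt
    exact hs.2 ⟨hs.1, not_le.1 hlt⟩
  simp [positiveKernel_of_nonpos G _ (sub_nonpos.2 this)]

lemma aestronglyMeasurable_duhamel (hK0 : 0 ≤ K) (hK1 : K ≤ 1) (hKL : K < L) {t : ℝ}
    (ht : 0 < t) : AEStronglyMeasurable (fun x => duhamel G h x t) volume := by
  simp_rw [hh.duhamel_eq hG hK0 hK1 hKL _ ht]
  refine AEStronglyMeasurable.integral_prod_right' (f := fun q : RN N × (RN N × ℝ) =>
    positiveKernel G (q.1 - q.2.1, t - q.2.2) * h q.2.1 q.2.2) ?_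
  refine AEStronglyMeasurable.mul ?_ hh.measurable.comp_snd
  exact (hG.measurable_positiveKernel.comp (by fun_prop : Measurable
    fun q : RN N × (RN N × ℝ) => (q.1 - q.2.1, t - q.2.2))).aestronglyMeasurable

lemma scaledBound_duhamel (hK0 : 0 ≤ K) (hK1 : K ≤ 1) (hKL : K < L) {t : ℝ} (ht : 0 < t) :
    ∃ ε : ℝ≥0∞, ε ≠ ∞ ∧ ScaledBound K d t (fun x => ‖duhamel G h x t‖ₑ) ε := by
  obtain ⟨ε, hε, -, h1⟩ := hh.scaledBound_lintegral hG hK0 hK1 hKL ht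
  refine ⟨ε, hε, h1.mono (Eventually.of_forall fun x => ?_) le_rfl⟩
  rw [hh.duhamel_eq hG hK0 hK1 hKL x ht]
  refine (enorm_integral_le_lintegral_enorm _).trans (le_of_eq ?_)
  simp_rw [enorm_mul]

variable {φ : RN N → ℝ}

/-- The remainder as an integral against the kernel defect. -/
lemma enorm_asymptoticRemainder_le (hK0 : 0 ≤ K) (hK1 : K ≤ 1) (hKL : K < L) (hφ : Integrable φ)
    (x : RN N) {t : ℝ} (ht : 0 < t) :
    ‖asymptoticRemainder G φ h x t‖ₑ ≤ (∫⁻ y, ‖kernelDefect G t x (y, 0)‖ₑ * ‖φ y‖ₑ) +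
      ∫⁻ z, ‖kernelDefect G t x z‖ₑ * ‖h z.1 z.2‖ₑ ∂spaceTime N := by
  have ht1 : 0 < t + 1 := by linarith
  obtain ⟨C, hC, hb⟩ := hG.abs_le_rpow
  have i1 : Integrable (fun y => G (x - y) t * φ y) :=
    hφ.bdd_mul ((hG.continuous_slice ht).comp
      (by fun_prop : Continuous fun y => x - y)).aestronglyMeasurable
      (Eventually.of_forall fun y => hb (x - y) t ht)
  have i2 := hh.integrable_kernel_mul hG hK0 hK1 hKL x ht
  have e1 : kernelSemigroup G t φ x - (∫ y, φ y) * G x (t + 1) =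
      ∫ y, kernelDefect G t x (y, 0) * φ y := by
    unfold kernelSemigroup
    rw [← integral_mul_const, ← integral_sub i1 (hφ.mul_const _)]
    congr 1
    ext y
    simp only [kernelDefect, sub_zero]
    rw [positiveKernel_of_pos G _ ht, positiveKernel_of_pos G _ ht1]
    ring
  -- Times `s ≥ t` are included: there only the second term of the defect is present, which accounts
  -- for the source mass not yet released.
  have e2 : duhamel G h x t - (∫ s in Ioi (0 : ℝ), ∫ y, h y s) * G x (t + 1) =
      ∫ z, kernelDefect G t x z * h z.1 z.2 ∂spaceTime N := by
    rw [hh.duhamel_eq hG hK0 hK1 hKL x ht, hh.integral_eq, ← integral_mul_const,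
      ← integral_sub i2 (hh.integrable.mul_const _)]
    congr 1
    ext z
    simp only [kernelDefect]
    rw [positiveKernel_of_pos G _ ht1]
    ring
  have e3 : asymptoticRemainder G φ h x t = (∫ y, kernelDefect G t x (y, 0) * φ y) +
      ∫ z, kernelDefect G t x z * h z.1 z.2 ∂spaceTime N := by
    rw [← e1, ← e2]
    unfold asymptoticRemainder shiftedKernel
    ring
  rw [e3]
  refine (enorm_add_le _ _).trans (add_le_add ?_ ?_)
  · refine (enorm_integral_le_lintegral_enorm _).trans (le_of_eq ?_)
    simp_rw [enorm_mul]
  · refine (enorm_integral_le_lintegral_enorm _).trans (le_of_eq ?_)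
    simp_rw [enorm_mul]

/-- Common input of the three regimes. The representatives do not depend on `t`, so the rate depends
only on `defectSize`; the data enter through `1 + ‖y‖^K`, the spatial weight at time one. -/
lemma exists_scaledBound_remainder (hK0 : 0 ≤ K) (hK1 : K ≤ 1) (hKL : K < L)
    (hφK : MemWeightedL1 K φ) :
    ∃ (C : ℝ≥0∞) (v₀ : RN N → ℝ≥0∞) (v : RN N × ℝ → ℝ≥0∞), C ≠ ∞ ∧ Measurable v₀ ∧ Measurable v ∧
      ∫⁻ y, ENNReal.ofReal (spatialWeight K d 1 y) * v₀ y ≠ ∞ ∧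
      (∀ᵐ s ∂(volume : Measure ℝ).restrict (Ioi 0),
        ScaledBound K d (1 + s) (fun y => v (y, s)) (ENNReal.ofReal (c * (1 + s) ^ (-b - 1)))) ∧
      ∀ t : ℝ, 1 ≤ t → ScaledBound K d t (fun x => ‖asymptoticRemainder G φ h x t‖ₑ)
        (C * defectSize K d v₀ v (fun s => ENNReal.ofReal (c * (1 + s) ^ (-b - 1))) t) := by
  obtain ⟨v, hv, hhv, hη⟩ := hh.exists_measurable
  obtain ⟨C, hC, h1⟩ := hG.scaledBound_defect hK0 hK1 hKL
  have hφm := hφK.1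
  have hφv : ∀ᵐ y, ‖φ y‖ₑ = ‖hφm.mk φ y‖ₑ := by
    filter_upwards [hφm.ae_eq_mk] with y hy
    rw [hy]
  have hw : ∀ y : RN N, ENNReal.ofReal (spatialWeight K d 1 y) * ‖φ y‖ₑ =
      ‖|φ y| * (1 + ‖y‖ ^ K)‖ₑ := by
    intro y
    rw [enorm_mul, Real.enorm_abs, Real.enorm_eq_ofReal (show 0 ≤ 1 + ‖y‖ ^ K by positivity),
      mul_comm]
    simp [spatialWeight]
  have hfin : ∫⁻ y, ENNReal.ofReal (spatialWeight K d 1 y) * ‖φ y‖ₑ ≠ ∞ := by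
    simp_rw [hw]
    exact hφK.2.2.ne
  have hφi : Integrable φ := by
    refine ⟨hφm, lt_of_le_of_lt (lintegral_mono fun y => ?_) hfin.lt_top⟩
    calc ‖φ y‖ₑ = ENNReal.ofReal 1 * ‖φ y‖ₑ := by simp
      _ ≤ _ := by gcongr; exact spatialWeight_one_le y one_pos
  refine ⟨C, fun y => ‖hφm.mk φ y‖ₑ, v, hC, hφm.stronglyMeasurable_mk.measurable.enorm, hv, ?_, hη,
    fun t ht => ?_⟩
  · refine ne_of_eq_of_ne (lintegral_congr_ae ?_) hfin
    filter_upwards [hφv] with y hy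
    rw [hy]
  · refine (h1 t (fun y => ‖hφm.mk φ y‖ₑ) v _ ht hφm.stronglyMeasurable_mk.measurable.enorm hv
      hη).mono (Eventually.of_forall fun x => ?_) le_rfl
    refine (hh.enorm_asymptoticRemainder_le hG hK0 hK1 hKL hφi x (by linarith)).trans
      (le_of_eq ?_)
    congr 1
    · refine lintegral_congr_ae ?_
      filter_upwards [hφv] with y hy
      rw [hy]
    · refine lintegral_congr_ae ?_
      filter_upwards [hhv] with z hz
      rw [hz]

/-- Fast decaying sources: the remainder is `o(t^{-K/d})`. -/
lemma remainder_of_gt (hK0 : 0 ≤ K) (hK1 : K < 1) (hKL : K < L) (hKd : K < d)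
    (hφK : MemWeightedL1 K φ) (hb : K / d < b) :
    ∃ E : ℝ → ℝ≥0∞, (∀ t : ℝ, 1 ≤ t →
      ScaledBound K d t (fun x => ‖asymptoticRemainder G φ h x t‖ₑ) (E t)) ∧
      Tendsto (fun t => ENNReal.ofReal (t ^ (K / d)) * E t) atTop (𝓝 0) := by
  obtain ⟨C, v₀, v, hC, hv₀, hv, hfin, hη, hbd⟩ :=
    hh.exists_scaledBound_remainder hG hK0 hK1.le hKL hφK
  refine ⟨_, hbd, ?_⟩
  have := ENNReal.Tendsto.const_mul (tendsto_defectSize hK0 hK1 hKd hv₀ hv hfin hh.const_nonneg hb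
    hη) (Or.inr hC)
  rw [mul_zero] at this
  refine this.congr fun t => ?_
  ring

/-- Slowly decaying sources: the remainder inherits their rate. -/
lemma remainder_of_lt (hK0 : 0 ≤ K) (hK1 : K < 1) (hKL : K < L) (hKd : K < d)
    (hφK : MemWeightedL1 K φ) (hb : b < K / d) :
    ∃ B : ℝ, 0 ≤ B ∧ ∀ t : ℝ, 1 ≤ t →
      ScaledBound K d t (fun x => ‖asymptoticRemainder G φ h x t‖ₑ)
        (ENNReal.ofReal (B * t ^ (-b))) := by
  obtain ⟨C, v₀, v, hC, hv₀, hv, hfin, hη, hbd⟩ :=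
    hh.exists_scaledBound_remainder hG hK0 hK1.le hKL hφK
  obtain ⟨B, hB, h1⟩ := defectSize_le_of_lt hK0 hKd hv hfin hh.const_nonneg hh.rate_pos hb hη
  refine ⟨C.toReal * B, by positivity, fun t ht => (hbd t ht).mono (ae_of_all _ fun _ => le_rfl) ?_⟩
  calc _ ≤ C * ENNReal.ofReal (B * t ^ (-b)) := by gcongr; exact h1 t ht
    _ = _ := by rw [mul_assoc, ENNReal.ofReal_mul ENNReal.toReal_nonneg, ENNReal.ofReal_toReal hC]

/-- The critical decay of the source: a logarithm appears. -/
lemma remainder_of_eq (hK0 : 0 ≤ K) (hK1 : K < 1) (hKL : K < L) (hKd : K < d)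
    (hφK : MemWeightedL1 K φ) (hb : b = K / d) :
    ∃ B : ℝ, 0 ≤ B ∧ ∀ t : ℝ, 1 ≤ t →
      ScaledBound K d t (fun x => ‖asymptoticRemainder G φ h x t‖ₑ)
        (ENNReal.ofReal (B * (t ^ (-b) * (1 + Real.log t)))) := by
  obtain ⟨C, v₀, v, hC, hv₀, hv, hfin, hη, hbd⟩ :=
    hh.exists_scaledBound_remainder hG hK0 hK1.le hKL hφK
  obtain ⟨B, hB, h1⟩ := defectSize_le_of_eq hK0 hKd hv hfin hh.const_nonneg hh.rate_pos hb hη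
  refine ⟨C.toReal * B, by positivity, fun t ht => (hbd t ht).mono (ae_of_all _ fun _ => le_rfl) ?_⟩
  calc _ ≤ C * ENNReal.ofReal (B * (t ^ (-b) * (1 + Real.log t))) := by gcongr; exact h1 t ht
    _ = _ := by rw [mul_assoc, ENNReal.ofReal_mul ENNReal.toReal_nonneg, ENNReal.ofReal_toReal hC]

end IsDecayingSource

/-! ### Sources produced by the nonlinearity. -/

lemma IsDecayingSource.mono_rate {N : ℕ} {K d b b' c : ℝ} {h : RN N → ℝ → ℝ}
    (hh : IsDecayingSource K d b c h) (hb' : 0 < b') (hbb : b' ≤ b) :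
    IsDecayingSource K d b' c h where
  measurable := hh.measurable
  bound s hs := by
    refine (hh.bound s hs).mono (ae_of_all _ fun _ => le_rfl) (ENNReal.ofReal_le_ofReal ?_)
    exact mul_le_mul_of_nonneg_left
      (Real.rpow_le_rpow_of_exponent_le (by linarith) (by linarith)) hh.const_nonneg
  rate_pos := hb'
  const_nonneg := hh.const_nonneg

lemma ScaledBound.zero {N : ℕ} {K d t : ℝ} (ε : ℝ≥0∞) :
    ScaledBound K d t (fun _ : RN N => 0) ε :=
  ⟨by simp, by simp⟩

/-- Differences of the nonlinearity along functions with the decay of the kernel. -/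
lemma IsPowerNonlinearity.isDecayingSource {N : ℕ} {Cstar A p : ℝ} {F : RN N → ℝ → ℝ → ℝ}
    (hF : IsPowerNonlinearity N Cstar A p F) (hC : 0 ≤ Cstar) (hp : 1 ≤ p) {K d b r D : ℝ}
    (hr : 0 < decayRate N d A p + r) (hb : 0 ≤ b) (hD : 0 ≤ D) {w₁ w₂ h : RN N → ℝ → ℝ}
    (hm₁ : AEStronglyMeasurable (fun z : RN N × ℝ => w₁ z.1 z.2) (spaceTime N))
    (hm₂ : AEStronglyMeasurable (fun z : RN N × ℝ => w₂ z.1 z.2) (spaceTime N))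
    (h₁ : ∀ s : ℝ, 0 < s → ScaledBound K d (1 + s) (fun x => ‖w₁ x s‖ₑ) (ENNReal.ofReal b))
    (h₂ : ∀ s : ℝ, 0 < s → ScaledBound K d (1 + s) (fun x => ‖w₂ x s‖ₑ) (ENNReal.ofReal b))
    (h₁₂ : ∀ s : ℝ, 0 < s → ScaledBound K d (1 + s) (fun x => ‖w₁ x s - w₂ x s‖ₑ)
      (ENNReal.ofReal (D * (1 + s) ^ (-r))))
    (hh : ∀ (x : RN N) (s : ℝ), 0 < s → h x s = F x s (w₁ x s) - F x s (w₂ x s)) :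
    IsDecayingSource K d (decayRate N d A p + r) (Cstar * b ^ (p - 1) * D) h where
  measurable := by
    refine ((hF.aestronglyMeasurable_comp hp hm₁).sub
      (hF.aestronglyMeasurable_comp hp hm₂)).congr ?_
    filter_upwards [ae_spaceTime_pos N] with z hz
    exact (hh z.1 z.2 hz).symm
  bound s hs := by
    have h1s : 0 < 1 + s := by linarith
    set κ := Cstar * b ^ (p - 1) * (1 + s) ^ (-decayRate N d A p - 1) with hκ
    have hκ0 : 0 ≤ κ := by positivity
    have conv : ∀ v : ℝ, ‖v‖ₑ ≤ ENNReal.ofReal b * ENNReal.ofReal ((1 + s) ^ (-((N : ℝ) / d))) →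
        |v| ≤ b * (1 + s) ^ (-((N : ℝ) / d)) := by
      intro v hv
      rw [← ENNReal.ofReal_mul hb, Real.enorm_eq_ofReal_abs] at hv
      exact (ENNReal.ofReal_le_ofReal_iff (by positivity)).1 hv
    refine ((h₁₂ s hs).const_mul (c := ENNReal.ofReal κ) ENNReal.ofReal_ne_top).mono ?_
      (le_of_eq ?_)
    · filter_upwards [(h₁ s hs).2, (h₂ s hs).2] with x hx1 hx2
      rw [hh x s hs, Real.enorm_eq_ofReal_abs, Real.enorm_eq_ofReal_abs, ← ENNReal.ofReal_mul hκ0]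
      exact ENNReal.ofReal_le_ofReal
        (hF.abs_sub_le_decay hC hp hb hs (conv _ hx1) (conv _ hx2))
    · rw [← ENNReal.ofReal_mul hκ0]
      congr 1
      have : (1 + s) ^ (-(decayRate N d A p + r) - 1) =
          (1 + s) ^ (-decayRate N d A p - 1) * (1 + s) ^ (-r) := by
        rw [← Real.rpow_add h1s]; congr 1; ring
      rw [this, hκ]; ring
  rate_pos := hr
  const_nonneg := by positivity

/-- A decay rate at large times, together with boundedness, is a decay rate at all times. -/
lemma scaledBound_of_eventual_rate {N : ℕ} {K d r B B₀ : ℝ} {w : RN N → ℝ → ℝ} (hK0 : 0 ≤ K)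
    (hd : 0 < d) (hr : 0 ≤ r) (hB : 0 ≤ B) (hB₀ : 0 ≤ B₀)
    (h₀ : ∀ s : ℝ, 0 < s → ScaledBound K d (1 + s) (fun x => ‖w x s‖ₑ) (ENNReal.ofReal B₀))
    (h : ∀ t : ℝ, 1 ≤ t → ScaledBound K d t (fun x => ‖w x t‖ₑ) (ENNReal.ofReal (B * t ^ (-r)))) :
    ∃ D : ℝ, 0 ≤ D ∧ ∀ s : ℝ, 0 < s →
      ScaledBound K d (1 + s) (fun x => ‖w x s‖ₑ) (ENNReal.ofReal (D * (1 + s) ^ (-r))) := by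
  set c : ℝ := 2 ^ (K / d) * 2 ^ ((N : ℝ) / d) with hc
  have hc0 : 0 < c := by positivity
  have h2r : (0 : ℝ) < 2 ^ r := by positivity
  have cmp : ∀ s t : ℝ, 0 < s → 0 < t → t ≤ 2 * s → s ^ (-r) ≤ 2 ^ r * t ^ (-r) := by
    intro s t hs ht hts
    have : (2 * s) ^ (-r) ≤ t ^ (-r) := Real.rpow_le_rpow_of_nonpos ht hts (by linarith)
    rwa [Real.mul_rpow (by norm_num) hs.le, Real.rpow_neg (by norm_num),
      inv_mul_le_iff₀ h2r] at this
  -- For `s ≥ 1` the rate at time `s` is moved to `1 + s ≤ 2s`, at cost `c 2^r`. For `s < 1` the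
  -- uniform bound `B₀` is used with `1 ≤ 2^r (1+s)^{-r}`.
  refine ⟨(c * B + B₀) * 2 ^ r, by positivity, fun s hs => ?_⟩
  have h1s : 0 < (1 + s) ^ (-r) := by positivity
  rcases le_or_gt 1 s with h1 | h1
  · refine ((h s h1).comparable (t := 1 + s) (c := 2) hK0 hd hs (by linarith) (by norm_num)
      (by linarith) (by linarith)).mono (ae_of_all _ fun _ => le_rfl) ?_
    rw [← ENNReal.ofReal_mul hc0.le]
    refine ENNReal.ofReal_le_ofReal ?_
    have h3 := cmp s (1 + s) hs (by linarith) (by linarith)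
    calc c * (B * s ^ (-r)) ≤ c * (B * (2 ^ r * (1 + s) ^ (-r))) := by gcongr
      _ = (c * B + 0) * 2 ^ r * (1 + s) ^ (-r) := by ring
      _ ≤ _ := by gcongr
  · refine (h₀ s hs).mono (ae_of_all _ fun _ => le_rfl) (ENNReal.ofReal_le_ofReal ?_)
    have h3 := cmp 1 (1 + s) one_pos (by linarith) (by linarith)
    rw [Real.one_rpow] at h3
    calc B₀ = (0 + B₀) * 1 := by ring
      _ ≤ (c * B + B₀) * (2 ^ r * (1 + s) ^ (-r)) := by gcongr; positivity
      _ = _ := by ring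

/-! ### From scaled bounds to Landau symbols. -/

section Asymptotics

variable {N : ℕ} {K d l : ℝ} {q : ℝ≥0∞} {w : RN N → ℝ → ℝ}

lemma lqNorm_nonneg (q : ℝ≥0∞) (f : RN N → ℝ) : 0 ≤ lqNorm q f := ENNReal.toReal_nonneg

lemma weightedL1Norm_nonneg (k : ℝ) (f : RN N → ℝ) : 0 ≤ weightedL1Norm k f :=
  integral_nonneg fun x => by positivity

lemma scaledNorm_nonneg {t : ℝ} (ht : 0 < t) : 0 ≤ scaledNorm d q l w t := by
  have h1 := lqNorm_nonneg q (fun x => w x t)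
  have h2 := weightedL1Norm_nonneg l (fun x => w x t)
  unfold scaledNorm
  positivity

variable (hd : 0 < d) (hq : 1 ≤ q) (hl0 : 0 ≤ l) (hlK : l ≤ K)
  (hw : ∀ t : ℝ, 0 < t → AEStronglyMeasurable (fun x => w x t) volume)
include hd hq hl0 hlK hw

lemma scaledNorm_isLittleO {E : ℝ → ℝ≥0∞}
    (h : ∀ t : ℝ, 1 ≤ t → ScaledBound K d t (fun x => ‖w x t‖ₑ) (E t))
    (hE : Tendsto (fun t => ENNReal.ofReal (t ^ (K / d)) * E t) atTop (𝓝 0)) :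
    scaledNorm d q l w =o[atTop] (fun t : ℝ => t ^ (-(K / d))) := by
  have h1 : Tendsto (fun t => 3 * (ENNReal.ofReal (t ^ (K / d)) * E t).toReal) atTop (𝓝 0) := by
    have := ((ENNReal.tendsto_toReal ENNReal.zero_ne_top).comp hE).const_mul 3
    simpa using this
  have h2 : ∀ᶠ t in atTop, ENNReal.ofReal (t ^ (K / d)) * E t < ∞ :=
    hE.eventually (gt_mem_nhds (by simp))
  rw [isLittleO_iff_tendsto' (by
    filter_upwards [eventually_gt_atTop 0] with t ht h0
    exact absurd h0 (by positivity))]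
  refine squeeze_zero' ?_ ?_ h1
  · filter_upwards [eventually_gt_atTop 0] with t ht
    have := scaledNorm_nonneg (d := d) (q := q) (l := l) (w := w) ht
    positivity
  · filter_upwards [eventually_ge_atTop 1, h2] with t ht hfin
    have ht0 : 0 < t := by linarith
    have hp : 0 < t ^ (K / d) := by positivity
    have hEt : E t ≠ ∞ := by
      intro h0
      rw [h0, ENNReal.mul_top (by simpa using hp)] at hfin
      simp at hfin
    have h3 := (h t ht).scaledNorm_le hEt hd ht (hw t ht0) hq hl0 hlK
    rw [ENNReal.toReal_mul, ENNReal.toReal_ofReal hp.le, Real.rpow_neg ht0.le, div_inv_eq_mul]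
    calc _ ≤ 3 * (E t).toReal * t ^ (K / d) := by gcongr
      _ = _ := by ring

lemma scaledNorm_isBigO {B : ℝ} {ρ : ℝ → ℝ} (hB : 0 ≤ B) (hρ : ∀ t : ℝ, 1 ≤ t → 0 ≤ ρ t)
    (h : ∀ t : ℝ, 1 ≤ t → ScaledBound K d t (fun x => ‖w x t‖ₑ) (ENNReal.ofReal (B * ρ t))) :
    scaledNorm d q l w =O[atTop] ρ := by
  refine IsBigO.of_bound (3 * B) ?_
  filter_upwards [eventually_ge_atTop 1] with t ht
  have ht0 : 0 < t := by linarith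
  have h3 := (h t ht).scaledNorm_le ENNReal.ofReal_ne_top hd ht (hw t ht0) hq hl0 hlK
  rw [ENNReal.toReal_ofReal (mul_nonneg hB (hρ t ht))] at h3
  rw [Real.norm_of_nonneg (scaledNorm_nonneg ht0), Real.norm_of_nonneg (hρ t ht)]
  linarith

end Asymptotics

lemma one_isBigO_log : (fun _ : ℝ => (1 : ℝ)) =O[atTop] Real.log :=
  (isLittleO_const_left.2 (Or.inr
    (tendsto_norm_atTop_atTop.comp Real.tendsto_log_atTop))).isBigO

/-! ### Application to the solution. -/

namespace IsGeneralizedHeatKernel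

variable {N γ : ℕ} {d L K Cstar A p : ℝ} {G : RN N → ℝ → ℝ} {F : RN N → ℝ → ℝ → ℝ}
  {φ : RN N → ℝ} {u : RN N → ℝ → ℝ}

lemma measurable_shiftedKernel (hG : IsGeneralizedHeatKernel N γ d L G) (M : ℝ) :
    AEStronglyMeasurable (fun z : RN N × ℝ => M * shiftedKernel G z.1 z.2) (spaceTime N) := by
  refine ((hG.measurable_positiveKernel.comp (by fun_prop : Measurable
    fun z : RN N × ℝ => (z.1, z.2 + 1))).aestronglyMeasurable.const_mul M).congr ?_
  filter_upwards [ae_spaceTime_pos N] with z hz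
  simp only [Function.comp, shiftedKernel]
  rw [positiveKernel_of_pos G _ (by linarith)]

lemma scaledBound_const_mul_shiftedKernel (hG : IsGeneralizedHeatKernel N γ d L G) (hK0 : 0 ≤ K)
    (hK1 : K ≤ 1) (hKL : K < L) (M : ℝ) : ∃ C : ℝ, 0 ≤ C ∧ ∀ t : ℝ, 0 < t →
      ScaledBound K d (1 + t) (fun x => ‖M * shiftedKernel G x t‖ₑ) (ENNReal.ofReal C) := by
  obtain ⟨C, hC, h⟩ := hG.scaledBound_shiftedKernel hK0 hK1 hKL
  refine ⟨|M| * C, by positivity, fun t ht => ?_⟩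
  refine ((h t ht).const_mul (c := ‖M‖ₑ) (by finiteness)).mono
    (ae_of_all _ fun x => le_of_eq (enorm_mul _ _)) (le_of_eq ?_)
  rw [Real.enorm_eq_ofReal_abs, ENNReal.ofReal_mul (abs_nonneg _)]

/-- As `F` vanishes at `v = 0`, this is the Lipschitz estimate between `u` and `0`, with no gain (`r
= 0`). -/
lemma isDecayingSource_solution (hF : IsPowerNonlinearity N Cstar A p F) (hC : 0 ≤ Cstar)
    (hp : 1 ≤ p) (hAp : 0 < decayRate N d A p) (hu : IsGlobalSolution G F φ u)
    (hub : HasHeatBounds d K u) (hK0 : 0 ≤ K) :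
    ∃ c : ℝ, IsDecayingSource K d (decayRate N d A p) c (fun x t => F x t (u x t)) := by
  obtain ⟨b, hb, hbu⟩ := hub.scaledBound hK0
  have := hF.isDecayingSource (K := K) (d := d) (r := 0) (D := b) (h := fun x t => F x t (u x t))
    (w₂ := fun _ _ => 0) hC hp (by simpa using hAp) hb hb hu.measurable
    aestronglyMeasurable_const hbu (by simpa using fun s _ => ScaledBound.zero _)
    (by simpa using hbu) (fun x s hs => by simp [hF.zero x s hs])
  rw [add_zero] at this
  exact ⟨_, this⟩

lemma isDecayingSource_frozenSource (hG : IsGeneralizedHeatKernel N γ d L G) (hK0 : 0 ≤ K)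
    (hK1 : K ≤ 1) (hKL : K < L) (hF : IsPowerNonlinearity N Cstar A p F) (hC : 0 ≤ Cstar)
    (hp : 1 ≤ p) (hAp : 0 < decayRate N d A p) :
    ∃ c : ℝ, IsDecayingSource K d (decayRate N d A p) c (frozenSource G F φ u) := by
  obtain ⟨b, hb, hbg⟩ := hG.scaledBound_const_mul_shiftedKernel hK0 hK1 hKL (limitMass F φ u)
  have := hF.isDecayingSource (K := K) (d := d) (r := 0) (D := b) (h := frozenSource G F φ u)
    (w₁ := fun x s => limitMass F φ u * shiftedKernel G x s)
    (w₂ := fun _ _ => 0) hC hp (by simpa using hAp) hb hb (hG.measurable_shiftedKernel _)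
    aestronglyMeasurable_const hbg (by simpa using fun s _ => ScaledBound.zero _)
    (by simpa using hbg) (fun x s hs => by simp [hF.zero x s hs, frozenSource])
  rw [add_zero] at this
  exact ⟨_, this⟩

/-- Common scaled bounds for `u`, `M g` and their difference. -/
lemma exists_scaledBound_sub (hG : IsGeneralizedHeatKernel N γ d L G) (hK0 : 0 ≤ K)
    (hK1 : K ≤ 1) (hKL : K < L) (hub : HasHeatBounds d K u) (M : ℝ) : ∃ b : ℝ, 0 ≤ b ∧
      ∀ s : ℝ, 0 < s → ScaledBound K d (1 + s) (fun x => ‖u x s‖ₑ) (ENNReal.ofReal b) ∧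
        ScaledBound K d (1 + s) (fun x => ‖M * shiftedKernel G x s‖ₑ) (ENNReal.ofReal b) ∧
        ScaledBound K d (1 + s) (fun x => ‖u x s - M * shiftedKernel G x s‖ₑ)
          (ENNReal.ofReal b) := by
  obtain ⟨b₁, hb₁, hbu⟩ := hub.scaledBound hK0
  obtain ⟨b₂, hb₂, hbg⟩ := hG.scaledBound_const_mul_shiftedKernel hK0 hK1 hKL M
  refine ⟨b₁ + b₂, by positivity, fun s hs => ⟨?_, ?_, ?_⟩⟩
  · exact (hbu s hs).mono (ae_of_all _ fun _ => le_rfl) (ENNReal.ofReal_le_ofReal (by linarith))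
  · exact (hbg s hs).mono (ae_of_all _ fun _ => le_rfl) (ENNReal.ofReal_le_ofReal (by linarith))
  · rw [ENNReal.ofReal_add hb₁ hb₂]
    exact ((hbu s hs).add (hbg s hs) ((hub ∞ K le_top hK0 le_rfl).1.choose_spec s hs).1.1.enorm).mono
      (ae_of_all _ fun x => enorm_sub_le) le_rfl

lemma isDecayingSource_sub (hG : IsGeneralizedHeatKernel N γ d L G) (hK0 : 0 ≤ K)
    (hK1 : K ≤ 1) (hKL : K < L) (hF : IsPowerNonlinearity N Cstar A p F) (hC : 0 ≤ Cstar)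
    (hp : 1 ≤ p) (hAp : 0 < decayRate N d A p) (hu : IsGlobalSolution G F φ u)
    (hub : HasHeatBounds d K u) :
    ∃ c : ℝ, IsDecayingSource K d (decayRate N d A p) c
      (fun x t => F x t (u x t) - frozenSource G F φ u x t) := by
  obtain ⟨b, hb, h⟩ := hG.exists_scaledBound_sub hK0 hK1 hKL hub (limitMass F φ u)
  have := hF.isDecayingSource (K := K) (d := d) (r := 0) (D := b) hC hp (by simpa using hAp) hb hb
    hu.measurable (hG.measurable_shiftedKernel (limitMass F φ u)) (fun s hs => (h s hs).1)
    (fun s hs => (h s hs).2.1) (by simpa using fun s hs => (h s hs).2.2)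
    (h := fun x t => F x t (u x t) - frozenSource G F φ u x t) (fun x s _ => rfl)
  rw [add_zero] at this
  exact ⟨_, this⟩

/-- The difference of the sources inherits the decay of `u - M g`. -/
lemma isDecayingSource_sub_of_rate (hG : IsGeneralizedHeatKernel N γ d L G) (hK0 : 0 ≤ K)
    (hK1 : K ≤ 1) (hKL : K < L) (hF : IsPowerNonlinearity N Cstar A p F) (hC : 0 ≤ Cstar)
    (hp : 1 ≤ p) (hAp : 0 < decayRate N d A p) (hu : IsGlobalSolution G F φ u)
    (hub : HasHeatBounds d K u) {B r : ℝ} (hr : 0 ≤ r) (hB : 0 ≤ B)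
    (h : ∀ t : ℝ, 1 ≤ t → ScaledBound K d t
      (fun x => ‖u x t - limitMass F φ u * shiftedKernel G x t‖ₑ) (ENNReal.ofReal (B * t ^ (-r)))) :
    ∃ c : ℝ, IsDecayingSource K d (decayRate N d A p + r) c
      (fun x t => F x t (u x t) - frozenSource G F φ u x t) := by
  obtain ⟨b, hb, hs⟩ := hG.exists_scaledBound_sub hK0 hK1 hKL hub (limitMass F φ u)
  obtain ⟨D, hD, hDb⟩ := scaledBound_of_eventual_rate hK0 hG.d_pos hr hB hb
    (fun s hs0 => (hs s hs0).2.2) h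
  exact ⟨_, hF.isDecayingSource hC hp (by linarith) hb hD hu.measurable
    (hG.measurable_shiftedKernel _) (fun s hs0 => (hs s hs0).1) (fun s hs0 => (hs s hs0).2.1) hDb
    (fun x s _ => rfl)⟩

/-- `M` is by definition the total mass of `φ` and of the source `F(u)`, so the integral equation is
the claim. -/
lemma ae_sub_limit_eq (hu : IsGlobalSolution G F φ u) {t : ℝ} (ht : 0 < t) :
    ∀ᵐ x, u x t - limitMass F φ u * shiftedKernel G x t =
      asymptoticRemainder G φ (fun x t => F x t (u x t)) x t := by
  filter_upwards [hu.equation t ht] with x hx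
  rw [hx]
  rfl

/-- The Duhamel term of `f_M` in `ũ` is absorbed by linearity, and `M'` is the total mass of `φ` and
`F(u) - f_M`. Linearity is legitimate because both convolutions converge absolutely at each point.
-/
lemma ae_sub_profile_eq (hG : IsGeneralizedHeatKernel N γ d L G) (hK0 : 0 ≤ K)
    (hK1 : K ≤ 1) (hKL : K < L) (hF : IsPowerNonlinearity N Cstar A p F) (hC : 0 ≤ Cstar)
    (hp : 1 ≤ p) (hAp : 0 < decayRate N d A p) (hu : IsGlobalSolution G F φ u)
    (hub : HasHeatBounds d K u) {b c : ℝ}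
    (hh : IsDecayingSource K d b c (fun x t => F x t (u x t) - frozenSource G F φ u x t)) {t : ℝ}
    (ht : 0 < t) :
    ∀ᵐ x, u x t - correctedProfile G F φ u x t =
      asymptoticRemainder G φ (fun x t => F x t (u x t) - frozenSource G F φ u x t) x t := by
  obtain ⟨c₁, h₁⟩ := isDecayingSource_solution hF hC hp hAp hu hub hK0
  obtain ⟨c₂, h₂⟩ := hG.isDecayingSource_frozenSource (φ := φ) (u := u) hK0 hK1 hKL hF hC hp hAp
  filter_upwards [hu.equation t ht] with x hx
  have e : duhamel G (fun x t => F x t (u x t) - frozenSource G F φ u x t) x t =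
      duhamel G (fun x t => F x t (u x t)) x t - duhamel G (frozenSource G F φ u) x t := by
    rw [hh.duhamel_eq hG hK0 hK1 hKL x ht, h₁.duhamel_eq hG hK0 hK1 hKL x ht,
      h₂.duhamel_eq hG hK0 hK1 hKL x ht, ← integral_sub (h₁.integrable_kernel_mul hG hK0 hK1 hKL x ht)
        (h₂.integrable_kernel_mul hG hK0 hK1 hKL x ht)]
    simp_rw [mul_sub]
  unfold asymptoticRemainder
  rw [hx, e]
  unfold correctedProfile correctedMass
  ring

/-- The mass of `u(t)` tends to `M`. -/
lemma tendsto_integral (hG : IsGeneralizedHeatKernel N γ d L G)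
    (hne : ∃ (x : RN N) (t : ℝ), 0 < t ∧ G x t ≠ 0) (hK0 : 0 ≤ K)
    (hφK : MemWeightedL1 K φ) (hF : IsPowerNonlinearity N Cstar A p F) (hC : 0 ≤ Cstar)
    (hp : 1 ≤ p) (hAp : 0 < decayRate N d A p) (hu : IsGlobalSolution G F φ u)
    (hub : HasHeatBounds d K u) :
    Tendsto (fun t : ℝ => ∫ x, u x t) atTop (𝓝 (limitMass F φ u)) := by
  -- With the weight exponent replaced by `0` every positive rate is fast, so `u - Mg` tends to zero
  -- in `L^1`; unit mass of the kernel then identifies the limit.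
  have hub0 : HasHeatBounds d 0 u := fun q l hq hl0 hl => hub q l hq hl0 (hl.trans hK0)
  obtain ⟨c, hc⟩ := isDecayingSource_solution hF hC hp hAp hu hub0 le_rfl
  have hφ0 : MemWeightedL1 0 φ := by
    refine ⟨hφK.1, (hφK.2.const_mul 2).mono' ?_ (ae_of_all _ fun x => ?_)⟩
    · simp only [Real.rpow_zero]
      exact hφK.1.norm.mul_const _
    · rw [Real.norm_of_nonneg (by positivity), Real.rpow_zero]
      have h1 : 0 ≤ ‖x‖ ^ K := by positivity
      nlinarith [abs_nonneg (φ x)]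
  obtain ⟨E, hE, hlim⟩ := hc.remainder_of_gt hG le_rfl one_pos hG.L_pos hG.d_pos hφ0
    (by simpa using hAp)
  simp only [zero_div, Real.rpow_zero, ENNReal.ofReal_one, one_mul] at hlim
  rw [tendsto_iff_norm_sub_tendsto_zero]
  have hlim' : Tendsto (fun t => (E t).toReal) atTop (𝓝 0) :=
    (ENNReal.tendsto_toReal ENNReal.zero_ne_top).comp hlim
  refine squeeze_zero' (Eventually.of_forall fun t => norm_nonneg _) ?_ hlim'
  filter_upwards [eventually_ge_atTop 1, hlim.eventually (gt_mem_nhds ENNReal.zero_lt_top)]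
    with t ht hfin
  have ht0 : 0 < t := by linarith
  have ht1 : 0 < t + 1 := by linarith
  have iu : Integrable (fun x => u x t) := by
    obtain ⟨C, hCu⟩ := (hub 1 0 le_rfl le_rfl hK0).1
    exact memLp_one_iff_integrable.1 (hCu t ht0).1
  have ig : Integrable (fun x => limitMass F φ u * shiftedKernel G x t) :=
    (hG.integrable_slice ht1).const_mul _
  have e : (∫ x, u x t) - limitMass F φ u =
      ∫ x, (u x t - limitMass F φ u * shiftedKernel G x t) := by
    rw [integral_sub iu ig, integral_const_mul]
    unfold shiftedKernel
    rw [hG.mass_eq ht1, hG.mass_eq_one hne, mul_one]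
  rw [e]
  refine (norm_integral_le_lintegral_norm _).trans (ENNReal.toReal_mono hfin.ne ?_)
  refine le_trans (le_of_eq (lintegral_congr_ae ?_)) ((hE t ht).lintegral_le ht0)
  filter_upwards [ae_sub_limit_eq hu ht0] with x hx
  rw [hx, ofReal_norm]

/-- The remainder of the trivial kernel vanishes. -/
lemma asymptoticRemainder_eq_zero (hG : IsGeneralizedHeatKernel N γ d L G) (hK0 : 0 ≤ K)
    (hK1 : K ≤ 1) (hKL : K < L) {b c : ℝ} {h : RN N → ℝ → ℝ} (hh : IsDecayingSource K d b c h)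
    (h0 : ∀ (x : RN N) (t : ℝ), 0 < t → G x t = 0) (x : RN N) {t : ℝ} (ht : 0 < t) :
    asymptoticRemainder G φ h x t = 0 := by
  have hpos : ∀ z, positiveKernel G z = 0 := fun z =>
    indicator_apply_eq_zero.2 fun hz => h0 _ _ hz.2
  unfold asymptoticRemainder
  rw [hh.duhamel_eq hG hK0 hK1 hKL x ht]
  simp [kernelSemigroup, shiftedKernel, h0 _ _ ht, h0 _ _ (show 0 < t + 1 by linarith), hpos]

end IsGeneralizedHeatKernel

/-! ### The main theorem. -/

theorem corollary5p2
    (N : ℕ) (hN : 1 ≤ N)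
    (γ : ℕ) (d L : ℝ) (G : RN N → ℝ → ℝ) (hG : IsGeneralizedHeatKernel N γ d L G)
    (K : ℝ) (hK0 : 0 ≤ K) (hKL : K < L) (hKγ : ⌊K⌋₊ + 1 ≤ γ) (hK1 : K < 1)
    (φ : RN N → ℝ) (hφ : MemLp φ ∞ volume) (hφK : MemWeightedL1 K φ)
    (Cstar A p : ℝ) (hC : 0 < Cstar) (hp : 1 ≤ p)
    (F : RN N → ℝ → ℝ → ℝ) (hF : IsPowerNonlinearity N Cstar A p F)
    (hAp : 0 < decayRate N d A p)
    (u : RN N → ℝ → ℝ) (hu : IsGlobalSolution G F φ u) (hub : HasHeatBounds d K u) :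
    -- all the integrals that enter the definition of `M`, `M'` and `ũ` converge absolutely
    Integrable (fun z : RN N × ℝ => F z.1 z.2 (u z.1 z.2)) (spaceTime N) ∧
    Integrable (fun z : RN N × ℝ => frozenSource G F φ u z.1 z.2) (spaceTime N) ∧
    (∀ (x : RN N) (t : ℝ), 0 < t →
      Integrable (fun z : RN N × ℝ => G (x - z.1) (t - z.2) * frozenSource G F φ u z.1 z.2)
        ((volume : Measure (RN N)).prod ((volume : Measure ℝ).restrict (Ioo 0 t)))) ∧
    -- `M` is the limit of the mass of `u(t)` (the kernel `G = 0` satisfies the assumptions too)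
    ((∃ (x : RN N) (t : ℝ), 0 < t ∧ G x t ≠ 0) →
      Tendsto (fun t : ℝ => ∫ x, u x t) atTop (𝓝 (limitMass F φ u))) ∧
    -- the decay estimate
    (∀ (q : ℝ≥0∞) (l : ℝ), 1 ≤ q → 0 ≤ l → l ≤ K →
      (∀ t : ℝ, 0 < t →
        MemLp (fun x => u x t - correctedProfile G F φ u x t) q volume ∧
        MemWeightedL1 l (fun x => u x t - correctedProfile G F φ u x t)) ∧
      (2 * decayRate N d A p ≠ K / d →
        ∃ e₁ e₂ : ℝ → ℝ,
          e₁ =o[atTop] (fun t : ℝ => t ^ (-(K / d))) ∧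
          e₂ =O[atTop] (fun t : ℝ => t ^ (-(2 * decayRate N d A p))) ∧
          ∀ t : ℝ, 0 < t →
            scaledNorm d q l (fun x t => u x t - correctedProfile G F φ u x t) t
              = e₁ t + e₂ t) ∧
      (2 * decayRate N d A p = K / d →
        scaledNorm d q l (fun x t => u x t - correctedProfile G F φ u x t)
          =O[atTop] (fun t : ℝ => t ^ (-(K / d)) * Real.log t))) := by
  have hd := hG.d_pos
  have hKL1 := hK1.le
  set a := decayRate N d A p with ha
  obtain ⟨c₁, hf⟩ := IsGeneralizedHeatKernel.isDecayingSource_solution hF hC.le hp hAp hu hub hK0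
  obtain ⟨c₂, hfM⟩ := hG.isDecayingSource_frozenSource (φ := φ) (u := u) hK0 hKL1 hKL hF hC.le hp hAp
  refine ⟨hf.integrable, hfM.integrable, fun x t ht => ?_,
    fun hne => hG.tendsto_integral hne hK0 hφK hF hC.le hp hAp hu hub, ?_⟩
  · have hi : IntegrableOn (fun z : RN N × ℝ => positiveKernel G (x - z.1, t - z.2) *
        frozenSource G F φ u z.1 z.2) (univ ×ˢ Ioo 0 t) (volume.prod volume) := by
      have h := hfM.integrable_kernel_mul hG hK0 hKL1 hKL x ht
      unfold spaceTime at h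
      rw [← Measure.restrict_univ (μ := (volume : Measure (RN N))), Measure.prod_restrict] at h
      exact IntegrableOn.mono_set h (prod_mono_right Ioo_subset_Ioi_self)
    rw [← Measure.restrict_univ (μ := (volume : Measure (RN N))), Measure.prod_restrict]
    refine hi.congr_fun (fun z hz => ?_) (MeasurableSet.univ.prod measurableSet_Ioo)
    simp only [positiveKernel_of_pos G _ (sub_pos.2 hz.2.2)]
  intro q l hq hl0 hlK
  have hut : ∀ t : ℝ, 0 < t → AEStronglyMeasurable (fun x => u x t) volume := fun t ht =>
    ((hub ∞ K le_top hK0 le_rfl).1.choose_spec t ht).1.1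
  have hgt : ∀ t : ℝ, 0 < t → AEStronglyMeasurable
      (fun x => correctedMass G F φ u * shiftedKernel G x t) volume := fun t ht =>
    ((hG.continuous_slice (show 0 < t + 1 by linarith)).const_mul _).aestronglyMeasurable
  have hdt : ∀ t : ℝ, 0 < t → AEStronglyMeasurable
      (fun x => duhamel G (frozenSource G F φ u) x t) volume := fun t ht =>
    hfM.aestronglyMeasurable_duhamel hG hK0 hKL1 hKL ht
  have hw : ∀ t : ℝ, 0 < t →
      AEStronglyMeasurable (fun x => u x t - correctedProfile G F φ u x t) volume := fun t ht =>
    (hut t ht).sub ((hgt t ht).add (hdt t ht))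
  -- Membership is needed for all `t > 0`, not only `t ≥ 1`. The Duhamel bound at time `t` is moved
  -- to `1 + t` with a factor depending on `t`.
  have hfin : ∀ t : ℝ, 0 < t → ∃ ε : ℝ≥0∞, ε ≠ ∞ ∧
      ScaledBound K d (1 + t) (fun x => ‖u x t - correctedProfile G F φ u x t‖ₑ) ε := by
    intro t ht
    obtain ⟨b₁, -, h₁⟩ := hub.scaledBound hK0
    obtain ⟨b₂, -, h₂⟩ := hG.scaledBound_const_mul_shiftedKernel hK0 hKL1 hKL
      (correctedMass G F φ u)
    obtain ⟨ε, hε, h₃⟩ := hfM.scaledBound_duhamel hG hK0 hKL1 hKL ht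
    have h₃' := h₃.comparable (t := 1 + t) (c := (1 + t) / t) hK0 hd ht (by linarith)
      (by rw [le_div_iff₀ ht]; linarith)
      (by
        have : 1 ≤ (1 + t) / t := by rw [le_div_iff₀ ht]; linarith
        nlinarith)
      (by rw [div_mul_cancel₀ _ ht.ne'])
    refine ⟨_, ?_, ((h₁ t ht).add ((h₂ t ht).add h₃' (hgt t ht).enorm) (hut t ht).enorm).mono
      (ae_of_all _ fun x => ?_) le_rfl⟩
    · finiteness
    · exact enorm_sub_le.trans (add_le_add le_rfl (enorm_add_le _ _))
  refine ⟨fun t ht => ?_, ?_⟩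
  · obtain ⟨ε, hε, h⟩ := hfin t ht
    exact ⟨h.memLp hε (by linarith) (hw t ht) hq,
      h.memWeightedL1 hε (by linarith) (hw t ht) hl0 hlK⟩
  have transfer : ∀ {b c : ℝ}, IsDecayingSource K d b c
      (fun x t => F x t (u x t) - frozenSource G F φ u x t) → ∀ (t : ℝ) (ε : ℝ≥0∞), 1 ≤ t →
      ScaledBound K d t (fun x => ‖asymptoticRemainder G φ
        (fun x t => F x t (u x t) - frozenSource G F φ u x t) x t‖ₑ) ε →
      ScaledBound K d t (fun x => ‖u x t - correctedProfile G F φ u x t‖ₑ) ε := by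
    intro b c hh t ε ht h
    refine h.mono ?_ le_rfl
    filter_upwards [hG.ae_sub_profile_eq hK0 hKL1 hKL hF hC.le hp hAp hu hub hh
      (show 0 < t by linarith)] with x hx
    rw [hx]
  have small : (∃ E : ℝ → ℝ≥0∞, (∀ t : ℝ, 1 ≤ t →
      ScaledBound K d t (fun x => ‖u x t - correctedProfile G F φ u x t‖ₑ) (E t)) ∧
      Tendsto (fun t => ENNReal.ofReal (t ^ (K / d)) * E t) atTop (𝓝 0)) →
      scaledNorm d q l (fun x t => u x t - correctedProfile G F φ u x t)
        =o[atTop] (fun t : ℝ => t ^ (-(K / d))) := by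
    rintro ⟨E, hE, hlim⟩
    exact scaledNorm_isLittleO hd hq hl0 hlK hw hE hlim
  -- An `o(t^{-K/d})` bound settles both cases at once, with `e₂ = 0` in the first.
  have fromSmall : scaledNorm d q l (fun x t => u x t - correctedProfile G F φ u x t)
        =o[atTop] (fun t : ℝ => t ^ (-(K / d))) → _ := fun h =>
    (⟨fun _ => ⟨_, fun _ => 0, h, isBigO_zero _ _, fun t _ => (add_zero _).symm⟩, fun _ => by
      refine h.isBigO.trans ?_
      simpa using (isBigO_refl (fun t : ℝ => t ^ (-(K / d))) atTop).mul one_isBigO_log⟩ :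
      (2 * a ≠ K / d → ∃ e₁ e₂ : ℝ → ℝ,
          e₁ =o[atTop] (fun t : ℝ => t ^ (-(K / d))) ∧
          e₂ =O[atTop] (fun t : ℝ => t ^ (-(2 * a))) ∧
          ∀ t : ℝ, 0 < t →
            scaledNorm d q l (fun x t => u x t - correctedProfile G F φ u x t) t
              = e₁ t + e₂ t) ∧
      (2 * a = K / d →
        scaledNorm d q l (fun x t => u x t - correctedProfile G F φ u x t)
          =O[atTop] (fun t : ℝ => t ^ (-(K / d)) * Real.log t)))
  -- The bootstrap: a rate `b` for `u - Mg` is added to the rate `a` of the source difference.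
  have improve : ∀ {b B : ℝ}, 0 ≤ b → 0 ≤ B → (∀ t : ℝ, 1 ≤ t → ScaledBound K d t (fun x =>
      ‖asymptoticRemainder G φ (fun x t => F x t (u x t)) x t‖ₑ) (ENNReal.ofReal (B * t ^ (-b)))) →
      ∃ c : ℝ, IsDecayingSource K d (a + b) c
        (fun x t => F x t (u x t) - frozenSource G F φ u x t) := by
    intro b B hb hB h
    refine hG.isDecayingSource_sub_of_rate hK0 hKL1 hKL hF hC.le hp hAp hu hub hb hB fun t ht => ?_
    refine (h t ht).mono ?_ le_rfl
    filter_upwards [IsGeneralizedHeatKernel.ae_sub_limit_eq hu (show 0 < t by linarith)] with x hx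
    rw [hx]
  obtain ⟨c₃, hsub⟩ := hG.isDecayingSource_sub hK0 hKL1 hKL hF hC.le hp hAp hu hub
  by_cases hne : ∃ (x : RN N) (t : ℝ), 0 < t ∧ G x t ≠ 0
  swap
  -- For the zero kernel `K < d` may fail, but the remainder vanishes identically.
  · refine fromSmall (small ⟨fun _ => 0, fun t ht => transfer hsub t 0 ht ?_, by simp⟩)
    push Not at hne
    simp_rw [hG.asymptoticRemainder_eq_zero hK0 hKL1 hKL hsub hne _ (show 0 < t by linarith),
      enorm_zero]
    exact ScaledBound.zero 0
  have hKd : K < d := hG.lt_order hne hN hK1 hKL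
  have hKd0 : 0 ≤ K / d := by positivity
  have fast : ∀ {b c : ℝ}, K / d < b → IsDecayingSource K d b c
      (fun x t => F x t (u x t) - frozenSource G F φ u x t) → _ := fun hb hh =>
    fromSmall (small (by
      obtain ⟨E, hE, hlim⟩ := hh.remainder_of_gt hG hK0 hK1 hKL hKd hφK hb
      exact ⟨E, fun t ht => transfer hh t _ ht (hE t ht), hlim⟩))
  rcases lt_trichotomy a (K / d) with hlt | heq | hgt'
  -- Below the threshold `u - Mg` decays at rate `a`, so the source difference has rate `2a`; the
  -- second application then depends on `2a` against `K/d`.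
  · obtain ⟨B, hB, h1⟩ := hf.remainder_of_lt hG hK0 hK1 hKL hKd hφK hlt
    obtain ⟨c, hc⟩ := improve hAp.le hB h1
    rw [← two_mul] at hc
    rcases lt_trichotomy (2 * a) (K / d) with h2 | h2 | h2
    · obtain ⟨B', hB', h3⟩ := hc.remainder_of_lt hG hK0 hK1 hKL hKd hφK h2
      refine ⟨fun _ => ⟨fun _ => 0, _, isLittleO_zero _ _, ?_, fun t _ => (zero_add _).symm⟩,
        fun h => absurd h h2.ne⟩
      exact scaledNorm_isBigO hd hq hl0 hlK hw hB' (fun t ht => by positivity)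
        (fun t ht => transfer hc t _ ht (h3 t ht))
    · obtain ⟨B', hB', h3⟩ := hc.remainder_of_eq hG hK0 hK1 hKL hKd hφK h2
      refine ⟨fun h => absurd h2 h, fun _ => ?_⟩
      have h4 := scaledNorm_isBigO (ρ := fun t => t ^ (-(2 * a)) * (1 + Real.log t)) hd hq hl0 hlK
        hw hB' (fun t ht => by
          have := Real.log_nonneg ht
          positivity) (fun t ht => transfer hc t _ ht (h3 t ht))
      refine h4.trans ?_
      rw [h2]
      exact (isBigO_refl _ _).mul (one_isBigO_log.add (isBigO_refl _ _))
    · exact fast h2 hc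
  -- At `a = K/d` a logarithm would appear in the first application. Lowering the rate to `3a/4`
  -- avoids it, and `a + 3a/4` still exceeds `K/d`.
  · have ha34 : 0 < 3 / 4 * a := by linarith
    obtain ⟨B, hB, h1⟩ := (hf.mono_rate ha34 (by linarith)).remainder_of_lt hG hK0 hK1 hKL hKd hφK
      (by linarith)
    obtain ⟨c, hc⟩ := improve ha34.le hB h1
    exact fast (by linarith) hc
  -- When `a > K/d` the source difference is fast even without any decay of `u - Mg`.
  · exact fast hgt' hsub
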